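/- Work over $\mathbb{C}$, with the Zariski topology on projective spaces, and identify the quadrics $\mathcal{Q}=V(Q)$ of $\mathbb{P}^3$, $Q$ a nonzero quadratic form in four variables up to scalar, with the points of $\mathbb{P}^9$. Let $\mathcal{C}\subset\mathbb{P}^3$ be an irreducible algebraic curve (an irreducible Zariski closed subset of dimension $1$). A point $m\in\mathcal{C}$ is nonsingular if the differentials $dF(\mathbf{m})$ of the homogeneous polynomials $F$ vanishing on $\mathcal{C}$ span a space of dimension $2$, where $\mathbf{m}=(m_1,\dots,m_4)$ represents $m$; the tangent line is then $\mathcal{T}_m\mathcal{C}=\bigcap_F V(dF(\mathbf{m}))$. The polar of $\mathcal{Q}$ with respect to $m$ is $\delta_m\mathcal{Q}=V\big(\sum_{i=1}^4 m_i\,\partial Q/\partial x_i\big)$. The Halphen map $\Phi_{\mathcal{C},\mathcal{Q}}$ sends a nonsingular point $m$ of $\mathcal{C}$ to the intersection point of $\mathcal{T}_m\mathcal{C}$ with $\delta_m\mathcal{Q}$, whenever this intersection is a single point. The Halphen transform $\mathcal{C}^{\mathcal{Q}}$ is the Zariski closure in $\mathbb{P}^3$ of the image of $\Phi_{\mathcal{C},\mathcal{Q}}$.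 Proposition. For every irreducible curve $\mathcal{C}\subset\mathbb{P}^3$ there is a nonempty Zariski open subset $G$ of the $\mathbb{P}^9$ of quadrics such that, for every $\mathcal{Q}=V(Q)\in G$, the form $Q$ is irreducible and $\Phi_{\mathcal{C},\mathcal{Q}}$ is a birational map from $\mathcal{C}$ onto $\mathcal{C}^{\mathcal{Q}}$: both $\mathcal{C}$ and $\mathcal{C}^{\mathcal{Q}}$ are irreducible, and $\Phi_{\mathcal{C},\mathcal{Q}}$ is defined on a nonempty Zariski open subset of $\mathcal{C}$ and restricts there to an isomorphism of varieties onto a nonempty Zariski open subset of $\mathcal{C}^{\mathcal{Q}}$. -/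

import Mathlib

open scoped LinearAlgebra.Projectivization

section

/-- The set of points of the projective space `ℙ(ℂ^σ)`, with homogeneous coordinates indexed by
`σ`, at which all the (homogeneous) polynomials of `S` vanish. -/
def projZeroLocus {σ : Type*} (S : Set (MvPolynomial σ ℂ)) : Set (ℙ ℂ (σ → ℂ)) :=
  {p | ∀ F ∈ S, MvPolynomial.eval p.rep F = 0}

/-- Being a form, that is, a homogeneous polynomial of some degree. -/
def IsForm {σ : Type*} (F : MvPolynomial σ ℂ) : Prop := ∃ d : ℕ, F.IsHomogeneous d

/-- The Zariski topology of `ℙ(ℂ^σ)`: the closed sets are the common zero loci of sets of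
homogeneous polynomials. -/
instance zariskiTopology (σ : Type*) : TopologicalSpace (ℙ ℂ (σ → ℂ)) :=
  TopologicalSpace.ofClosed
    {Z | ∃ S : Set (MvPolynomial σ ℂ), (∀ F ∈ S, IsForm F) ∧ Z = projZeroLocus S}
    (by
      refine ⟨{1}, ?_, ?_⟩
      · rintro F rfl
        exact ⟨0, MvPolynomial.isHomogeneous_one σ ℂ⟩
      · ext p
        simp [projZeroLocus])
    (by
      intro A hA
      refine ⟨{F | IsForm F ∧ ∀ p ∈ ⋂₀ A, MvPolynomial.eval p.rep F = 0}, fun F hF => hF.1, ?_⟩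
      ext p
      constructor
      · exact fun hp F hF => hF.2 p hp
      · intro hp Z hZ
        obtain ⟨S, hS, rfl⟩ := hA hZ
        intro F hF
        exact hp F ⟨hS F hF, fun q hq => hq _ hZ F hF⟩)
    (by
      rintro _ ⟨S, hS, rfl⟩ _ ⟨T, hT, rfl⟩
      refine ⟨{H | ∃ F ∈ S, ∃ G ∈ T, H = F * G}, ?_, ?_⟩
      · rintro _ ⟨F, hF, G, hG, rfl⟩
        obtain ⟨d, hd⟩ := hS F hF
        obtain ⟨e, he⟩ := hT G hG
        exact ⟨d + e, hd.mul he⟩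
      · ext p
        constructor
        · rintro (hp | hp)
          · rintro _ ⟨F, hF, G, hG, rfl⟩
            simp [hp F hF]
          · rintro _ ⟨F, hF, G, hG, rfl⟩
            simp [hp G hG]
        · intro hp
          by_contra hcon
          rw [Set.mem_union, not_or] at hcon
          obtain ⟨h1, h2⟩ := hcon
          simp only [projZeroLocus, Set.mem_ofPred_eq, not_forall] at h1 h2
          obtain ⟨F, hF, hF0⟩ := h1
          obtain ⟨G, hG, hG0⟩ := h2
          have := hp (F * G) ⟨F, hF, G, hG, rfl⟩
          rw [map_mul, mul_eq_zero] at this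
          exact this.elim hF0 hG0)

/-- An irreducible algebraic curve: an irreducible Zariski closed subset of dimension one. -/
structure IsIrreducibleCurve {σ : Type*} (C : Set (ℙ ℂ (σ → ℂ))) : Prop where
  isClosed : IsClosed C
  isIrreducible : IsIrreducible C
  dim_eq_one : topologicalKrullDim C = 1

/-- `f` is a regular map (a morphism) from the locally closed set `U` to `ℙ(ℂ^τ)`: Zariski
locally on `U`, it is given by forms of one and the same degree without common zero. -/
def IsRegularOn {σ τ : Type*} (f : ℙ ℂ (σ → ℂ) → ℙ ℂ (τ → ℂ)) (U : Set (ℙ ℂ (σ → ℂ))) : Prop :=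
  ∀ x ∈ U, ∃ (D : Set (ℙ ℂ (σ → ℂ))) (d : ℕ) (F : τ → MvPolynomial σ ℂ),
    IsOpen D ∧ x ∈ D ∧ (∀ j, (F j).IsHomogeneous d) ∧
    ∀ y ∈ U ∩ D, ∃ h : (fun j => MvPolynomial.eval y.rep (F j)) ≠ 0,
      f y = Projectivization.mk ℂ (fun j => MvPolynomial.eval y.rep (F j)) h

/-- The partially defined map `φ` is a birational map from the irreducible variety `X` to the
irreducible variety `Y`: it restricts to an isomorphism from a nonempty Zariski open subset `U`
of `X` to a nonempty Zariski open subset `V` of `Y`. -/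
def IsBirational {σ τ : Type*} (φ : ℙ ℂ (σ → ℂ) →. ℙ ℂ (τ → ℂ))
    (X : Set (ℙ ℂ (σ → ℂ))) (Y : Set (ℙ ℂ (τ → ℂ))) : Prop :=
  IsIrreducible X ∧ IsIrreducible Y ∧
  ∃ (U : Set (ℙ ℂ (σ → ℂ))) (V : Set (ℙ ℂ (τ → ℂ))),
    (∃ O, IsOpen O ∧ U = X ∩ O) ∧ U.Nonempty ∧
    (∃ O, IsOpen O ∧ V = Y ∩ O) ∧ V.Nonempty ∧
    ∃ (f : ℙ ℂ (σ → ℂ) → ℙ ℂ (τ → ℂ)) (g : ℙ ℂ (τ → ℂ) → ℙ ℂ (σ → ℂ)),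
      (∀ m ∈ U, f m ∈ φ m) ∧ IsRegularOn f U ∧ IsRegularOn g V ∧
      Set.MapsTo f U V ∧ Set.MapsTo g V U ∧ Set.InvOn g f U V

/-- The homogeneous polynomials that vanish on `C`; they generate the homogeneous ideal of `C`. -/
def vanishingForms {σ : Type*} (C : Set (ℙ ℂ (σ → ℂ))) : Set (MvPolynomial σ ℂ) :=
  {F | IsForm F ∧ ∀ p ∈ C, MvPolynomial.eval p.rep F = 0}

/-- The gradient of `F` at (a representative of) `m`. -/
noncomputable def gradAt {σ : Type*} (F : MvPolynomial σ ℂ) (m : ℙ ℂ (σ → ℂ)) : σ → ℂ :=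
  fun i => MvPolynomial.eval m.rep (MvPolynomial.pderiv i F)

/-- `m` is a nonsingular point of the space curve `C`: the differentials at `m` of the equations
of `C` span a space of dimension two. -/
def IsNonsingularPoint (C : Set (ℙ ℂ (Fin 4 → ℂ))) (m : ℙ ℂ (Fin 4 → ℂ)) : Prop :=
  m ∈ C ∧ Module.finrank ℂ
    (Submodule.span ℂ {v : Fin 4 → ℂ | ∃ F ∈ vanishingForms C, v = gradAt F m}) = 2

/-- The tangent line to the space curve `C` at a nonsingular point `m`: the intersection of the
planes `V(dF(m))`, where `F` runs through the equations of `C`. -/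
def tangentLine (C : Set (ℙ ℂ (Fin 4 → ℂ))) (m : ℙ ℂ (Fin 4 → ℂ)) : Set (ℙ ℂ (Fin 4 → ℂ)) :=
  {p | ∀ F ∈ vanishingForms C, ∑ i, gradAt F m i * p.rep i = 0}

/-- The quadratic form of a quadric of `ℙ³`. The quadrics are the points of
`ℙ⁹ = ℙ(ℂ^{Sym2 (Fin 4)})`, whose homogeneous coordinates are the coefficients of the ten
monomials `X i * X j`. -/
noncomputable def quadraticFormOf (q : ℙ ℂ (Sym2 (Fin 4) → ℂ)) : MvPolynomial (Fin 4) ℂ :=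
  ∑ s : Sym2 (Fin 4), MvPolynomial.C (q.rep s) *
    Sym2.lift ⟨fun i j => MvPolynomial.X i * MvPolynomial.X j, fun _ _ => mul_comm _ _⟩ s

/-- The polar of `V(Q)` with respect to `m = [m₀ : m₁ : m₂ : m₃]`: the zero locus of
`Δ_m Q = ∑ i, mᵢ ∂Q/∂Xᵢ`. -/
def polarPlane (Q : MvPolynomial (Fin 4) ℂ) (m : ℙ ℂ (Fin 4 → ℂ)) : Set (ℙ ℂ (Fin 4 → ℂ)) :=
  {p | ∑ i, m.rep i * gradAt Q p i = 0}

/-- The Halphen map of the space curve `C` with respect to the quadric `V(Q)`. It sends a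
nonsingular point `m` of `C` to the intersection point of the tangent line to `C` at `m` with the
polar of `V(Q)` with respect to `m`, and is defined where this intersection is a single point. -/
noncomputable def halphenMap (C : Set (ℙ ℂ (Fin 4 → ℂ))) (Q : MvPolynomial (Fin 4) ℂ) :
    ℙ ℂ (Fin 4 → ℂ) →. ℙ ℂ (Fin 4 → ℂ) :=
  fun m => ⟨IsNonsingularPoint C m ∧ ∃ p, tangentLine C m ∩ polarPlane Q m = {p},
    fun h => h.2.choose⟩

theorem mem_halphenMap {C : Set (ℙ ℂ (Fin 4 → ℂ))} {Q : MvPolynomial (Fin 4) ℂ}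
    {m p : ℙ ℂ (Fin 4 → ℂ)} :
    p ∈ halphenMap C Q m ↔
      IsNonsingularPoint C m ∧ tangentLine C m ∩ polarPlane Q m = {p} := by
  constructor
  · rintro ⟨h, rfl⟩
    exact ⟨h.1, h.2.choose_spec⟩
  · rintro ⟨h, hp⟩
    have h' : ∃ p, tangentLine C m ∩ polarPlane Q m = {p} := ⟨p, hp⟩
    exact ⟨⟨h, h'⟩, Set.singleton_injective (h'.choose_spec.symm.trans hp)⟩

/-- The Halphen transform: the Zariski closure of the image of the Halphen map. -/
def halphenTransform (C : Set (ℙ ℂ (Fin 4 → ℂ))) (Q : MvPolynomial (Fin 4) ℂ) :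
    Set (ℙ ℂ (Fin 4 → ℂ)) :=
  closure (halphenMap C Q).ran

end

/-!
Let `K` be the function field of `C`, of transcendence degree one over `ℂ`, and let `m` be the
generic point of `C`: a vector over `K`, normalised by `m i₀ = 1`, at which exactly the forms
vanishing on `C` vanish. A nonzero derivation `D` of `K` gives the point `m' = D ∘ m`, and the line
through `m` and `m'` is the tangent line at `m` (`exists_eq_add_of_tangent`): a vector killed by all
the differentials at `m` is, up to a multiple of `m`, a derivation of `K`, and these are the
multiples of `D`. If `B` is the polar form of the quadric `q`, the Halphen map therefore sends `m` to
`p = B(m, m') m - B(m, m) m'` (`halphenVector`). Where two suitable equations of `C` have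
independent differentials, the map is given by the vector product of these differentials and of the
coefficients of the polar plane (`halphenForms`), so that `p` is a generic point of the Halphen
transform. Birationality amounts to expressing `m` by forms in `p`, with coefficients in `ℂ`
(`IsGenericVector.isBirational`).

This is done first for the generic quadric, whose coefficients `b` are independent over `K`
(`algebraMap_mem_adjoin_halphenVector`). Let `M` be the field generated over `ℂ` by `b` and by the
ratios of the coordinates of `p`. If a ratio `z` is not constant for the extension of `D` that kills
`b`, then `K(b)` is algebraic over `ℂ(b, z)`. The derivation `∂/∂b_s - (∂z/∂b_s / Dz) D` maps
`ℂ(b, z)` into itself, hence `M` into itself. When `b_s` varies, `p` moves along the line `⟨m, m'⟩`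
with a speed proportional to the polar form of the monomial `s` at `(m, p)`
(`partial_halphenVector_div`). Applied to a second ratio, the derivation thus shows that the
symmetric product of `m` and `p` is rational over `M` up to a common factor, and this determines `m`
(`mem_adjoin_of_ne`). The factor is nonzero unless `p` moves along `⟨m, m'⟩` under `D` as well; then
`m''` is proportional to `m'` (`second_derivative_mul_eq`), `C` is a line, and the Halphen map is an
involution of this line, given by an explicit formula (`mem_adjoin_of_line`).

Specialising the coefficients, the formulas remain valid for all quadrics outside a hypersurface
(`exists_inverse_forms`), whose equation over `K` is replaced by one over `ℂ` by applying a linear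
functional. The quadrics of nonzero discriminant are irreducible (`irreducible_quadraticFormOf`).
-/

universe u

/-! ### Extending derivations -/

open KaehlerDifferential TensorProduct in
theorem Derivation.exists_extend_of_formallyEtale {R S T M : Type*} [CommRing R] [CommRing S]
    [CommRing T] [Algebra R S] [Algebra S T] [Algebra R T] [IsScalarTower R S T]
    [Algebra.FormallyEtale S T] [AddCommGroup M] [Module T M] [Module S M] [Module R M]
    [IsScalarTower S T M] [IsScalarTower R T M] [IsScalarTower R S M] (d : Derivation R S M) :
    ∃ D : Derivation R T M, ∀ s, D (algebraMap S T s) = d s := by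
  refine ⟨(d.liftKaehlerDifferential.liftBaseChange T ∘ₗ
    (tensorKaehlerEquivOfFormallyEtale R S T).symm.toLinearMap).compDer (KaehlerDifferential.D R T),
    fun s => ?_⟩
  have := tensorKaehlerEquivOfFormallyEtale_symm_D_algebraMap R S T s
  change (d.liftKaehlerDifferential.liftBaseChange T)
    ((tensorKaehlerEquivOfFormallyEtale R S T).symm (KaehlerDifferential.D R T _)) = _
  simp [this]

theorem Derivation.ext_of_formallyUnramified {R S T M : Type*} [CommRing R] [CommRing S]
    [CommRing T] [Algebra S T] [Algebra R T]
    [Algebra.FormallyUnramified S T] [AddCommGroup M] [Module T M] [Module R M]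
    {D₁ D₂ : Derivation R T M}
    (h : ∀ s, D₁ (algebraMap S T s) = D₂ (algebraMap S T s)) : D₁ = D₂ := by
  let : Module S M := Module.compHom M (algebraMap S T)
  have : IsScalarTower S T M := ⟨fun s t m => by
    rw [Algebra.smul_def, mul_smul]; rfl⟩
  let E : Derivation S T M :=
    { toFun := fun t => D₁ t - D₂ t
      map_add' := fun a b => by simp [add_sub_add_comm]
      map_smul' := fun s t => by
        rw [Algebra.smul_def]
        simp only [Derivation.leibniz, h s, RingHom.id_apply]
        rw [add_sub_add_right_eq_sub, ← smul_sub]; rfl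
      map_one_eq_zero' := by simp
      leibniz' := fun a b => by simp [smul_sub]; abel }
  ext t
  have h0 : E t = 0 := by
    rw [← E.liftKaehlerDifferential_comp_D t, Subsingleton.elim (KaehlerDifferential.D S T t) 0,
      map_zero]
  exact sub_eq_zero.mp h0

/-- In characteristic zero, a field is formally étale over the polynomial ring in a transcendence
basis. -/
theorem IsTranscendenceBasis.formallyEtale {ι k L : Type*} [Field k] [CharZero k] [Field L]
    [Algebra k L] [Algebra (MvPolynomial ι k) L] [IsScalarTower k (MvPolynomial ι k) L]
    (hx : IsTranscendenceBasis k fun i => algebraMap (MvPolynomial ι k) L (MvPolynomial.X i)) :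
    Algebra.FormallyEtale (MvPolynomial ι k) L := by
  have hmap : (algebraMap (MvPolynomial ι k) L) = (MvPolynomial.aeval
      fun i => algebraMap (MvPolynomial ι k) L (MvPolynomial.X i) :
      MvPolynomial ι k →ₐ[k] L).toRingHom := by
    refine MvPolynomial.ringHom_ext (fun a => ?_) (fun i => ?_)
    · rw [← MvPolynomial.algebraMap_eq, ← IsScalarTower.algebraMap_apply]
      exact (AlgHom.commutes (MvPolynomial.aeval _ : MvPolynomial ι k →ₐ[k] L) a).symm
    · exact (MvPolynomial.aeval_X
        (fun i => algebraMap (MvPolynomial ι k) L (MvPolynomial.X i)) i).symm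
  have hinj : Function.Injective (algebraMap (MvPolynomial ι k) L) := by
    rw [hmap]; exact hx.1
  have : FaithfulSMul (MvPolynomial ι k) L := (faithfulSMul_iff_algebraMap_injective _ _).mpr hinj
  let : Algebra (FractionRing (MvPolynomial ι k)) L := FractionRing.liftAlgebra _ _
  have hadj := hx.isAlgebraic
  have : Algebra.IsAlgebraic (MvPolynomial ι k) L := by
    refine Algebra.IsAlgebraic.of_ringHom_of_comp_eq hx.1.aevalEquiv (RingHom.id L)
      hx.1.aevalEquiv.surjective Function.injective_id ?_
    refine RingHom.ext fun s => ?_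
    exact (hx.1.algebraMap_aevalEquiv s).trans (RingHom.congr_fun hmap s).symm
  have : Algebra.IsAlgebraic (FractionRing (MvPolynomial ι k)) L :=
    IsFractionRing.comap_isAlgebraic_iff (A := MvPolynomial ι k).mp this
  have : CharZero (FractionRing (MvPolynomial ι k)) :=
    charZero_of_injective_algebraMap (IsFractionRing.injective (MvPolynomial ι k) _)
  have := Algebra.FormallyEtale.of_isLocalization (R := MvPolynomial ι k)
    (Rₘ := FractionRing (MvPolynomial ι k)) (nonZeroDivisors _)
  have := Algebra.FormallyEtale.of_isSeparable (FractionRing (MvPolynomial ι k)) L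
  exact Algebra.FormallyEtale.comp _ (FractionRing (MvPolynomial ι k)) _

/-- The values of a derivation on a transcendence basis may be prescribed. -/
theorem IsTranscendenceBasis.exists_derivation {ι k L M : Type*} [Field k] [CharZero k] [Field L]
    [Algebra k L] [AddCommGroup M] [Module L M] [Module k M] [IsScalarTower k L M] {x : ι → L}
    (hx : IsTranscendenceBasis k x) (v : ι → M) :
    ∃ D : Derivation k L M, ∀ i, D (x i) = v i := by
  let : Algebra (MvPolynomial ι k) L := (MvPolynomial.aeval x : _ →ₐ[k] L).toAlgebra
  have hX : ∀ i, algebraMap (MvPolynomial ι k) L (MvPolynomial.X i) = x i :=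
    fun i => MvPolynomial.aeval_X x i
  have : IsScalarTower k (MvPolynomial ι k) L :=
    .of_algebraMap_eq fun r => (AlgHom.commutes (MvPolynomial.aeval x : _ →ₐ[k] L) r).symm
  have : Algebra.FormallyEtale (MvPolynomial ι k) L :=
    IsTranscendenceBasis.formallyEtale (by simpa only [hX] using hx)
  let : Module (MvPolynomial ι k) M := Module.compHom M (algebraMap (MvPolynomial ι k) L)
  have : IsScalarTower (MvPolynomial ι k) L M := ⟨fun s t m => by
    rw [Algebra.smul_def, mul_smul]; rfl⟩
  have : IsScalarTower k (MvPolynomial ι k) M := ⟨fun s t m => by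
    rw [← IsScalarTower.algebraMap_smul L t, ← IsScalarTower.algebraMap_smul L (s • t),
      ← smul_assoc, ← algebraMap.coe_smul]⟩
  obtain ⟨D, hD⟩ := Derivation.exists_extend_of_formallyEtale (T := L)
    (MvPolynomial.mkDerivation k v)
  refine ⟨D, fun i => ?_⟩
  rw [← hX, hD, MvPolynomial.mkDerivation_X]

theorem IsTranscendenceBasis.derivation_ext {ι k L M : Type*} [Field k] [CharZero k] [Field L]
    [Algebra k L] [AddCommGroup M] [Module L M] [Module k M] {x : ι → L}
    (hx : IsTranscendenceBasis k x)
    {D₁ D₂ : Derivation k L M} (h : ∀ i, D₁ (x i) = D₂ (x i)) : D₁ = D₂ := by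
  let : Algebra (MvPolynomial ι k) L := (MvPolynomial.aeval x : _ →ₐ[k] L).toAlgebra
  have hX : ∀ i, algebraMap (MvPolynomial ι k) L (MvPolynomial.X i) = x i :=
    fun i => MvPolynomial.aeval_X x i
  have : IsScalarTower k (MvPolynomial ι k) L :=
    .of_algebraMap_eq fun r => (AlgHom.commutes (MvPolynomial.aeval x : _ →ₐ[k] L) r).symm
  have : Algebra.FormallyEtale (MvPolynomial ι k) L :=
    IsTranscendenceBasis.formallyEtale (by simpa only [hX] using hx)
  refine Derivation.ext_of_formallyUnramified (S := MvPolynomial ι k) fun s => ?_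
  induction s using MvPolynomial.induction_on with
  | C a =>
    rw [← MvPolynomial.algebraMap_eq, ← IsScalarTower.algebraMap_apply, D₁.map_algebraMap,
      D₂.map_algebraMap]
  | add p q hp hq => rw [map_add, map_add, map_add, hp, hq]
  | mul_X p i hp => rw [map_mul, D₁.leibniz, D₂.leibniz, hp, hX, h]

/-- A derivation which maps a subfield into a larger one still does so on the algebraic elements of
the larger one. -/
theorem Derivation.apply_mem_of_isAlgebraic {k L : Type*} [Field k] [CharZero k] [Field L]
    [Algebra k L] (D : Derivation k L L) {F M : IntermediateField k L} (hFM : F ≤ M)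
    (hD : ∀ a ∈ F, D a ∈ M) {x : L} (hxM : x ∈ M) (hx : IsAlgebraic F x) : D x ∈ M := by
  have hsep : (minpoly F x).Separable := (minpoly.irreducible hx.isIntegral).separable
  have h0 : Polynomial.aeval x (Polynomial.derivative (minpoly F x)) ≠ 0 :=
    hsep.aeval_derivative_ne_zero (minpoly.aeval F x)
  have key : ∀ p : Polynomial F,
      D (Polynomial.aeval x p) - Polynomial.aeval x (Polynomial.derivative p) * D x ∈ M := by
    intro p
    induction p using Polynomial.induction_on' with
    | add p q hp hq =>
      convert M.add_mem hp hq using 1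
      simp only [map_add]
      ring
    | monomial n a =>
      have : D (Polynomial.aeval x (Polynomial.monomial n a)) -
          Polynomial.aeval x (Polynomial.derivative (Polynomial.monomial n a)) * D x =
          x ^ n * D a := by
        simp only [Polynomial.aeval_monomial, Derivation.leibniz, Derivation.leibniz_pow,
          Polynomial.derivative_monomial, map_mul, smul_eq_mul, nsmul_eq_mul,
          IntermediateField.algebraMap_apply]
        push_cast
        ring
      rw [this]
      exact M.mul_mem (pow_mem hxM n) (hD a a.2)
  have hmem : Polynomial.aeval x (Polynomial.derivative (minpoly F x)) ∈ M := by
    have : Polynomial.aeval x (Polynomial.derivative (minpoly F x)) = (Polynomial.aeval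
        (⟨x, hxM⟩ : M) ((Polynomial.derivative (minpoly F x)).map
          (IntermediateField.inclusion hFM).toRingHom) : M) := by
      rw [Polynomial.aeval_def, Polynomial.aeval_def, Polynomial.eval₂_map,
        ← IntermediateField.algebraMap_apply, Polynomial.hom_eval₂]
      rfl
    rw [this]
    exact SetLike.coe_mem _
  have := key (minpoly F x)
  rw [minpoly.aeval, map_zero, zero_sub, neg_mem_iff] at this
  convert M.mul_mem (M.inv_mem hmem) this using 1
  field_simp

/-! ### The polar form and the Halphen point of a tangent line -/

/-- The polar form of the monomial `X i * X j`, where `s` is the pair `{i, j}`. -/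
def polarMonomial {τ R : Type*} [CommRing R] (s : Sym2 τ) (u v : τ → R) : R :=
  Sym2.lift ⟨fun i j => u i * v j + u j * v i, fun _ _ => add_comm _ _⟩ s

/-- The polar form of the quadratic form with coefficients `b`; its value on the diagonal is twice
the quadratic form. -/
def polarForm {τ R : Type*} [Fintype τ] [DecidableEq τ] [CommRing R] (b : Sym2 τ → R)
    (u v : τ → R) : R :=
  ∑ s, b s * polarMonomial s u v

/-- The point of the line through `m` and `m'` that is conjugate to `m` with respect to the
quadratic form with coefficients `b`. -/
def halphenVector {τ R : Type*} [Fintype τ] [DecidableEq τ] [CommRing R] (b : Sym2 τ → R)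
    (m m' : τ → R) : τ → R :=
  polarForm b m m' • m - polarForm b m m • m'

section PolarForm

variable {τ R : Type*} [CommRing R]

@[simp]
theorem polarMonomial_mk (i j : τ) (u v : τ → R) :
    polarMonomial s(i, j) u v = u i * v j + u j * v i := rfl

theorem polarMonomial_comm (s : Sym2 τ) (u v : τ → R) :
    polarMonomial s u v = polarMonomial s v u := by
  induction s with | _ i j => simp only [polarMonomial_mk]; ring

theorem polarMonomial_add_left (s : Sym2 τ) (u u' v : τ → R) :
    polarMonomial s (u + u') v = polarMonomial s u v + polarMonomial s u' v := by
  induction s with | _ i j => simp only [polarMonomial_mk, Pi.add_apply]; ring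

theorem polarMonomial_smul_left (s : Sym2 τ) (c : R) (u v : τ → R) :
    polarMonomial s (c • u) v = c * polarMonomial s u v := by
  induction s with | _ i j => simp only [polarMonomial_mk, Pi.smul_apply, smul_eq_mul]; ring

theorem map_polarMonomial {R' : Type*} [CommRing R'] (f : R →+* R') (s : Sym2 τ) (u v : τ → R) :
    f (polarMonomial s u v) = polarMonomial s (f ∘ u) (f ∘ v) := by
  induction s with | _ i j => simp

theorem Derivation.apply_polarMonomial {k : Type*} [CommRing k] [Algebra k R]
    (D : Derivation k R R) (s : Sym2 τ) {u v : τ → R} (hu : ∀ i, D (u i) = 0)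
    (hv : ∀ i, D (v i) = 0) : D (polarMonomial s u v) = 0 := by
  induction s with | _ i j => simp [hu, hv]

variable [Fintype τ] [DecidableEq τ] (b : Sym2 τ → R)

theorem polarForm_comm (u v : τ → R) : polarForm b u v = polarForm b v u :=
  Finset.sum_congr rfl fun s _ => by rw [polarMonomial_comm]

theorem polarForm_add_left (u u' v : τ → R) :
    polarForm b (u + u') v = polarForm b u v + polarForm b u' v := by
  simp only [polarForm, polarMonomial_add_left, mul_add, Finset.sum_add_distrib]

theorem polarForm_smul_left (c : R) (u v : τ → R) :
    polarForm b (c • u) v = c * polarForm b u v := by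
  simp only [polarForm, polarMonomial_smul_left, Finset.mul_sum]
  exact Finset.sum_congr rfl fun s _ => by ring

theorem polarForm_add_right (u v v' : τ → R) :
    polarForm b u (v + v') = polarForm b u v + polarForm b u v' := by
  rw [polarForm_comm, polarForm_add_left, polarForm_comm b v, polarForm_comm b v']

theorem polarForm_smul_right (c : R) (u v : τ → R) :
    polarForm b u (c • v) = c * polarForm b u v := by
  rw [polarForm_comm, polarForm_smul_left, polarForm_comm]

theorem map_polarForm {R' : Type*} [CommRing R'] (f : R →+* R') (u v : τ → R) :
    f (polarForm b u v) = polarForm (f ∘ b) (f ∘ u) (f ∘ v) := by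
  simp [polarForm, map_polarMonomial]

theorem map_halphenVector {R' : Type*} [CommRing R'] (f : R →+* R') (m m' : τ → R) (i : τ) :
    f (halphenVector b m m' i) = halphenVector (f ∘ b) (f ∘ m) (f ∘ m') i := by
  simp [halphenVector, map_polarForm]

/-- If `D` is the partial derivative in the direction of the coefficient `b s`, then `D` of the
polar form is the polar form of the corresponding monomial. -/
theorem Derivation.apply_polarForm {k : Type*} [CommRing k] [Algebra k R]
    (D : Derivation k R R) {s : Sym2 τ} (hb : ∀ t, D (b t) = if t = s then 1 else 0)
    {u v : τ → R} (hu : ∀ i, D (u i) = 0) (hv : ∀ i, D (v i) = 0) :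
    D (polarForm b u v) = polarMonomial s u v := by
  simp only [polarForm, map_sum, Derivation.leibniz, D.apply_polarMonomial _ hu hv, hb,
    zero_add, smul_eq_mul, mul_ite, mul_one, mul_zero, Finset.sum_ite_eq', Finset.mem_univ, if_true]

end PolarForm

/-- Membership in a subfield generated by `S` is stable under a derivation as soon as this holds for
the elements of `S`. -/
theorem Derivation.apply_mem_of_mem_adjoin {k L : Type*} [Field k] [Field L] [Algebra k L]
    (D : Derivation k L L) {S : Set L} {M : IntermediateField k L}
    (hSM : IntermediateField.adjoin k S ≤ M) (hS : ∀ a ∈ S, D a ∈ M) {a : L}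
    (ha : a ∈ IntermediateField.adjoin k S) : D a ∈ M := by
  induction ha using IntermediateField.adjoin_induction with
  | mem x hx => exact hS x hx
  | algebraMap r => simp
  | add x y _ _ hx hy => rw [map_add]; exact M.add_mem hx hy
  | inv x hx' hx =>
    rw [D.leibniz_inv, smul_eq_mul]
    exact M.mul_mem (M.neg_mem (pow_mem (M.inv_mem (hSM hx')) 2)) hx
  | mul x y hx' hy' hx hy =>
    rw [D.leibniz]
    exact M.add_mem (M.mul_mem (hSM hx') hy) (M.mul_mem (hSM hy') hx)

theorem polarMonomial_comp_mem {k L τ : Type*} [Field k] [Field L] [Algebra k L]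
    (M : IntermediateField k L) (s : Sym2 τ) {u v : τ → L} (hu : ∀ i, u i ∈ M)
    (hv : ∀ i, v i ∈ M) : polarMonomial s u v ∈ M := by
  induction s with
  | _ i j => exact M.add_mem (M.mul_mem (hu _) (hv _)) (M.mul_mem (hu _) (hv _))

theorem polarForm_mem {k L τ : Type*} [Field k] [Field L] [Algebra k L] [Fintype τ]
    [DecidableEq τ] (M : IntermediateField k L) {b : Sym2 τ → L} {u v : τ → L} (hb : ∀ s, b s ∈ M)
    (hu : ∀ i, u i ∈ M) (hv : ∀ i, v i ∈ M) : polarForm b u v ∈ M :=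
  sum_mem fun s _ => M.mul_mem (hb s) (polarMonomial_comp_mem M s hu hv)

/-! ### Rationality of the generic point over the field of the generic Halphen point -/

section Generic

variable {k L τ : Type*} [Field k] [Field L] [Algebra k L] [Fintype τ]
  [DecidableEq τ] {b : Sym2 τ → L} {m m' : τ → L} {i₀ j₀ : τ}

/-- The key computation: when the coefficient `b s` of the quadric varies, the Halphen point moves
along the tangent line, with a speed whose dependence on `s` is that of `polarMonomial s m p`. -/
theorem partial_halphenVector_div (E : Derivation k L L) {s : Sym2 τ}
    (hb : ∀ t, E (b t) = if t = s then 1 else 0) (hm : ∀ i, E (m i) = 0)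
    (hm' : ∀ i, E (m' i) = 0) (i : τ) :
    E (halphenVector b m m' i / halphenVector b m m' j₀) =
      polarMonomial s m (halphenVector b m m') *
        ((m i * m' j₀ - m' i * m j₀) / halphenVector b m m' j₀ ^ 2) := by
  have key : ∀ j, E (halphenVector b m m' j) =
      polarMonomial s m m' * m j - polarMonomial s m m * m' j := by
    intro j
    simp only [halphenVector, Pi.sub_apply, Pi.smul_apply, smul_eq_mul, map_sub,
      Derivation.leibniz, hm, hm', E.apply_polarForm b hb hm hm',
      E.apply_polarForm b hb hm hm]
    ring
  have h1 : polarMonomial s m (halphenVector b m m') =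
      polarForm b m m' * polarMonomial s m m - polarForm b m m * polarMonomial s m m' := by
    have : halphenVector b m m' = polarForm b m m' • m + (-polarForm b m m) • m' := by
      rw [halphenVector, neg_smul, sub_eq_add_neg]
    rw [this, polarMonomial_comm, polarMonomial_add_left, polarMonomial_smul_left,
      polarMonomial_smul_left, polarMonomial_comm s m' m]
    ring
  rw [Derivation.leibniz_div, key, key, h1, inv_pow, smul_eq_mul, inv_mul_eq_div, ← mul_div_assoc]
  congr 1
  simp only [halphenVector, Pi.sub_apply, Pi.smul_apply, smul_eq_mul]
  ring

/-- If the line `⟨m, m'⟩` is not the tangent line of the curve described by the Halphen point, then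
`m` is rational over the field `M` generated by the coefficients of the quadric and the coordinates
of the Halphen point: `M` is stable under the derivation along the coefficient `b s` that fixes a
nonconstant coordinate of the Halphen point, and this gives the symmetric product of `m` and the
Halphen point up to a common factor. -/
theorem mem_adjoin_of_ne [CharZero k] (D : Derivation k L L) (E : Sym2 τ → Derivation k L L)
    (hDb : ∀ t, D (b t) = 0) (hEb : ∀ s t, E s (b t) = if t = s then 1 else 0)
    (hEm : ∀ s i, E s (m i) = 0) (hEm' : ∀ s i, E s (m' i) = 0)
    (halg : ∀ z, D z ≠ 0 →
      Algebra.IsAlgebraic (IntermediateField.adjoin k (insert z (Set.range b))) L)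
    (hm₀ : m i₀ = 1) (h₀ : halphenVector b m m' j₀ ≠ 0)
    (hne : ∃ i j, (m i * m' j₀ - m' i * m j₀) *
        D (halphenVector b m m' j / halphenVector b m m' j₀) ≠
      (m j * m' j₀ - m' j * m j₀) * D (halphenVector b m m' i / halphenVector b m m' j₀)) (i : τ) :
    m i ∈ IntermediateField.adjoin k
      (Set.range b ∪ Set.range fun j => halphenVector b m m' j / halphenVector b m m' j₀) := by
  set q := halphenVector b m m' with hq
  set M := IntermediateField.adjoin k (Set.range b ∪ Set.range fun j => q j / q j₀) with hM
  have hbM : ∀ t, b t ∈ M := fun t => IntermediateField.subset_adjoin _ _ (.inl ⟨t, rfl⟩)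
  have hpM : ∀ j, q j / q j₀ ∈ M := fun j => IntermediateField.subset_adjoin _ _ (.inr ⟨j, rfl⟩)
  obtain ⟨i₁, j₁, hne, hD⟩ : ∃ i j, (m i * m' j₀ - m' i * m j₀) * D (q j / q j₀) ≠
      (m j * m' j₀ - m' j * m j₀) * D (q i / q j₀) ∧ D (q j / q j₀) ≠ 0 := by
    obtain ⟨i, j, hne⟩ := hne
    by_cases hj : D (q j / q j₀) = 0
    · refine ⟨j, i, hne.symm, fun hi => hne ?_⟩
      rw [hi, hj, mul_zero, mul_zero]
    · exact ⟨i, j, hne, hj⟩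
  set z := q j₁ / q j₀ with hz
  have hFM : IntermediateField.adjoin k (insert z (Set.range b)) ≤ M := by
    rw [IntermediateField.adjoin_le_iff, Set.insert_subset_iff]
    exact ⟨hpM j₁, by rintro _ ⟨t, rfl⟩; exact hbM t⟩
  -- `M` is stable under the derivations that fix `z`, as it is algebraic over `k(b, z)`
  have hstab : ∀ s, (E s - (E s z / D z) • D) (q i₁ / q j₀) ∈ M := by
    intro s
    refine Derivation.apply_mem_of_isAlgebraic _ hFM (fun a ha => ?_) (hpM i₁)
      ((halg z hD).isAlgebraic _)
    refine Derivation.apply_mem_of_mem_adjoin _ hFM ?_ ha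
    rintro a (rfl | ⟨t, rfl⟩)
    · have : (E s - (E s z / D z) • D) z = 0 := by simp [hD]
      rw [this]
      exact M.zero_mem
    · have : (E s - (E s z / D z) • D) (b t) = if t = s then 1 else 0 := by simp [hDb, hEb]
      rw [this]
      split_ifs
      · exact M.one_mem
      · exact M.zero_mem
  -- their values at the ratio `q i₁ / q j₀` are the entries of the symmetric product of `m` and
  -- `q`, up to the common factor `c`
  obtain ⟨c, hc, hcM⟩ : ∃ c ≠ 0, ∀ s, c * polarMonomial s m (fun j => q j / q j₀) ∈ M := by
    refine ⟨q j₀ * (((m i₁ * m' j₀ - m' i₁ * m j₀) * D z -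
      (m j₁ * m' j₀ - m' j₁ * m j₀) * D (q i₁ / q j₀)) / (q j₀ ^ 2 * D z)),
      mul_ne_zero h₀ (div_ne_zero (sub_ne_zero.mpr hne) (mul_ne_zero (pow_ne_zero 2 h₀) hD)),
      fun s => ?_⟩
    have hs := hstab s
    have h1 := partial_halphenVector_div (j₀ := j₀) (E s) (hEb s) (hEm s) (hEm' s) i₁
    have h2 := partial_halphenVector_div (j₀ := j₀) (E s) (hEb s) (hEm s) (hEm' s) j₁
    rw [← hq] at h1 h2
    have h3 : polarMonomial s m (fun j => q j / q j₀) = (q j₀)⁻¹ * polarMonomial s m q := by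
      have : (fun j => q j / q j₀) = (q j₀)⁻¹ • q := by
        ext j; simp [div_eq_inv_mul]
      rw [this, polarMonomial_comm, polarMonomial_smul_left, polarMonomial_comm]
    rw [Derivation.sub_apply, Derivation.smul_apply, h1, smul_eq_mul] at hs
    rw [← hz] at h2
    rw [h2] at hs
    rw [h3]
    convert hs using 1
    field_simp
  have hp₀ : q j₀ / q j₀ = 1 := div_self h₀
  have hL : CharZero L := charZero_of_injective_algebraMap (algebraMap k L).injective
  have hcm₀ : c * m j₀ ∈ M := by
    have := hcM s(j₀, j₀)
    rw [polarMonomial_mk, hp₀] at this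
    convert M.mul_mem (M.inv_mem (natCast_mem M 2)) this using 1
    push_cast
    field_simp
    ring
  have hcm : ∀ j, c * m j ∈ M := by
    intro j
    have := hcM s(j, j₀)
    rw [polarMonomial_mk, hp₀] at this
    convert M.sub_mem this (M.mul_mem hcm₀ (hpM j)) using 1
    ring
  have hc' : c ∈ M := by simpa [hm₀] using hcm i₀
  convert M.mul_mem (M.inv_mem hc') (hcm i) using 1
  field_simp

/-- The remaining case: if the tangent line of the curve described by the Halphen point is the
tangent line `⟨m, m'⟩`, then the latter is stationary. -/
theorem second_derivative_mul_eq (D : Derivation k L L) (hm : ∀ i, D (m i) = m' i)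
    (hm₀ : m i₀ = 1) (h₀ : halphenVector b m m' j₀ ≠ 0) (hmm : polarForm b m m ≠ 0)
    (heq : ∀ i j, (m i * m' j₀ - m' i * m j₀) *
        D (halphenVector b m m' j / halphenVector b m m' j₀) =
      (m j * m' j₀ - m' j * m j₀) * D (halphenVector b m m' i / halphenVector b m m' j₀))
    (i j : τ) : D (m' i) * m' j = D (m' j) * m' i := by
  have hm'₀ : m' i₀ = 0 := by rw [← hm, hm₀, D.map_one_eq_zero]
  obtain ⟨l, hl⟩ : ∃ l, m l * m' j₀ - m' l * m j₀ ≠ 0 := by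
    by_contra! hcon
    have h1 : m' j₀ = 0 := by simpa [hm₀, hm'₀] using hcon i₀
    have h2 : m j₀ ≠ 0 := fun h2 => h₀ (by simp [halphenVector, h1, h2])
    have h3 : ∀ l, m' l = 0 := fun l => by simpa [h1, h2] using hcon l
    refine h₀ ?_
    have : m' = 0 := funext h3
    simp [halphenVector, this, polarForm, polarMonomial_comm _ m 0]
    refine Or.inl (Finset.sum_eq_zero fun s _ => ?_)
    have := polarMonomial_smul_left s 0 0 m
    simp_all
  -- The derivative of the Halphen vector is a combination of `m` and `m'`, ...
  obtain ⟨A, B, hAB⟩ : ∃ A B, ∀ i, D (halphenVector b m m' i) = A * m i + B * m' i := by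
    have : ∀ i, D (halphenVector b m m' i) =
        (D (halphenVector b m m' j₀) * halphenVector b m m' i + halphenVector b m m' j₀ ^ 2 *
          (D (halphenVector b m m' l / halphenVector b m m' j₀) / (m l * m' j₀ - m' l * m j₀) *
            (m i * m' j₀ - m' i * m j₀))) / halphenVector b m m' j₀ := by
      intro i
      have h1 := heq l i
      have h2 := D.leibniz_div (halphenVector b m m' i) (halphenVector b m m' j₀)
      rw [div_mul_eq_mul_div, mul_comm (D (halphenVector b m m' l / _)), ← h1,
        mul_div_cancel_left₀ _ hl, h2]
      simp only [smul_eq_mul]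
      field_simp
      ring
    refine ⟨(D (halphenVector b m m' j₀) * polarForm b m m' + halphenVector b m m' j₀ ^ 2 *
      (D (halphenVector b m m' l / halphenVector b m m' j₀) / (m l * m' j₀ - m' l * m j₀) *
        m' j₀)) / halphenVector b m m' j₀, (-D (halphenVector b m m' j₀) * polarForm b m m -
      halphenVector b m m' j₀ ^ 2 * (D (halphenVector b m m' l / halphenVector b m m' j₀) /
        (m l * m' j₀ - m' l * m j₀) * m j₀)) / halphenVector b m m' j₀, fun i => ?_⟩
    rw [this i]
    generalize D (halphenVector b m m' l / halphenVector b m m' j₀) /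
      (m l * m' j₀ - m' l * m j₀) = r
    generalize D (halphenVector b m m' j₀) = e
    have : halphenVector b m m' i = polarForm b m m' * m i - polarForm b m m * m' i := rfl
    rw [this]
    field_simp
    ring
  have key : ∀ i, polarForm b m m * D (m' i) = (D (polarForm b m m') - A) * m i +
      (polarForm b m m' - D (polarForm b m m) - B) * m' i := by
    intro i
    have h1 := hAB i
    simp only [halphenVector, Pi.sub_apply, Pi.smul_apply, smul_eq_mul, map_sub,
      Derivation.leibniz, hm] at h1
    linear_combination -h1
  have hA : D (polarForm b m m') - A = 0 := by
    have := key i₀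
    rw [hm'₀, map_zero, hm₀] at this
    linear_combination -this
  -- ... and the coefficient of `m` vanishes, as `m` is normalised by `m i₀ = 1`.
  have key' : ∀ i, D (m' i) =
      (polarForm b m m' - D (polarForm b m m) - B) / polarForm b m m * m' i := by
    intro i
    have := key i
    rw [hA, zero_mul, zero_add] at this
    field_simp
    linear_combination this
  rw [key' i, key' j]
  ring

/-- If the curve is the line `x ↦ u + x v`, then `m` is rational over the field generated by the
coefficients of the quadric and the coordinates of the Halphen point `q`: the polar of `q` meets the
line in `m`, so that `x` is the quotient of `-polarForm b q u` by `polarForm b q v`. -/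
theorem mem_adjoin_of_line [CharZero k] (E : Sym2 τ → Derivation k L L)
    (hEb : ∀ s t, E s (b t) = if t = s then 1 else 0)
    {u v : τ → k} {x x' : L} {i₁ : τ} (hu₀ : u i₀ = 1) (hv₀ : v i₀ = 0)
    (hv₁ : v i₁ = 1) (hx' : x' ≠ 0)
    (hm : ∀ i, m i = algebraMap k L (u i) + x * algebraMap k L (v i))
    (hm' : ∀ i, m' i = x' * algebraMap k L (v i))
    (h₀ : halphenVector b m m' j₀ ≠ 0) (i : τ) :
    m i ∈ IntermediateField.adjoin k
      (Set.range b ∪ Set.range fun j => halphenVector b m m' j / halphenVector b m m' j₀) := by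
  set q := halphenVector b m m' with hq
  set M := IntermediateField.adjoin k (Set.range b ∪ Set.range fun j => q j / q j₀) with hM
  have hbM : ∀ t, b t ∈ M := fun t => IntermediateField.subset_adjoin _ _ (.inl ⟨t, rfl⟩)
  have hpM : ∀ j, q j / q j₀ ∈ M := fun j => IntermediateField.subset_adjoin _ _ (.inr ⟨j, rfl⟩)
  set U : τ → L := fun i => algebraMap k L (u i) with hU
  set V : τ → L := fun i => algebraMap k L (v i) with hV
  have hEU : ∀ s i, E s (U i) = 0 := fun s i => (E s).map_algebraMap _
  have hEV : ∀ s i, E s (V i) = 0 := fun s i => (E s).map_algebraMap _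
  set uu := polarForm b U U
  set uv := polarForm b U V
  set vv := polarForm b V V
  have hmUV : m = U + x • V := funext hm
  have hm'V : m' = x' • V := funext hm'
  have hqUV : q = x' • ((uv + x * vv) • U + (-(uu + x * uv)) • V) := by
    have h1 : polarForm b m V = uv + x * vv := by
      rw [hmUV, polarForm_add_left, polarForm_smul_left]
    have h2 : polarForm b m U = uu + x * uv := by
      rw [hmUV, polarForm_add_left, polarForm_smul_left, polarForm_comm b V U]
    have h3 : polarForm b m m = (uu + x * uv) + x * (uv + x * vv) := by
      nth_rw 2 [hmUV]
      rw [polarForm_add_right, polarForm_smul_right, h1, h2]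
    rw [hq, halphenVector, h3, hm'V, polarForm_smul_right, h1, hmUV]
    ext j
    simp only [Pi.sub_apply, Pi.smul_apply, Pi.add_apply, smul_eq_mul]
    ring
  have hqv : polarForm b q V = x' * (uv ^ 2 - uu * vv) := by
    rw [hqUV, polarForm_smul_left, polarForm_add_left, polarForm_smul_left, polarForm_smul_left]
    ring
  have hqu : polarForm b q U = -(x * (x' * (uv ^ 2 - uu * vv))) := by
    rw [hqUV, polarForm_smul_left, polarForm_add_left, polarForm_smul_left, polarForm_smul_left,
      polarForm_comm b V U]
    ring
  -- The quadric does not touch the line, since its coefficients are independent.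
  have hdisc : uv ^ 2 - uu * vv ≠ 0 := by
    intro h
    have hvv : 2 * vv = 0 := by
      have := congrArg (E s(i₀, i₀)) h
      simp only [map_sub, Derivation.leibniz, Derivation.leibniz_pow, map_zero] at this
      rw [(E _).apply_polarForm b (hEb _) (hEU _) (hEV _),
        (E _).apply_polarForm b (hEb _) (hEU _) (hEU _),
        (E _).apply_polarForm b (hEb _) (hEV _) (hEV _)] at this
      simp only [polarMonomial_mk, hU, hV, hu₀, hv₀, map_one, map_zero, smul_eq_mul] at this
      linear_combination -this
    have := congrArg (E s(i₁, i₁)) hvv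
    have h2 : E s(i₁, i₁) (2 : L) = 0 := by exact_mod_cast (E s(i₁, i₁)).map_natCast 2
    rw [Derivation.leibniz, (E _).apply_polarForm b (hEb _) (hEV _) (hEV _), h2] at this
    simp only [polarMonomial_mk, hV, hv₁, map_one, map_zero, smul_eq_mul] at this
    have : (4 : L) = 0 := by linear_combination this
    have hL : CharZero L := charZero_of_injective_algebraMap (algebraMap k L).injective
    norm_num at this
  have hUM : ∀ i, U i ∈ M := fun i => M.algebraMap_mem _
  have hVM : ∀ i, V i ∈ M := fun i => M.algebraMap_mem _
  have hxM : x ∈ M := by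
    have h1 : ∀ w, polarForm b (fun j => q j / q j₀) w = (q j₀)⁻¹ * polarForm b q w := by
      intro w
      rw [← polarForm_smul_left]
      congr 1
      ext j
      simp [div_eq_inv_mul]
    have h2 := M.mul_mem (M.neg_mem (polarForm_mem M hbM hpM hUM))
      (M.inv_mem (polarForm_mem M hbM hpM hVM))
    rw [h1, h1, hqv, hqu] at h2
    convert h2 using 1
    field_simp
  rw [hm]
  exact M.add_mem (hUM i) (M.mul_mem hxM (hVM i))

end Generic

theorem Derivation.eq_zero_of_isAlgebraic {k L : Type*} [Field k] [CharZero k] [Field L]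
    [Algebra k L] (D : Derivation k L L) {F : IntermediateField k L} (hF : ∀ a ∈ F, D a = 0)
    {z : L} (hz : IsAlgebraic F z) : D z = 0 := by
  let D' : Derivation F L L := Derivation.mk'
    { toFun := D
      map_add' := D.map_add
      map_smul' := fun a x => by
        rw [Algebra.smul_def, D.leibniz, IntermediateField.algebraMap_apply, hF a a.2, smul_zero,
          add_zero, RingHom.id_apply]
        rfl }
    (fun a b => D.leibniz a b)
  have h0 : Polynomial.aeval z (Polynomial.derivative (minpoly F z)) ≠ 0 :=
    (minpoly.irreducible hz.isIntegral).separable.aeval_derivative_ne_zero (minpoly.aeval F z)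
  have := D'.map_aeval (minpoly F z) z
  rw [minpoly.aeval, map_zero] at this
  exact (smul_eq_zero.mp this.symm).resolve_left h0

theorem IntermediateField.isAlgebraic_of_isAlgebraic_adjoin {k L : Type*} [Field k] [Field L]
    [Algebra k L] {S : Set L} {z : L} (hz : IsAlgebraic (Algebra.adjoin k S) z) :
    IsAlgebraic (IntermediateField.adjoin k S) z := by
  let : Algebra (Algebra.adjoin k S) (IntermediateField.adjoin k S) :=
    (Subalgebra.inclusion (IntermediateField.algebra_adjoin_le_adjoin k S)).toRingHom.toAlgebra
  have : IsScalarTower (Algebra.adjoin k S) (IntermediateField.adjoin k S) L :=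
    .of_algebraMap_eq fun _ => rfl
  refine hz.extendScalars fun a b hab => Subtype.ext ?_
  exact congrArg (fun c : IntermediateField.adjoin k S => (c : L)) hab

/-- The constants of a nonzero derivation of a function field in one variable over an algebraically
closed field are the elements of the ground field. -/
theorem Derivation.exists_algebraMap_eq_of_apply_eq_zero {k K : Type*} [Field k] [CharZero k]
    [IsAlgClosed k] [Field K] [Algebra k K] {y : K}
    (hy : IsTranscendenceBasis k fun _ : Unit => y) {D : Derivation k K K} (hD : D ≠ 0) {z : K}
    (hz : D z = 0) : ∃ c, algebraMap k K c = z := by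
  have halg : IsAlgebraic k z := by
    by_contra hcon
    have h1 : AlgebraicIndependent k fun _ : Unit => z :=
      algebraicIndependent_unique_type_iff.mpr hcon
    have h2 : IsTranscendenceBasis k fun _ : Unit => z :=
      h1.isTranscendenceBasis_of_lift_trdeg_le_of_finite hy.lift_cardinalMk_eq_trdeg.ge
    exact hD (h2.derivation_ext fun _ => hz)
  exact minpoly.mem_range_of_degree_eq_one k z
    (IsAlgClosed.degree_eq_one_of_irreducible k (minpoly.irreducible halg.isIntegral))

section

variable {k K N τ : Type*} [Field k] [CharZero k] [Field K] [Field N] [Algebra k K]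
  [Algebra K N] [Algebra k N] [IsScalarTower k K N]

/-- Adding to the independent elements `b` a nonconstant element `z` for a derivation killing `b`
gives a transcendence basis, if the transcendence degree is right. -/
theorem isAlgebraic_adjoin_insert {ι : Type*} [Finite ι] {b : ι → N}
    (hb : IsTranscendenceBasis K b) {y : K} (hy : IsTranscendenceBasis k fun _ : Unit => y)
    {D : Derivation k N N} (hDb : ∀ t, D (b t) = 0) {z : N} (hz : D z ≠ 0) :
    Algebra.IsAlgebraic (IntermediateField.adjoin k (insert z (Set.range b))) N := by
  have h1 : AlgebraicIndependent k fun o : Option ι => o.elim z b := by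
    refine AlgebraicIndependent.option_iff.mpr
      ⟨hb.1.restrictScalars (algebraMap k K).injective, fun hcon => hz ?_⟩
    refine D.eq_zero_of_isAlgebraic (fun a ha => ?_)
      (IntermediateField.isAlgebraic_of_isAlgebraic_adjoin hcon)
    induction ha using IntermediateField.adjoin_induction with
    | mem x hx => obtain ⟨t, rfl⟩ := hx; exact hDb t
    | algebraMap r => exact D.map_algebraMap r
    | add x y _ _ hx hy => rw [map_add, hx, hy, add_zero]
    | inv x _ hx => rw [D.leibniz_inv, hx, smul_zero]
    | mul x y _ _ hx hy => rw [D.leibniz, hx, hy, smul_zero, smul_zero, add_zero]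
  have h2 := (hy.sumElim_comp hb).lift_cardinalMk_eq_trdeg
  have h3 : IsTranscendenceBasis k fun o : Option ι => o.elim z b := by
    refine h1.isTranscendenceBasis_of_lift_trdeg_le_of_finite ?_
    rw [Cardinal.mk_congr (Equiv.optionEquivSumPUnit.{0} ι)]
    exact h2.ge
  have h4 := h3.isAlgebraic_field
  have : (Set.range fun o : Option ι => o.elim z b) = insert z (Set.range b) := by
    ext a
    simp [Option.exists, eq_comm]
  rwa [this] at h4

/-- The generic point of a curve is rational over the field generated by the coefficients of a
generic quadric and by the coordinates of the corresponding Halphen point. -/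
theorem algebraMap_mem_adjoin_halphenVector [IsAlgClosed k] [Fintype τ] [DecidableEq τ]
    {b : Sym2 τ → N} (hb : IsTranscendenceBasis K b) {y : K}
    (hy : IsTranscendenceBasis k fun _ : Unit => y) (D : Derivation k K K) (hDy : D y = 1)
    {m : τ → K} {i₀ : τ} (hm₀ : m i₀ = 1) (hm' : ∃ i, D (m i) ≠ 0) {j₀ : τ}
    (h₀ : halphenVector b (algebraMap K N ∘ m) (algebraMap K N ∘ D ∘ m) j₀ ≠ 0) (i : τ) :
    algebraMap K N (m i) ∈ IntermediateField.adjoin k (Set.range b ∪ Set.range fun j =>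
      halphenVector b (algebraMap K N ∘ m) (algebraMap K N ∘ D ∘ m) j /
        halphenVector b (algebraMap K N ∘ m) (algebraMap K N ∘ D ∘ m) j₀) := by
  have hD : D ≠ 0 := fun h => by simp [h] at hDy
  have hbas := hy.sumElim_comp hb
  have hN : CharZero N := charZero_of_injective_algebraMap (algebraMap k N).injective
  -- the derivation `D` extends to `N`, with constants `b`
  obtain ⟨DN, hDN⟩ := hbas.exists_derivation (M := N) (Sum.elim (fun _ => 0) fun _ => 1)
  have hDNb : ∀ t, DN (b t) = 0 := fun t => hDN (.inl t)
  have hDNK : ∀ a, DN (algebraMap K N a) = algebraMap K N (D a) := by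
    have : DN.compAlgebraMap K = (Algebra.linearMap K N).compDer D :=
      hy.derivation_ext fun u => by
        refine (hDN (.inr u)).trans ?_
        change (1 : N) = algebraMap K N (D y)
        rw [hDy, map_one]
    exact fun a => Derivation.congr_fun this a
  -- the partial derivatives with respect to the coefficients of the quadric
  choose E hE using fun s => hbas.exists_derivation (M := N)
    (Sum.elim (fun t => if t = s then 1 else 0) fun _ => 0)
  have hEb : ∀ s t, E s (b t) = if t = s then 1 else 0 := fun s t => hE s (.inl t)
  have hEK : ∀ s a, E s (algebraMap K N a) = 0 := by
    intro s
    have : (E s).compAlgebraMap K = 0 := hy.derivation_ext fun u => hE s (.inr u)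
    exact fun a => Derivation.congr_fun this a
  by_cases hne : ∃ i j, ((algebraMap K N ∘ m) i * (algebraMap K N ∘ D ∘ m) j₀ -
        (algebraMap K N ∘ D ∘ m) i * (algebraMap K N ∘ m) j₀) *
        DN (halphenVector b (algebraMap K N ∘ m) (algebraMap K N ∘ D ∘ m) j /
          halphenVector b (algebraMap K N ∘ m) (algebraMap K N ∘ D ∘ m) j₀) ≠
      ((algebraMap K N ∘ m) j * (algebraMap K N ∘ D ∘ m) j₀ -
        (algebraMap K N ∘ D ∘ m) j * (algebraMap K N ∘ m) j₀) *
        DN (halphenVector b (algebraMap K N ∘ m) (algebraMap K N ∘ D ∘ m) i /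
          halphenVector b (algebraMap K N ∘ m) (algebraMap K N ∘ D ∘ m) j₀)
  · exact mem_adjoin_of_ne (i₀ := i₀) DN E hDNb hEb (fun s i => hEK s _) (fun s i => hEK s _)
      (fun z hz => isAlgebraic_adjoin_insert hb hy hDNb hz) (by simp [hm₀]) h₀ hne i
  push Not at hne
  have hmm : polarForm b (algebraMap K N ∘ m) (algebraMap K N ∘ m) ≠ 0 := by
    intro h
    have := congrArg (E s(i₀, i₀)) h
    rw [(E _).apply_polarForm b (hEb _) (u := algebraMap K N ∘ m) (v := algebraMap K N ∘ m)
      (fun i => hEK _ _) (fun i => hEK _ _)] at this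
    norm_num [hm₀] at this
  have hsecond : ∀ i j, D (D (m i)) * D (m j) = D (D (m j)) * D (m i) := by
    intro i j
    have := second_derivative_mul_eq (i₀ := i₀) DN (fun i => hDNK _) (by simp [hm₀]) h₀ hmm hne i j
    simp only [hDNK] at this
    apply (algebraMap K N).injective
    simpa only [map_mul] using this
  obtain ⟨i₁, hi₁⟩ := hm'
  have hv : ∀ i, ∃ c : k, algebraMap k K c = D (m i) / D (m i₁) := fun i => by
    refine Derivation.exists_algebraMap_eq_of_apply_eq_zero hy hD ?_
    rw [Derivation.leibniz_div, smul_eq_mul, smul_eq_mul, smul_eq_mul]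
    linear_combination (D (m i₁))⁻¹ ^ 2 * hsecond i i₁
  choose v hv using hv
  have hv' : ∀ i, D (m i) = D (m i₁) * algebraMap k K (v i) := fun i => by
    rw [hv, mul_div_cancel₀ _ hi₁]
  have hu : ∀ i, ∃ c : k, algebraMap k K c = m i - m i₁ * algebraMap k K (v i) := fun i => by
    refine Derivation.exists_algebraMap_eq_of_apply_eq_zero hy hD ?_
    rw [map_sub, Derivation.leibniz, D.map_algebraMap, hv' i]
    simp only [smul_eq_mul]
    ring
  choose u hu using hu
  have hv₀ : v i₀ = 0 := (algebraMap k K).injective (by rw [hv, hm₀]; simp)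
  have hu₀ : u i₀ = 1 := (algebraMap k K).injective (by rw [hu, hm₀, hv₀]; simp)
  have hv₁ : v i₁ = 1 := (algebraMap k K).injective (by rw [hv, div_self hi₁, map_one])
  refine mem_adjoin_of_line (i₀ := i₀) (i₁ := i₁) (u := u) (v := v) (x := algebraMap K N (m i₁))
    (x' := algebraMap K N (D (m i₁))) E hEb hu₀ hv₀ hv₁ (by simpa using hi₁) (fun i => ?_)
    (fun i => ?_) h₀ i
  · rw [IsScalarTower.algebraMap_apply k K N, IsScalarTower.algebraMap_apply k K N, hu, ← map_mul,
      ← map_add]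
    simp
  · rw [IsScalarTower.algebraMap_apply k K N, ← map_mul, ← hv']
    rfl

end

/-! ### Homogeneous polynomials -/

/-- The homogenisation in degree `e` of a polynomial `F` with respect to the variable `X i₀`, which
is already one of the variables of `F`. -/
noncomputable def homogenizeAt {σ R : Type*} [CommRing R] (i₀ : σ) (e : ℕ)
    (F : MvPolynomial σ R) : MvPolynomial σ R :=
  ∑ d ∈ Finset.range (e + 1),
    MvPolynomial.X i₀ ^ (e - d) * MvPolynomial.homogeneousComponent d F

section Homogeneous

variable {σ R : Type*} [CommRing R] {F : MvPolynomial σ R} {i₀ : σ} {d e : ℕ}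

theorem isHomogeneous_homogenizeAt : (homogenizeAt i₀ e F).IsHomogeneous e := by
  refine MvPolynomial.IsHomogeneous.sum _ _ _ fun d hd => ?_
  have := (MvPolynomial.isHomogeneous_X_pow (R := R) i₀ (e - d)).mul
    (MvPolynomial.homogeneousComponent_isHomogeneous d F)
  rwa [Nat.sub_add_cancel (Nat.lt_succ_iff.mp (Finset.mem_range.mp hd))] at this

theorem sum_range_homogeneousComponent (he : F.totalDegree ≤ e) :
    ∑ d ∈ Finset.range (e + 1), MvPolynomial.homogeneousComponent d F = F := by
  nth_rw 2 [← F.sum_homogeneousComponent]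
  refine (Finset.sum_subset (Finset.range_mono (by omega)) fun d _ hd => ?_).symm
  exact MvPolynomial.homogeneousComponent_eq_zero d F (by simpa using hd)

theorem aeval_homogenizeAt {S : Type*} [CommRing S] [Algebra R S] {v : σ → S} (hv : v i₀ = 1)
    (he : F.totalDegree ≤ e) :
    MvPolynomial.aeval v (homogenizeAt i₀ e F) = MvPolynomial.aeval v F := by
  nth_rw 2 [← sum_range_homogeneousComponent he]
  simp [homogenizeAt, hv]

theorem MvPolynomial.IsHomogeneous.aeval_smul {S : Type*} [CommRing S] [Algebra R S]
    (hF : F.IsHomogeneous d) (c : S) (v : σ → S) :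
    MvPolynomial.aeval (c • v) F = c ^ d * MvPolynomial.aeval v F := by
  rw [MvPolynomial.aeval_def, MvPolynomial.aeval_def, MvPolynomial.eval₂_eq, MvPolynomial.eval₂_eq,
    Finset.mul_sum]
  refine Finset.sum_congr rfl fun s hs => ?_
  simp only [Pi.smul_apply, smul_eq_mul, mul_pow, Finset.prod_mul_distrib,
    Finset.prod_pow_eq_pow_sum]
  rw [← hF.degree_eq_sum_deg_support hs]
  ring

theorem MvPolynomial.IsHomogeneous.eval_smul (hF : F.IsHomogeneous d) (c : R) (v : σ → R) :
    MvPolynomial.eval (c • v) F = c ^ d * MvPolynomial.eval v F := by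
  simpa only [MvPolynomial.aeval_eq_eval] using hF.aeval_smul c v

end Homogeneous

/-! ### Specialisation of the quadric -/

/-- Clearing denominators in a rational expression in the quotients `h j / h j₀`, compatibly with
specialisations. -/
theorem exists_clear_denominators {σ τ : Type*} {k : Type*} {R : Type u} [CommRing k] [CommRing R]
    [Algebra k R] (g : σ → R) (h : τ → R) (j₀ : τ) (r : MvPolynomial (σ ⊕ τ) k) :
    ∃ (e : ℕ) (P : R), ∀ (F : Type u) [Field F] [Algebra k F] (φ : R →ₐ[k] F), φ (h j₀) ≠ 0 →
      φ P = φ (h j₀) ^ e *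
        MvPolynomial.aeval (Sum.elim (φ ∘ g) fun j => φ (h j) / φ (h j₀)) r := by
  induction r using MvPolynomial.induction_on with
  | C a =>
    exact ⟨0, algebraMap k R a, fun F _ _ φ _ => by simp⟩
  | add p q hp hq =>
    obtain ⟨e, P, hP⟩ := hp
    obtain ⟨e', Q, hQ⟩ := hq
    refine ⟨e + e', h j₀ ^ e' * P + h j₀ ^ e * Q, fun F _ _ φ hφ => ?_⟩
    rw [map_add, map_mul, map_mul, map_pow, map_pow, hP F φ hφ, hQ F φ hφ, map_add]
    ring
  | mul_X p i hp =>
    obtain ⟨e, P, hP⟩ := hp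
    cases i with
    | inl s =>
      refine ⟨e, P * g s, fun F _ _ φ hφ => ?_⟩
      rw [map_mul, hP F φ hφ, map_mul, MvPolynomial.aeval_X, Sum.elim_inl, Function.comp_apply]
      ring
    | inr j =>
      refine ⟨e + 1, P * h j, fun F _ _ φ hφ => ?_⟩
      rw [map_mul, hP F φ hφ, map_mul, MvPolynomial.aeval_X, Sum.elim_inr]
      rw [pow_succ]
      field_simp

/-- Finitely many elements of a subfield generated by a family are fractions with a common
denominator. -/
theorem IntermediateField.exists_common_denominator {ι κ k L : Type*} [Fintype κ] [DecidableEq κ]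
    [Field k] [Field L] [Algebra k L] (f : ι → L) {x : κ → L}
    (hx : ∀ i, x i ∈ IntermediateField.adjoin k (Set.range f)) :
    ∃ (s : MvPolynomial ι k) (r : κ → MvPolynomial ι k), MvPolynomial.aeval f s ≠ 0 ∧
      ∀ i, MvPolynomial.aeval f s * x i = MvPolynomial.aeval f (r i) := by
  have : ∀ i, ∃ r s : MvPolynomial ι k, MvPolynomial.aeval f s ≠ 0 ∧
      MvPolynomial.aeval f s * x i = MvPolynomial.aeval f r := by
    intro i
    obtain ⟨r, s, h⟩ := (IntermediateField.mem_adjoin_range_iff k f (x i)).mp (hx i)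
    by_cases hs : MvPolynomial.aeval f s = 0
    · refine ⟨0, 1, by simp, ?_⟩
      rw [h, hs]
      simp
    · exact ⟨r, s, hs, by rw [h]; field_simp⟩
  choose r s hs h using this
  refine ⟨∏ i, s i, fun i => r i * ∏ j ∈ Finset.univ.erase i, s j, ?_, fun i => ?_⟩
  · rw [map_prod]
    exact Finset.prod_ne_zero_iff.mpr fun i _ => hs i
  · rw [← Finset.mul_prod_erase _ _ (Finset.mem_univ i), map_mul, map_mul, ← h i]
    ring

/-- For all quadrics outside a hypersurface, the generic point `m` is obtained from the Halphen
point by forms of one and the same degree: for the generic quadric, `m` is a rational expression in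
the coefficients and the Halphen point, and this specialises as long as the denominators, collected
in `P`, do not vanish. -/
theorem exists_inverse_forms {k : Type*} {K τ : Type u} [Field k] [CharZero k] [IsAlgClosed k]
    [Field K] [Algebra k K] [Fintype τ] [DecidableEq τ] {y : K}
    (hy : IsTranscendenceBasis k fun _ : Unit => y) (D : Derivation k K K) (hDy : D y = 1)
    {m : τ → K} {i₀ : τ} (hm₀ : m i₀ = 1) (hm' : ∃ i, D (m i) ≠ 0) :
    ∃ P : MvPolynomial (Sym2 τ) K, P ≠ 0 ∧ ∀ q : Sym2 τ → k,
      MvPolynomial.eval (algebraMap k K ∘ q) P ≠ 0 →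
        halphenVector (algebraMap k K ∘ q) m (D ∘ m) ≠ 0 ∧
        ∃ (e : ℕ) (Ψ : τ → MvPolynomial τ k) (c : K), (∀ i, (Ψ i).IsHomogeneous e) ∧ c ≠ 0 ∧
          ∀ i, MvPolynomial.aeval (halphenVector (algebraMap k K ∘ q) m (D ∘ m)) (Ψ i) =
            c * m i := by
  have hK : CharZero K := charZero_of_injective_algebraMap (algebraMap k K).injective
  let R := MvPolynomial (Sym2 τ) K
  let N := FractionRing R
  let h : τ → R := halphenVector MvPolynomial.X (MvPolynomial.C ∘ m) (MvPolynomial.C ∘ D ∘ m)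
  have hinj : Function.Injective (algebraMap R N) := IsFractionRing.injective R N
  have : Algebra.IsAlgebraic R N :=
    IsFractionRing.comap_isAlgebraic_iff (K := N).mpr inferInstance
  have hb : IsTranscendenceBasis K (algebraMap R N ∘ MvPolynomial.X) :=
    (IsTranscendenceBasis.mvPolynomial (Sym2 τ) K).algebraMap_comp
  -- the specialisations
  let φ : (Sym2 τ → k) → R →ₐ[k] K := fun q =>
    (MvPolynomial.aeval (algebraMap k K ∘ q) : R →ₐ[K] K).restrictScalars k
  have hφ : ∀ q P, φ q P = MvPolynomial.eval (algebraMap k K ∘ q) P := fun q P => by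
    change MvPolynomial.aeval _ _ = _
    rw [MvPolynomial.aeval_eq_eval]
  have hφh : ∀ q j, φ q (h j) = halphenVector (algebraMap k K ∘ q) m (D ∘ m) j := by
    intro q j
    have hX : (φ q).toRingHom ∘ MvPolynomial.X = algebraMap k K ∘ q := by
      funext s; exact MvPolynomial.aeval_X _ s
    have hC : ∀ a, (φ q).toRingHom (MvPolynomial.C a) = a := fun a => by
      exact MvPolynomial.aeval_C _ a
    refine (map_halphenVector MvPolynomial.X (φ q).toRingHom _ _ j).trans ?_
    rw [hX]
    congr 1 <;> funext i <;> exact hC _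
  obtain ⟨j₀, hj₀⟩ : ∃ j, h j ≠ 0 := by
    by_contra! hcon
    obtain ⟨i₁, hi₁⟩ := hm'
    have h1 := hcon i₀
    have h2 := hcon i₁
    simp only [h, halphenVector, Pi.sub_apply, Pi.smul_apply, Function.comp_apply, smul_eq_mul, hm₀,
      D.map_one_eq_zero, map_zero, map_one, mul_one, mul_zero, sub_zero] at h1 h2
    rw [h1, zero_mul, zero_sub, neg_eq_zero, mul_eq_zero, MvPolynomial.C_eq_zero] at h2
    have h3 := h2.resolve_right hi₁
    have h4 := congrArg (MvPolynomial.eval (Pi.single s(i₀, i₀) 1)) h3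
    rw [map_zero, map_polarForm] at h4
    have hX : MvPolynomial.eval (Pi.single s(i₀, i₀) 1 : Sym2 τ → K) ∘ MvPolynomial.X =
        Pi.single s(i₀, i₀) 1 := by funext s; simp
    rw [hX, polarForm, Finset.sum_eq_single s(i₀, i₀)] at h4
    · norm_num [hm₀] at h4
    · intro s _ hs; simp [hs]
    · simp
  -- the formulas for a generic quadric
  have hh : ∀ j, algebraMap R N (h j) = halphenVector (algebraMap R N ∘ MvPolynomial.X)
      (algebraMap K N ∘ m) (algebraMap K N ∘ D ∘ m) j :=
    fun j => map_halphenVector MvPolynomial.X (algebraMap R N) _ _ j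
  have hmem : ∀ i, algebraMap K N (m i) ∈ IntermediateField.adjoin k (Set.range
      (Sum.elim (algebraMap R N ∘ MvPolynomial.X)
        fun j => algebraMap R N (h j) / algebraMap R N (h j₀))) := by
    intro i
    rw [Set.Sum.elim_range]
    simp only [hh]
    refine algebraMap_mem_adjoin_halphenVector hb hy D hDy hm₀ hm' ?_ i
    rw [← hh]
    exact fun h0 => hj₀ (hinj (h0.trans (map_zero _).symm))
  obtain ⟨s, r, hs, hr⟩ := IntermediateField.exists_common_denominator _ hmem
  obtain ⟨es, Ps, hPs⟩ := exists_clear_denominators (MvPolynomial.X : Sym2 τ → R) h j₀ s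
  choose e P hP using
    fun i => exists_clear_denominators (MvPolynomial.X : Sym2 τ → R) h j₀ (r i)
  have hφN : IsScalarTower.toAlgHom k R N (h j₀) ≠ 0 :=
    fun h0 => hj₀ (hinj (h0.trans (map_zero _).symm))
  have hPsN := hPs N (IsScalarTower.toAlgHom k R N) hφN
  have hPN := fun i => hP i N (IsScalarTower.toAlgHom k R N) hφN
  have hPs0 : Ps ≠ 0 := by
    rintro rfl
    rw [map_zero] at hPsN
    exact mul_ne_zero (pow_ne_zero _ hφN) hs hPsN.symm
  have hid : ∀ i, Ps * h j₀ ^ e i * MvPolynomial.C (m i) = P i * h j₀ ^ es := by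
    intro i
    apply hinj
    have h1 : algebraMap R N (MvPolynomial.C (m i)) = algebraMap K N (m i) := rfl
    have h2 : algebraMap R N Ps = algebraMap R N (h j₀) ^ es * MvPolynomial.aeval
      (Sum.elim (algebraMap R N ∘ MvPolynomial.X)
        fun j => algebraMap R N (h j) / algebraMap R N (h j₀)) s := hPsN
    have h3 : algebraMap R N (P i) = algebraMap R N (h j₀) ^ e i * MvPolynomial.aeval
      (Sum.elim (algebraMap R N ∘ MvPolynomial.X)
        fun j => algebraMap R N (h j) / algebraMap R N (h j₀)) (r i) := hPN i
    rw [map_mul, map_mul, map_mul, map_pow, map_pow, h1, h2, h3, ← hr i]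
    ring
  refine ⟨Ps * h j₀, mul_ne_zero hPs0 hj₀, fun q hq => ?_⟩
  rw [← hφ, map_mul] at hq
  have hq₀ := right_ne_zero_of_mul hq
  have hqs := left_ne_zero_of_mul hq
  set H := halphenVector (algebraMap k K ∘ q) m (D ∘ m) with hH
  have hH₀ : H j₀ ≠ 0 := by rwa [hH, ← hφh]
  have hqX : φ q ∘ MvPolynomial.X = algebraMap k K ∘ q := by
    funext s; exact MvPolynomial.aeval_X _ s
  have hsq := hPs K (φ q) hq₀
  have hrq := fun i => hP i K (φ q) hq₀
  simp only [hφh, hqX, ← hH] at hsq hrq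
  set p : τ → K := fun j => H j / H j₀ with hp
  have hsp : MvPolynomial.aeval (Sum.elim (algebraMap k K ∘ q) p) s ≠ 0 := by
    intro h0
    rw [h0, mul_zero] at hsq
    exact hqs hsq
  have hspec : ∀ i, MvPolynomial.aeval (Sum.elim (algebraMap k K ∘ q) p) (r i) =
      MvPolynomial.aeval (Sum.elim (algebraMap k K ∘ q) p) s * m i := by
    intro i
    have h1 := congrArg (φ q) (hid i)
    have h2 : φ q (MvPolynomial.C (m i)) = m i := MvPolynomial.aeval_C _ _
    rw [map_mul, map_mul, map_mul, map_pow, map_pow, h2, hsq, hrq, hφh, ← hH] at h1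
    have h3 : H j₀ ^ es * H j₀ ^ e i ≠ 0 := mul_ne_zero (pow_ne_zero _ hH₀) (pow_ne_zero _ hH₀)
    refine mul_left_cancel₀ h3 ?_
    linear_combination -h1
  -- the specialised polynomials, and their homogenisations
  let ρ : τ → MvPolynomial τ k := fun i =>
    MvPolynomial.aeval (Sum.elim (MvPolynomial.C ∘ q) MvPolynomial.X) (r i)
  have hρ : ∀ i, MvPolynomial.aeval p (ρ i) =
      MvPolynomial.aeval (Sum.elim (algebraMap k K ∘ q) p) (r i) := by
    intro i
    change ((MvPolynomial.aeval p).comp (MvPolynomial.aeval _)) (r i) = _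
    rw [MvPolynomial.comp_aeval]
    congr 2
    funext x
    cases x <;> simp
  let E := Finset.univ.sup fun i => (ρ i).totalDegree
  have hHp : H = H j₀ • p := by
    ext j; simp [p, mul_div_cancel₀ _ hH₀]
  refine ⟨fun h0 => hH₀ (by rw [h0]; rfl), E, fun i => homogenizeAt j₀ E (ρ i),
    H j₀ ^ E * MvPolynomial.aeval (Sum.elim (algebraMap k K ∘ q) p) s,
    fun i => isHomogeneous_homogenizeAt, mul_ne_zero (pow_ne_zero _ hH₀) hsp, fun i => ?_⟩
  rw [hHp, isHomogeneous_homogenizeAt.aeval_smul, ← hHp,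
    aeval_homogenizeAt (v := p) (div_self hH₀)
      (Finset.le_sup (f := fun i => (ρ i).totalDegree) (Finset.mem_univ i)), hρ, hspec]
  ring

/-! ### Closed sets of projective space and their generic points -/

section Zariski

variable {σ τ : Type*}

theorem eval_rep_mk_eq_zero_iff {F : MvPolynomial σ ℂ} (hF : IsForm F) {v : σ → ℂ} (hv : v ≠ 0) :
    MvPolynomial.eval (Projectivization.mk ℂ v hv).rep F = 0 ↔ MvPolynomial.eval v F = 0 := by
  obtain ⟨d, hd⟩ := hF
  obtain ⟨a, ha⟩ := Projectivization.exists_smul_eq_mk_rep ℂ v hv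
  rw [← ha, Units.smul_def, hd.eval_smul, mul_eq_zero, or_iff_right (pow_ne_zero _ a.ne_zero)]

theorem IsForm.mul {F G : MvPolynomial σ ℂ} (hF : IsForm F) (hG : IsForm G) : IsForm (F * G) := by
  obtain ⟨d, hd⟩ := hF
  obtain ⟨e, he⟩ := hG
  exact ⟨d + e, hd.mul he⟩

theorem isForm_X (i : σ) : IsForm (MvPolynomial.X i : MvPolynomial σ ℂ) :=
  ⟨1, MvPolynomial.isHomogeneous_X ℂ i⟩

theorem isClosed_iff_exists_forms {Z : Set (ℙ ℂ (σ → ℂ))} :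
    IsClosed Z ↔ ∃ S : Set (MvPolynomial σ ℂ), (∀ F ∈ S, IsForm F) ∧ Z = projZeroLocus S := by
  rw [← isOpen_compl_iff]
  change Zᶜᶜ ∈ _ ↔ _
  rw [compl_compl]
  rfl

theorem isOpen_setOf_eval_ne_zero {F : MvPolynomial σ ℂ} (hF : IsForm F) :
    IsOpen {p : ℙ ℂ (σ → ℂ) | MvPolynomial.eval p.rep F ≠ 0} := by
  rw [← isClosed_compl_iff, isClosed_iff_exists_forms]
  refine ⟨{F}, by simpa using hF, ?_⟩
  ext p
  simp [projZeroLocus]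

theorem mem_closure_iff_forms {X : Set (ℙ ℂ (σ → ℂ))} {p : ℙ ℂ (σ → ℂ)} :
    p ∈ closure X ↔ ∀ F ∈ vanishingForms X, MvPolynomial.eval p.rep F = 0 := by
  constructor
  · intro hp F hF
    by_contra hcon
    obtain ⟨x, hx, hxX⟩ := mem_closure_iff.mp hp _ (isOpen_setOf_eval_ne_zero hF.1) hcon
    exact hx (hF.2 x hxX)
  · intro h
    obtain ⟨S, hS, hZ⟩ := isClosed_iff_exists_forms.mp (isClosed_closure (s := X))
    rw [hZ]
    intro F hF
    refine h F ⟨hS F hF, fun x hx => ?_⟩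
    have : x ∈ projZeroLocus S := hZ ▸ subset_closure hx
    exact this F hF

theorem exists_form_of_mem_isOpen {O : Set (ℙ ℂ (σ → ℂ))} (hO : IsOpen O) {p : ℙ ℂ (σ → ℂ)}
    (hp : p ∈ O) : ∃ F, IsForm F ∧ MvPolynomial.eval p.rep F ≠ 0 ∧
      ∀ x : ℙ ℂ (σ → ℂ), MvPolynomial.eval x.rep F ≠ 0 → x ∈ O := by
  obtain ⟨S, hS, hZ⟩ := isClosed_iff_exists_forms.mp hO.isClosed_compl
  have hp' : p ∉ projZeroLocus S := hZ ▸ fun h => h hp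
  simp only [projZeroLocus, Set.mem_ofPred_eq, not_forall] at hp'
  obtain ⟨F, hF, hFp⟩ := hp'
  refine ⟨F, hS F hF, hFp, fun x hx => by_contra fun hxO => hx ?_⟩
  have : x ∈ projZeroLocus S := hZ ▸ hxO
  exact this F hF

theorem Projectivization.mk_eq_mk_of_mul_eq {v w : σ → ℂ} (hv : v ≠ 0) (hw : w ≠ 0)
    (h : ∀ i j, v i * w j = v j * w i) :
    Projectivization.mk ℂ v hv = Projectivization.mk ℂ w hw := by
  obtain ⟨j, hj⟩ := Function.ne_iff.mp hw
  rw [Projectivization.mk_eq_mk_iff']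
  refine ⟨v j / w j, funext fun i => ?_⟩
  rw [Pi.smul_apply, smul_eq_mul, div_mul_eq_mul_div, ← h i j, mul_div_cancel_right₀ _ hj]

variable {K : Type*} [Field K] [Algebra ℂ K]

/-- `m`, a vector over an extension `K` of `ℂ`, is a generic point of the closed set `X`: the forms
that vanish at `m` are those that vanish on `X`. -/
structure IsGenericVector (m : σ → K) (X : Set (ℙ ℂ (σ → ℂ))) : Prop where
  isClosed : IsClosed X
  aeval_eq_zero_iff : ∀ F, IsForm F →
    (MvPolynomial.aeval m F = 0 ↔ ∀ x ∈ X, MvPolynomial.eval x.rep F = 0)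

namespace IsGenericVector

variable {m : σ → K} {X : Set (ℙ ℂ (σ → ℂ))}

theorem exists_eval_ne_zero (hX : IsGenericVector m X) {F : MvPolynomial σ ℂ} (hF : IsForm F)
    (h : MvPolynomial.aeval m F ≠ 0) : ∃ x ∈ X, MvPolynomial.eval x.rep F ≠ 0 := by
  by_contra! hcon
  exact h ((hX.aeval_eq_zero_iff F hF).mpr hcon)

theorem eval_eq_zero (hX : IsGenericVector m X) {F : MvPolynomial σ ℂ} (hF : IsForm F)
    (h : MvPolynomial.aeval m F = 0) {x : ℙ ℂ (σ → ℂ)} (hx : x ∈ X) :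
    MvPolynomial.eval x.rep F = 0 :=
  (hX.aeval_eq_zero_iff F hF).mp h x hx

theorem isIrreducible (hX : IsGenericVector m X) : IsIrreducible X := by
  constructor
  · obtain ⟨x, hx, _⟩ := hX.exists_eval_ne_zero ⟨0, MvPolynomial.isHomogeneous_one σ ℂ⟩
      (by rw [map_one]; exact one_ne_zero)
    exact ⟨x, hx⟩
  · rintro u v hu hv ⟨x, hxX, hxu⟩ ⟨y, hyX, hyv⟩
    obtain ⟨F, hF, hFx, hFu⟩ := exists_form_of_mem_isOpen hu hxu
    obtain ⟨G, hG, hGy, hGv⟩ := exists_form_of_mem_isOpen hv hyv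
    have hF0 : MvPolynomial.aeval m F ≠ 0 := fun h => hFx (hX.eval_eq_zero hF h hxX)
    have hG0 : MvPolynomial.aeval m G ≠ 0 := fun h => hGy (hX.eval_eq_zero hG h hyX)
    obtain ⟨z, hz, hz0⟩ := hX.exists_eval_ne_zero (hF.mul hG)
      (by rw [map_mul]; exact mul_ne_zero hF0 hG0)
    rw [map_mul] at hz0
    exact ⟨z, hz, hFu z (left_ne_zero_of_mul hz0), hGv z (right_ne_zero_of_mul hz0)⟩

end IsGenericVector

/-! ### Maps given by forms -/

/-- The values at `v` of a family of polynomials. -/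
noncomputable def evalVec (Φ : τ → MvPolynomial σ ℂ) (v : σ → ℂ) : τ → ℂ :=
  fun j => MvPolynomial.eval v (Φ j)

theorem evalVec_smul {Φ : τ → MvPolynomial σ ℂ} {d : ℕ} (hΦ : ∀ j, (Φ j).IsHomogeneous d) (c : ℂ)
    (v : σ → ℂ) : evalVec Φ (c • v) = c ^ d • evalVec Φ v :=
  funext fun j => (hΦ j).eval_smul c v

theorem eval_evalVec (Φ : τ → MvPolynomial σ ℂ) (v : σ → ℂ) (F : MvPolynomial τ ℂ) :
    MvPolynomial.eval (evalVec Φ v) F = MvPolynomial.eval v (MvPolynomial.aeval Φ F) := by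
  have : ((MvPolynomial.aeval v : MvPolynomial σ ℂ →ₐ[ℂ] ℂ).comp (MvPolynomial.aeval Φ)) F =
      MvPolynomial.aeval (evalVec Φ v) F := by
    rw [MvPolynomial.comp_aeval]; rfl
  exact this.symm

theorem evalVec_evalVec {ρ : Type*} (Φ : τ → MvPolynomial σ ℂ) (Ψ : ρ → MvPolynomial τ ℂ)
    (v : σ → ℂ) :
    evalVec Ψ (evalVec Φ v) = evalVec (fun i => MvPolynomial.aeval Φ (Ψ i)) v :=
  funext fun i => eval_evalVec Φ v (Ψ i)

theorem aeval_aeval_vec (Φ : τ → MvPolynomial σ ℂ) (m : σ → K) (F : MvPolynomial τ ℂ) :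
    MvPolynomial.aeval m (MvPolynomial.aeval Φ F) =
      MvPolynomial.aeval (fun j => MvPolynomial.aeval m (Φ j)) F := by
  have : ((MvPolynomial.aeval m : MvPolynomial σ ℂ →ₐ[ℂ] K).comp (MvPolynomial.aeval Φ)) F =
      MvPolynomial.aeval (fun j => MvPolynomial.aeval m (Φ j)) F := by
    rw [MvPolynomial.comp_aeval]
  exact this

theorem isOpen_setOf_evalVec_ne_zero {Φ : τ → MvPolynomial σ ℂ} (hΦ : ∀ j, IsForm (Φ j)) :
    IsOpen {p : ℙ ℂ (σ → ℂ) | evalVec Φ p.rep ≠ 0} := by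
  have : {p : ℙ ℂ (σ → ℂ) | evalVec Φ p.rep ≠ 0} =
      ⋃ j, {p | MvPolynomial.eval p.rep (Φ j) ≠ 0} := by
    ext p
    simp [Function.ne_iff, evalVec]
  rw [this]
  exact isOpen_iUnion fun j => isOpen_setOf_eval_ne_zero (hΦ j)

variable {m : σ → K} {X : Set (ℙ ℂ (σ → ℂ))} {p : τ → K} {Y : Set (ℙ ℂ (τ → ℂ))}
  {Φ : τ → MvPolynomial σ ℂ} {Ψ : σ → MvPolynomial τ ℂ} {d e : ℕ} {c c' : K}

theorem IsGenericVector.mk_evalVec_mem (hX : IsGenericVector m X) (hY : IsGenericVector p Y)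
    (hΦ : ∀ j, (Φ j).IsHomogeneous d) (hΦm : ∀ j, MvPolynomial.aeval m (Φ j) = c * p j)
    {x : ℙ ℂ (σ → ℂ)} (hx : x ∈ X) (h : evalVec Φ x.rep ≠ 0) :
    Projectivization.mk ℂ (evalVec Φ x.rep) h ∈ Y := by
  rw [← hY.isClosed.closure_eq, mem_closure_iff_forms]
  intro F hF
  rw [eval_rep_mk_eq_zero_iff hF.1, eval_evalVec]
  obtain ⟨n, hn⟩ := hF.1
  refine hX.eval_eq_zero ⟨_, hn.aeval _ hΦ⟩ ?_ hx
  rw [aeval_aeval_vec, funext hΦm]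
  refine (hn.aeval_smul c p).trans ?_
  rw [(hY.aeval_eq_zero_iff F hF.1).mpr hF.2, mul_zero]

/-- If `Φ` and `Ψ` are inverse to each other at the generic points, then so they are at the points
where they are defined. -/
theorem IsGenericVector.evalVec_inverse (hX : IsGenericVector m X)
    (hΦ : ∀ j, (Φ j).IsHomogeneous d) (hΦm : ∀ j, MvPolynomial.aeval m (Φ j) = c * p j)
    (hΨ : ∀ i, (Ψ i).IsHomogeneous e) (hΨp : ∀ i, MvPolynomial.aeval p (Ψ i) = c' * m i)
    {x : ℙ ℂ (σ → ℂ)} (hx : x ∈ X) (h : evalVec Φ x.rep ≠ 0)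
    (h' : evalVec Ψ (evalVec Φ x.rep) ≠ 0) :
    ∃ h₁ : evalVec Ψ (Projectivization.mk ℂ (evalVec Φ x.rep) h).rep ≠ 0,
      Projectivization.mk ℂ (evalVec Ψ (Projectivization.mk ℂ (evalVec Φ x.rep) h).rep) h₁ = x ∧
      evalVec Φ (evalVec Ψ (Projectivization.mk ℂ (evalVec Φ x.rep) h).rep) ≠ 0 := by
  obtain ⟨a, ha⟩ := Projectivization.exists_smul_eq_mk_rep ℂ (evalVec Φ x.rep) h
  have ha0 : (a : ℂ) ^ e ≠ 0 := pow_ne_zero _ a.ne_zero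
  have h₁ : evalVec Ψ (Projectivization.mk ℂ (evalVec Φ x.rep) h).rep ≠ 0 := by
    rw [← ha, Units.smul_def, evalVec_smul hΨ]
    exact smul_ne_zero ha0 h'
  have hprop : ∀ i j, evalVec Ψ (evalVec Φ x.rep) i * x.rep j =
      evalVec Ψ (evalVec Φ x.rep) j * x.rep i := by
    intro i j
    have h0 : IsForm (MvPolynomial.aeval Φ (Ψ i) * MvPolynomial.X j -
        MvPolynomial.aeval Φ (Ψ j) * MvPolynomial.X i) :=
      ⟨_, (((hΨ i).aeval _ hΦ).mul (MvPolynomial.isHomogeneous_X ℂ j)).sub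
        (((hΨ j).aeval _ hΦ).mul (MvPolynomial.isHomogeneous_X ℂ i))⟩
    have hm : ∀ i, MvPolynomial.aeval m (MvPolynomial.aeval Φ (Ψ i)) = c ^ e * (c' * m i) := by
      intro i
      rw [aeval_aeval_vec, funext hΦm, ← hΨp]
      exact (hΨ i).aeval_smul c p
    have := hX.eval_eq_zero h0 (by
      rw [map_sub, map_mul, map_mul, hm, hm, MvPolynomial.aeval_X, MvPolynomial.aeval_X]
      ring) hx
    rw [map_sub, map_mul, map_mul, ← eval_evalVec, ← eval_evalVec, MvPolynomial.eval_X,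
      MvPolynomial.eval_X, sub_eq_zero] at this
    exact this
  have hxr := x.rep_nonzero
  obtain ⟨b, hb, hbx⟩ : ∃ b : ℂ, b ≠ 0 ∧
      evalVec Ψ (Projectivization.mk ℂ (evalVec Φ x.rep) h).rep = b • x.rep := by
    obtain ⟨j, hj⟩ := Function.ne_iff.mp hxr
    have hbx : evalVec Ψ (Projectivization.mk ℂ (evalVec Φ x.rep) h).rep =
        ((a : ℂ) ^ e * (evalVec Ψ (evalVec Φ x.rep) j / x.rep j)) • x.rep := by
      rw [← ha, Units.smul_def, evalVec_smul hΨ, mul_smul]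
      congr 1
      funext i
      rw [Pi.smul_apply, smul_eq_mul, div_mul_eq_mul_div, ← hprop i j, mul_div_cancel_right₀ _ hj]
    refine ⟨_, fun h0 => h₁ ?_, hbx⟩
    rw [hbx, h0, zero_smul]
  refine ⟨h₁, ?_, ?_⟩
  · exact ((Projectivization.mk_eq_mk_iff' ℂ _ _ h₁ hxr).mpr ⟨b, hbx.symm⟩).trans x.mk_rep
  · rw [hbx, evalVec_smul hΦ]
    exact smul_ne_zero (pow_ne_zero _ hb) h

theorem isRegularOn_of_forms (hΦ : ∀ j, (Φ j).IsHomogeneous d)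
    {f : ℙ ℂ (σ → ℂ) → ℙ ℂ (τ → ℂ)} {U : Set (ℙ ℂ (σ → ℂ))}
    (hf : ∀ x ∈ U, ∃ h : evalVec Φ x.rep ≠ 0, f x = Projectivization.mk ℂ _ h) :
    IsRegularOn f U :=
  fun _ _ => ⟨Set.univ, d, Φ, isOpen_univ, Set.mem_univ _, hΦ, fun y hy => hf y hy.1⟩

/-- If forms `Φ` and `Ψ` are inverse to each other at the generic points of `X` and `Y`, then a
partial map that is given by `Φ` wherever `Φ` does not vanish is a birational map. -/
theorem IsGenericVector.isBirational (hX : IsGenericVector m X) (hY : IsGenericVector p Y)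
    (hm : m ≠ 0) (hp : p ≠ 0)
    (hΦ : ∀ j, (Φ j).IsHomogeneous d) (hΦm : ∀ j, MvPolynomial.aeval m (Φ j) = c * p j)
    (hΨ : ∀ i, (Ψ i).IsHomogeneous e) (hΨp : ∀ i, MvPolynomial.aeval p (Ψ i) = c' * m i)
    (hc : c ≠ 0) (hc' : c' ≠ 0) (φ : ℙ ℂ (σ → ℂ) →. ℙ ℂ (τ → ℂ))
    (hφ : ∀ x ∈ X, ∀ h : evalVec Φ x.rep ≠ 0, Projectivization.mk ℂ _ h ∈ φ x) :
    IsBirational φ X Y := by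
  classical
  obtain ⟨x₀, hx₀⟩ := hX.isIrreducible.nonempty
  obtain ⟨y₀, hy₀⟩ := hY.isIrreducible.nonempty
  let f : ℙ ℂ (σ → ℂ) → ℙ ℂ (τ → ℂ) := fun x =>
    if h : evalVec Φ x.rep ≠ 0 then Projectivization.mk ℂ _ h else y₀
  let g : ℙ ℂ (τ → ℂ) → ℙ ℂ (σ → ℂ) := fun y =>
    if h : evalVec Ψ y.rep ≠ 0 then Projectivization.mk ℂ _ h else x₀
  let U := {x | x ∈ X ∧ evalVec Φ x.rep ≠ 0 ∧ evalVec Ψ (evalVec Φ x.rep) ≠ 0}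
  let V := {y | y ∈ Y ∧ evalVec Ψ y.rep ≠ 0 ∧ evalVec Φ (evalVec Ψ y.rep) ≠ 0}
  have hfU : ∀ x ∈ U, ∃ h : evalVec Φ x.rep ≠ 0, f x = Projectivization.mk ℂ _ h :=
    fun x hx => ⟨hx.2.1, dif_pos hx.2.1⟩
  have hgV : ∀ y ∈ V, ∃ h : evalVec Ψ y.rep ≠ 0, g y = Projectivization.mk ℂ _ h :=
    fun y hy => ⟨hy.2.1, dif_pos hy.2.1⟩
  have hfg : ∀ x ∈ U, f x ∈ V ∧ g (f x) = x := by
    intro x hx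
    obtain ⟨h, hfx⟩ := hfU x hx
    obtain ⟨h₁, h₂, h₃⟩ := hX.evalVec_inverse hΦ hΦm hΨ hΨp hx.1 h hx.2.2
    have hV : f x ∈ V := by
      rw [hfx]
      exact ⟨hX.mk_evalVec_mem hY hΦ hΦm hx.1 h, h₁, h₃⟩
    refine ⟨hV, ?_⟩
    rw [hfx]
    exact (dif_pos h₁).trans h₂
  have hgf : ∀ y ∈ V, g y ∈ U ∧ f (g y) = y := by
    intro y hy
    obtain ⟨h, hgy⟩ := hgV y hy
    obtain ⟨h₁, h₂, h₃⟩ := hY.evalVec_inverse hΨ hΨp hΦ hΦm hy.1 h hy.2.2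
    have hU : g y ∈ U := by
      rw [hgy]
      exact ⟨hY.mk_evalVec_mem hX hΨ hΨp hy.1 h, h₁, h₃⟩
    refine ⟨hU, ?_⟩
    rw [hgy]
    exact (dif_pos h₁).trans h₂
  have hU : U.Nonempty := by
    obtain ⟨i, hi⟩ := Function.ne_iff.mp hm
    obtain ⟨j, hj⟩ := Function.ne_iff.mp hp
    obtain ⟨x, hx, hx0⟩ := hX.exists_eval_ne_zero
      (F := MvPolynomial.aeval Φ (Ψ i) * Φ j) ⟨_, ((hΨ i).aeval _ hΦ).mul (hΦ j)⟩ (by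
        rw [map_mul, aeval_aeval_vec, hΦm, funext hΦm]
        refine mul_ne_zero ?_ (mul_ne_zero hc hj)
        refine ((hΨ i).aeval_smul c p).trans_ne ?_
        rw [hΨp]
        exact mul_ne_zero (pow_ne_zero _ hc) (mul_ne_zero hc' hi))
    rw [map_mul, ← eval_evalVec] at hx0
    exact ⟨x, hx, Function.ne_iff.mpr ⟨j, right_ne_zero_of_mul hx0⟩,
      Function.ne_iff.mpr ⟨i, left_ne_zero_of_mul hx0⟩⟩
  refine ⟨hX.isIrreducible, hY.isIrreducible, U, V, ⟨_, (isOpen_setOf_evalVec_ne_zero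
    fun j => ⟨d, hΦ j⟩).inter (isOpen_setOf_evalVec_ne_zero (fun i => ⟨_, (hΨ i).aeval _ hΦ⟩)), ?_⟩,
    hU, ⟨_, (isOpen_setOf_evalVec_ne_zero fun j => ⟨e, hΨ j⟩).inter
      (isOpen_setOf_evalVec_ne_zero (fun i => ⟨_, (hΦ i).aeval _ hΨ⟩)), ?_⟩, ?_, f, g, ?_,
    isRegularOn_of_forms hΦ hfU, isRegularOn_of_forms hΨ hgV, fun x hx => (hfg x hx).1,
    fun y hy => (hgf y hy).1, fun x hx => (hfg x hx).2, fun y hy => (hgf y hy).2⟩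
  · ext x
    rw [← funext fun v => evalVec_evalVec Φ Ψ v]
    exact Iff.rfl
  · ext x
    rw [← funext fun v => evalVec_evalVec Ψ Φ v]
    exact Iff.rfl
  · obtain ⟨x, hx⟩ := hU
    exact ⟨_, (hfg x hx).1⟩
  · intro x hx
    obtain ⟨h, hfx⟩ := hfU x hx
    rw [hfx]
    exact hφ x hx.1 h

end Zariski

/-! ### The function field of an irreducible closed set -/

section FunctionField

variable {σ : Type}

theorem IsIrreducible.exists_eval_mul_ne_zero {C : Set (ℙ ℂ (σ → ℂ))} (hC : IsIrreducible C)
    {F G : MvPolynomial σ ℂ} (hF : IsForm F) (hG : IsForm G)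
    (hF' : ∃ x ∈ C, MvPolynomial.eval x.rep F ≠ 0) (hG' : ∃ x ∈ C, MvPolynomial.eval x.rep G ≠ 0) :
    ∃ x ∈ C, MvPolynomial.eval x.rep F ≠ 0 ∧ MvPolynomial.eval x.rep G ≠ 0 :=
  hC.isPreirreducible _ _ (isOpen_setOf_eval_ne_zero hF) (isOpen_setOf_eval_ne_zero hG) hF' hG'

/-- The prime ideal of the affine part `X i₀ = 1` of an irreducible set. -/
theorem IsIrreducible.exists_prime_ideal {C : Set (ℙ ℂ (σ → ℂ))} (hC : IsIrreducible C) :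
    ∃ (i₀ : σ) (J : Ideal (MvPolynomial σ ℂ)), J.IsPrime ∧ MvPolynomial.X i₀ - 1 ∈ J ∧
      ∀ F, IsForm F → (F ∈ J ↔ ∀ x ∈ C, MvPolynomial.eval x.rep F = 0) := by
  obtain ⟨x₀, hx₀⟩ := hC.nonempty
  obtain ⟨i₀, hi₀⟩ := Function.ne_iff.mp x₀.rep_nonzero
  have hX : ∃ x ∈ C, MvPolynomial.eval x.rep (MvPolynomial.X i₀) ≠ 0 :=
    ⟨x₀, hx₀, by simpa using hi₀⟩
  let aff : ℙ ℂ (σ → ℂ) → σ → ℂ := fun x => (x.rep i₀)⁻¹ • x.rep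
  let J : Ideal (MvPolynomial σ ℂ) :=
    { carrier := {F | ∀ x ∈ C, x.rep i₀ ≠ 0 → MvPolynomial.eval (aff x) F = 0}
      zero_mem' := fun x _ _ => map_zero _
      add_mem' := fun hF hG x hx hx' => by rw [map_add, hF x hx hx', hG x hx hx', add_zero]
      smul_mem' := fun F G hG x hx hx' => by rw [smul_eq_mul, map_mul, hG x hx hx', mul_zero] }
  have hmem : ∀ F, F ∈ J ↔ ∀ x ∈ C, x.rep i₀ ≠ 0 → MvPolynomial.eval (aff x) F = 0 :=
    fun F => Iff.rfl
  have haff : ∀ x, x.rep i₀ ≠ 0 → aff x i₀ = 1 := fun x hx => inv_mul_cancel₀ hx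
  -- a polynomial outside `J` is nonzero at some point of the affine part, and so is its
  -- homogenisation
  have hhom : ∀ F, F ∉ J → ∃ H, IsForm H ∧ (∃ x ∈ C, MvPolynomial.eval x.rep H ≠ 0) ∧
      ∀ x : ℙ ℂ (σ → ℂ), x.rep i₀ ≠ 0 → MvPolynomial.eval x.rep H ≠ 0 →
        MvPolynomial.eval (aff x) F ≠ 0 := by
    intro F hF
    have key : ∀ x : ℙ ℂ (σ → ℂ), x.rep i₀ ≠ 0 →
        (MvPolynomial.eval x.rep (homogenizeAt i₀ F.totalDegree F) ≠ 0 ↔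
          MvPolynomial.eval (aff x) F ≠ 0) := by
      intro x hx
      have h1 : MvPolynomial.eval (aff x) (homogenizeAt i₀ F.totalDegree F) =
          MvPolynomial.eval (aff x) F := aeval_homogenizeAt (haff x hx) le_rfl
      rw [← h1, isHomogeneous_homogenizeAt.eval_smul, mul_ne_zero_iff,
        and_iff_right (pow_ne_zero _ (inv_ne_zero hx))]
    rw [hmem] at hF
    push Not at hF
    obtain ⟨x, hx, hx', hxF⟩ := hF
    exact ⟨_, ⟨_, isHomogeneous_homogenizeAt⟩, ⟨x, hx, (key x hx').mpr hxF⟩,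
      fun x hx => (key x hx).mp⟩
  refine ⟨i₀, J, ⟨?_, ?_⟩, ?_, ?_⟩
  · rw [Ideal.ne_top_iff_one, hmem]
    intro h
    simpa using h x₀ hx₀ hi₀
  · intro F G hFG
    by_contra! hcon
    obtain ⟨H, hH, hHx, hHF⟩ := hhom F hcon.1
    obtain ⟨H', hH', hHx', hHG⟩ := hhom G hcon.2
    obtain ⟨x, hx, hx1, hx2⟩ := hC.exists_eval_mul_ne_zero hH hH' hHx hHx'
    obtain ⟨x, hx, hx1, hx2⟩ := hC.exists_eval_mul_ne_zero (hH.mul hH') (isForm_X i₀)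
      ⟨x, hx, by rw [map_mul]; exact mul_ne_zero hx1 hx2⟩ hX
    rw [map_mul] at hx1
    rw [MvPolynomial.eval_X] at hx2
    have := hFG x hx hx2
    rw [map_mul] at this
    exact mul_ne_zero (hHF x hx2 (left_ne_zero_of_mul hx1))
      (hHG x hx2 (right_ne_zero_of_mul hx1)) this
  · intro x _ hx'
    rw [map_sub, MvPolynomial.eval_X, haff x hx', map_one, sub_self]
  · intro F hF
    obtain ⟨d, hd⟩ := hF
    have key : ∀ x : ℙ ℂ (σ → ℂ), x.rep i₀ ≠ 0 →
        (MvPolynomial.eval (aff x) F = 0 ↔ MvPolynomial.eval x.rep F = 0) := by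
      intro x hx
      rw [hd.eval_smul, mul_eq_zero, or_iff_right (pow_ne_zero _ (inv_ne_zero hx))]
    constructor
    · intro hFJ
      by_contra! hcon
      obtain ⟨x, hx, hx1, hx2⟩ := hC.exists_eval_mul_ne_zero ⟨d, hd⟩ (isForm_X i₀) hcon hX
      rw [MvPolynomial.eval_X] at hx2
      exact hx1 ((key x hx2).mp (hFJ x hx hx2))
    · exact fun h x hx hx' => (key x hx').mpr (h x hx)

/-- The vector of the classes of the coordinates in the fraction field of `ℂ[X] ⧸ J`. -/
noncomputable def genericVector (J : Ideal (MvPolynomial σ ℂ)) :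
    σ → FractionRing (MvPolynomial σ ℂ ⧸ J) :=
  fun i => algebraMap _ _ (Ideal.Quotient.mk J (MvPolynomial.X i))

theorem aeval_genericVector (J : Ideal (MvPolynomial σ ℂ)) (F : MvPolynomial σ ℂ) :
    MvPolynomial.aeval (genericVector J) F =
      algebraMap (MvPolynomial σ ℂ ⧸ J) (FractionRing (MvPolynomial σ ℂ ⧸ J))
        (Ideal.Quotient.mk J F) := by
  have : MvPolynomial.aeval (genericVector J) = (IsScalarTower.toAlgHom ℂ (MvPolynomial σ ℂ ⧸ J)
      (FractionRing (MvPolynomial σ ℂ ⧸ J))).comp (Ideal.Quotient.mkₐ ℂ J) := by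
    ext i
    rw [MvPolynomial.aeval_X]
    rfl
  rw [this]
  rfl

theorem aeval_genericVector_eq_zero_iff {J : Ideal (MvPolynomial σ ℂ)} [J.IsPrime]
    {F : MvPolynomial σ ℂ} : MvPolynomial.aeval (genericVector J) F = 0 ↔ F ∈ J := by
  rw [aeval_genericVector, IsFractionRing.to_map_eq_zero_iff, Ideal.Quotient.eq_zero_iff_mem]

theorem genericVector_eq_one {J : Ideal (MvPolynomial σ ℂ)} {i₀ : σ}
    (h : MvPolynomial.X i₀ - 1 ∈ J) : genericVector J i₀ = 1 := by
  rw [genericVector, (Ideal.Quotient.eq (x := MvPolynomial.X i₀) (y := 1)).mpr h, map_one, map_one]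

/-- By the Nullstellensatz, every prime ideal containing `X i₀ - 1` is the ideal of the affine part
of an irreducible closed set. -/
theorem exists_isGenericVector [Finite σ] {J : Ideal (MvPolynomial σ ℂ)} [J.IsPrime] {i₀ : σ}
    (h : MvPolynomial.X i₀ - 1 ∈ J) : ∃ Z, IsGenericVector (genericVector J) Z := by
  refine ⟨projZeroLocus {F | IsForm F ∧ F ∈ J},
    isClosed_iff_exists_forms.mpr ⟨_, fun F hF => hF.1, rfl⟩, fun F hF => ?_⟩
  rw [aeval_genericVector_eq_zero_iff]
  refine ⟨fun hFJ x hx => hx F ⟨hF, hFJ⟩, fun hFZ => ?_⟩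
  rw [← MvPolynomial.IsPrime.vanishingIdeal_zeroLocus (K := ℂ) J]
  intro a ha
  have ha1 : a i₀ = 1 := by
    have := ha _ h
    rwa [map_sub, MvPolynomial.aeval_X, map_one, sub_eq_zero] at this
  have ha0 : a ≠ 0 := fun h0 => by simp [h0] at ha1
  have := hFZ (Projectivization.mk ℂ a ha0) fun G hG =>
    (eval_rep_mk_eq_zero_iff hG.1 ha0).mpr (ha G hG.2)
  exact (eval_rep_mk_eq_zero_iff hF ha0).mp this

/-! ### The transcendence degree of the function field of a curve -/

/-- An irreducible closed subset of `C`, as an irreducible closed subset of the space `C`. -/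
theorem IsIrreducible.preimage_val {C Z : Set (ℙ ℂ (σ → ℂ))} (hZ : IsIrreducible Z) (hZC : Z ⊆ C) :
    IsIrreducible (Subtype.val ⁻¹' Z : Set C) := by
  constructor
  · obtain ⟨z, hz⟩ := hZ.nonempty
    exact ⟨⟨z, hZC hz⟩, hz⟩
  · rintro _ _ ⟨u, hu, rfl⟩ ⟨v, hv, rfl⟩ ⟨x, hx, hxu⟩ ⟨y, hy, hyv⟩
    obtain ⟨z, hz, hzu, hzv⟩ := hZ.isPreirreducible u v hu hv ⟨x, hx, hxu⟩ ⟨y, hy, hyv⟩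
    exact ⟨⟨z, hZC hz⟩, hz, hzu, hzv⟩

theorem two_le_topologicalKrullDim {C Z Z' : Set (ℙ ℂ (σ → ℂ))} (hC : IsClosed C)
    (hCi : IsIrreducible C) (hZ : IsClosed Z) (hZi : IsIrreducible Z) (hZ' : IsClosed Z')
    (hZi' : IsIrreducible Z') (h1 : Z' ⊂ Z) (h2 : Z ⊂ C) : 2 ≤ topologicalKrullDim C := by
  let A : TopologicalSpace.IrreducibleCloseds C :=
    ⟨_, hZi'.preimage_val (h1.1.trans h2.1), hZ'.preimage continuous_subtype_val⟩
  let B : TopologicalSpace.IrreducibleCloseds C :=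
    ⟨_, hZi.preimage_val h2.1, hZ.preimage continuous_subtype_val⟩
  let D : TopologicalSpace.IrreducibleCloseds C :=
    ⟨_, hCi.preimage_val subset_rfl, hC.preimage continuous_subtype_val⟩
  have hAB : A < B := by
    refine ⟨fun x hx => h1.1 hx, fun hle => h1.2 fun x hx => ?_⟩
    exact hle (show (⟨x, h2.1 hx⟩ : C) ∈ B from hx)
  have hBD : B < D := by
    refine ⟨fun x hx => h2.1 hx, fun hle => h2.2 fun x hx => ?_⟩
    exact hle (show (⟨x, hx⟩ : C) ∈ D from hx)
  exact Order.LTSeries.length_le_krullDim (α := TopologicalSpace.IrreducibleCloseds C)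
    { length := 2, toFun := ![A, B, D], step := fun i => by fin_cases i <;> assumption }

theorem isClosed_singleton_projectivization (z : ℙ ℂ (σ → ℂ)) : IsClosed {z} := by
  rw [← closure_subset_iff_isClosed]
  intro x hx
  rw [mem_closure_iff_forms] at hx
  rw [Set.mem_singleton_iff, ← x.mk_rep, ← z.mk_rep]
  refine Projectivization.mk_eq_mk_of_mul_eq _ _ fun i j => ?_
  have h0 : MvPolynomial.X i * MvPolynomial.C (z.rep j) -
      MvPolynomial.X j * MvPolynomial.C (z.rep i) ∈ vanishingForms {z} := by
    refine ⟨⟨1, ?_⟩, ?_⟩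
    · simpa only [add_zero] using (((MvPolynomial.isHomogeneous_X ℂ i).mul
        (MvPolynomial.isHomogeneous_C _ _)).sub
        ((MvPolynomial.isHomogeneous_X ℂ j).mul (MvPolynomial.isHomogeneous_C _ _)))
    · rintro _ rfl
      simp [mul_comm]
  have := hx _ h0
  simpa [sub_eq_zero] using this

variable {K : Type*} [Field K] [Algebra ℂ K]

/-- The coordinates of a generic point are constant exactly for single points. -/
theorem IsGenericVector.subsingleton_iff {m : σ → K} {X : Set (ℙ ℂ (σ → ℂ))}
    (hX : IsGenericVector m X) {i₀ : σ} (hm : m i₀ = 1) :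
    X.Subsingleton ↔ ∀ i, ∃ a : ℂ, algebraMap ℂ K a = m i := by
  have hform : ∀ i j (a b : ℂ), IsForm (MvPolynomial.X i * MvPolynomial.C a -
      MvPolynomial.X j * MvPolynomial.C b : MvPolynomial σ ℂ) := fun i j a b =>
    ⟨1, by simpa only [add_zero] using (((MvPolynomial.isHomogeneous_X ℂ i).mul
        (MvPolynomial.isHomogeneous_C _ _)).sub
        ((MvPolynomial.isHomogeneous_X ℂ j).mul (MvPolynomial.isHomogeneous_C _ _)))⟩
  constructor
  · intro h i
    obtain ⟨x, hx, hx0⟩ := hX.exists_eval_ne_zero (isForm_X i₀)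
      (by rw [MvPolynomial.aeval_X, hm]; exact one_ne_zero)
    rw [MvPolynomial.eval_X] at hx0
    refine ⟨x.rep i / x.rep i₀, ?_⟩
    have := (hX.aeval_eq_zero_iff _ (hform i i₀ (x.rep i₀) (x.rep i))).mpr fun y hy => by
      rw [h hy hx]
      simp [mul_comm]
    rw [map_sub, map_mul, map_mul, MvPolynomial.aeval_X, MvPolynomial.aeval_X, hm,
      MvPolynomial.aeval_C, MvPolynomial.aeval_C, sub_eq_zero, one_mul] at this
    rw [map_div₀, ← this, mul_div_cancel_right₀]
    simpa using hx0
  · intro h x hx y hy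
    choose a ha using h
    have ha0 : a i₀ = 1 := (algebraMap ℂ K).injective (by rw [ha, hm, map_one])
    have ha0' : a ≠ 0 := fun h => by simp [h] at ha0
    have key : ∀ x ∈ X, x = Projectivization.mk ℂ a ha0' := by
      intro x hx
      rw [← x.mk_rep]
      refine Projectivization.mk_eq_mk_of_mul_eq _ _ fun i j => ?_
      have := hX.eval_eq_zero (hform i j (a j) (a i)) (by simp [ha, mul_comm]) hx
      simpa [sub_eq_zero] using this
    rw [key x hx, key y hy]

end FunctionField

section FunctionFieldOfCurve

variable {σ : Type}

/-- If the affine coordinate ring is integral over `ℂ`, then the generic point is constant. -/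
theorem exists_eq_genericVector_of_isIntegral_zero {J : Ideal (MvPolynomial σ ℂ)} [J.IsPrime]
    (g : MvPolynomial (Fin 0) ℂ →ₐ[ℂ] MvPolynomial σ ℂ ⧸ J) (hg : g.IsIntegral) (i : σ) :
    ∃ a : ℂ, algebraMap ℂ _ a = genericVector J i := by
  have hint : IsIntegral ℂ (Ideal.Quotient.mk J (MvPolynomial.X i)) := by
    have h1 : (g.toRingHom.comp
        (MvPolynomial.isEmptyAlgEquiv ℂ (Fin 0)).symm.toRingHom).IsIntegral :=
      RingHom.IsIntegral.trans _ _ (RingHom.isIntegral_of_surjective _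
        (MvPolynomial.isEmptyAlgEquiv ℂ (Fin 0)).symm.surjective) hg
    have h2 : g.toRingHom.comp (MvPolynomial.isEmptyAlgEquiv ℂ (Fin 0)).symm.toRingHom =
        algebraMap ℂ (MvPolynomial σ ℂ ⧸ J) := by
      refine RingHom.ext fun a => ?_
      exact (g.comp (MvPolynomial.isEmptyAlgEquiv ℂ (Fin 0)).symm.toAlgHom).commutes a
    have := h1 (Ideal.Quotient.mk J (MvPolynomial.X i))
    rwa [h2] at this
  have hint' : IsIntegral ℂ (genericVector J i) :=
    hint.map (IsScalarTower.toAlgHom ℂ (MvPolynomial σ ℂ ⧸ J)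
      (FractionRing (MvPolynomial σ ℂ ⧸ J)))
  exact minpoly.mem_range_of_degree_eq_one ℂ _
    (IsAlgClosed.degree_eq_one_of_irreducible ℂ (minpoly.irreducible hint'))

variable [Finite σ]

/-- If the affine coordinate ring of `C` is integral over a polynomial ring in at least two
variables, then the zero locus of one of them contains a closed irreducible set that is neither a
point nor `C`, so that `C` is not a curve. -/
theorem two_le_topologicalKrullDim_of_isIntegral {C : Set (ℙ ℂ (σ → ℂ))}
    {J : Ideal (MvPolynomial σ ℂ)} [J.IsPrime] {i₀ : σ} (h : MvPolynomial.X i₀ - 1 ∈ J)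
    (hC : IsGenericVector (genericVector J) C) {n : ℕ}
    (g : MvPolynomial (Fin (n + 2)) ℂ →ₐ[ℂ] MvPolynomial σ ℂ ⧸ J) (hinj : Function.Injective g)
    (hg : g.IsIntegral) : 2 ≤ topologicalKrullDim C := by
  let : Algebra (MvPolynomial (Fin (n + 2)) ℂ) (MvPolynomial σ ℂ ⧸ J) := g.toRingHom.toAlgebra
  have hint : Algebra.IsIntegral (MvPolynomial (Fin (n + 2)) ℂ) (MvPolynomial σ ℂ ⧸ J) := ⟨hg⟩
  let I : Ideal (MvPolynomial (Fin (n + 2)) ℂ) := Ideal.span {MvPolynomial.X 0}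
  have hI : I.IsPrime := by
    rw [Ideal.span_singleton_prime (MvPolynomial.X_ne_zero _)]
    exact MvPolynomial.X_prime
  obtain ⟨Q, hQ, hQI⟩ := Ideal.exists_ideal_over_prime_of_isIntegral_of_isDomain
    (S := MvPolynomial σ ℂ ⧸ J) I (by
      have : RingHom.ker (algebraMap (MvPolynomial (Fin (n + 2)) ℂ) (MvPolynomial σ ℂ ⧸ J)) = ⊥ :=
        (RingHom.injective_iff_ker_eq_bot _).mp hinj
      rw [this]; exact bot_le)
  let P : Ideal (MvPolynomial σ ℂ) := Q.comap (Ideal.Quotient.mk J)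
  have hP : P.IsPrime := Ideal.comap_isPrime _ _
  have hJP : J ≤ P := by
    intro F hF
    change Ideal.Quotient.mk J F ∈ Q
    rw [Ideal.Quotient.eq_zero_iff_mem.mpr hF]
    exact Q.zero_mem
  obtain ⟨Z, hZ⟩ := exists_isGenericVector (hJP h)
  have hlift : ∀ a, ∃ F, Ideal.Quotient.mk J F = g a :=
    fun a => Ideal.Quotient.mk_surjective (g a)
  obtain ⟨F₀, hF₀⟩ := hlift (MvPolynomial.X 0)
  obtain ⟨F₁, hF₁⟩ := hlift (MvPolynomial.X 1)
  have hF₀P : F₀ ∈ P := by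
    change Ideal.Quotient.mk J F₀ ∈ Q
    rw [hF₀]
    have : MvPolynomial.X 0 ∈ Q.comap (algebraMap (MvPolynomial (Fin (n + 2)) ℂ) _) := by
      rw [hQI]; exact Ideal.subset_span rfl
    exact this
  have hF₀J : F₀ ∉ J := by
    rw [← Ideal.Quotient.eq_zero_iff_mem, hF₀, map_eq_zero_iff g hinj]
    exact MvPolynomial.X_ne_zero _
  have hZC : Z ⊂ C := by
    refine ⟨fun x hx => ?_, fun hle => hF₀J ?_⟩
    · rw [← hC.isClosed.closure_eq, mem_closure_iff_forms]
      intro F hF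
      refine hZ.eval_eq_zero hF.1 (aeval_genericVector_eq_zero_iff.mpr (hJP ?_)) hx
      exact aeval_genericVector_eq_zero_iff.mp ((hC.aeval_eq_zero_iff F hF.1).mpr hF.2)
    · have hH := isHomogeneous_homogenizeAt (i₀ := i₀) (e := F₀.totalDegree) (F := F₀)
      rw [← aeval_genericVector_eq_zero_iff,
        ← aeval_homogenizeAt (genericVector_eq_one h) le_rfl, hC.aeval_eq_zero_iff _ ⟨_, hH⟩]
      intro x hx
      refine hZ.eval_eq_zero ⟨_, hH⟩ ?_ (hle hx)
      rw [aeval_homogenizeAt (genericVector_eq_one (hJP h)) le_rfl,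
        aeval_genericVector_eq_zero_iff]
      exact hF₀P
  -- the second variable is not constant on `Z`
  have hZs : ¬ Z.Subsingleton := by
    rw [hZ.subsingleton_iff (genericVector_eq_one (hJP h))]
    intro hcon
    choose a ha using hcon
    have h1 : MvPolynomial.aeval (genericVector P) F₁ =
        algebraMap ℂ _ (MvPolynomial.eval a F₁) := by
      rw [← funext ha, ← MvPolynomial.aeval_eq_eval]
      exact MvPolynomial.aeval_algebraMap_apply _ a F₁
    have h2 : F₁ - MvPolynomial.C (MvPolynomial.eval a F₁) ∈ P := by
      rw [← aeval_genericVector_eq_zero_iff, map_sub, h1, MvPolynomial.aeval_C, sub_self]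
    have h3 : MvPolynomial.X 1 - MvPolynomial.C (MvPolynomial.eval a F₁) ∈ I := by
      rw [← hQI]
      change g _ ∈ Q
      have h4 : Ideal.Quotient.mk J (F₁ - MvPolynomial.C (MvPolynomial.eval a F₁)) ∈ Q := h2
      rw [map_sub, hF₁] at h4
      rw [map_sub]
      convert h4 using 2
      rw [← MvPolynomial.algebraMap_eq, AlgHom.commutes]
      rfl
    obtain ⟨G, hG⟩ := Ideal.mem_span_singleton.mp h3
    have := congrArg (MvPolynomial.eval
      (fun i => if i = 0 then 0 else MvPolynomial.eval a F₁ + 1 : Fin (n + 2) → ℂ)) hG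
    simp at this
  obtain ⟨z, hz⟩ := hZ.isIrreducible.nonempty
  refine two_le_topologicalKrullDim hC.isClosed hC.isIrreducible hZ.isClosed hZ.isIrreducible
    (isClosed_singleton_projectivization z) isIrreducible_singleton
    ⟨Set.singleton_subset_iff.mpr hz, fun hle => hZs ?_⟩ hZC
  exact Set.subsingleton_singleton.anti hle

/-- The function field of a curve has transcendence degree one. -/
theorem IsIrreducibleCurve.exists_isTranscendenceBasis {C : Set (ℙ ℂ (σ → ℂ))}
    (hC : IsIrreducibleCurve C) {J : Ideal (MvPolynomial σ ℂ)} [J.IsPrime] {i₀ : σ}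
    (h : MvPolynomial.X i₀ - 1 ∈ J) (hJ : IsGenericVector (genericVector J) C) :
    ∃ F : MvPolynomial σ ℂ, IsTranscendenceBasis ℂ
      fun _ : Unit => MvPolynomial.aeval (genericVector J) F := by
  obtain ⟨s, g, hinj, hg⟩ := exists_integral_inj_algHom_of_fg ℂ (MvPolynomial σ ℂ ⧸ J)
  match s, g, hinj, hg with
  | 0, g, hinj, hg =>
    exfalso
    have hsub : C.Subsingleton := (hJ.subsingleton_iff (genericVector_eq_one h)).mpr
      (exists_eq_genericVector_of_isIntegral_zero g hg)
    have : Subsingleton C := hsub.coe_sort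
    have h0 := topologicalKrullDim_zero_of_discreteTopology C
    rw [hC.dim_eq_one] at h0
    exact absurd h0 (by decide)
  | n + 2, g, hinj, hg =>
    exfalso
    have h0 := two_le_topologicalKrullDim_of_isIntegral h hJ g hinj hg
    rw [hC.dim_eq_one] at h0
    exact absurd h0 (by decide)
  | 1, g, hinj, hg =>
    let : Algebra (MvPolynomial (Fin 1) ℂ) (MvPolynomial σ ℂ ⧸ J) := g.toRingHom.toAlgebra
    have : IsScalarTower ℂ (MvPolynomial (Fin 1) ℂ) (MvPolynomial σ ℂ ⧸ J) :=
      .of_algebraMap_eq fun a => (g.commutes a).symm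
    have hint : Algebra.IsIntegral (MvPolynomial (Fin 1) ℂ) (MvPolynomial σ ℂ ⧸ J) := ⟨hg⟩
    have : FaithfulSMul (MvPolynomial (Fin 1) ℂ) (MvPolynomial σ ℂ ⧸ J) :=
      (faithfulSMul_iff_algebraMap_injective _ _).mpr hinj
    have h1 : IsTranscendenceBasis ℂ (algebraMap (MvPolynomial (Fin 1) ℂ) (MvPolynomial σ ℂ ⧸ J) ∘
        MvPolynomial.X) := (IsTranscendenceBasis.mvPolynomial (Fin 1) ℂ).algebraMap_comp
    have : Algebra.IsAlgebraic (MvPolynomial σ ℂ ⧸ J) (FractionRing (MvPolynomial σ ℂ ⧸ J)) :=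
      IsFractionRing.comap_isAlgebraic_iff
        (K := FractionRing (MvPolynomial σ ℂ ⧸ J)).mpr inferInstance
    have h2 : IsTranscendenceBasis ℂ (algebraMap (MvPolynomial σ ℂ ⧸ J)
        (FractionRing (MvPolynomial σ ℂ ⧸ J)) ∘ (algebraMap (MvPolynomial (Fin 1) ℂ)
          (MvPolynomial σ ℂ ⧸ J) ∘ MvPolynomial.X)) := h1.algebraMap_comp
    obtain ⟨F, hF⟩ := Ideal.Quotient.mk_surjective (g (MvPolynomial.X 0))
    refine ⟨F, ?_⟩
    rw [← isTranscendenceBasis_equiv (Equiv.ofUnique (Fin 1) Unit)]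
    convert h2 using 1
    funext i
    rw [Subsingleton.elim i 0]
    simp only [Function.comp_apply]
    rw [aeval_genericVector, hF]
    rfl

end FunctionFieldOfCurve

/-! ### The tangent line at the generic point -/

section Tangent

variable {σ : Type} {J : Ideal (MvPolynomial σ ℂ)} {i₀ : σ}

theorem smul_eq_aeval_genericVector_mul (F : MvPolynomial σ ℂ)
    (x : FractionRing (MvPolynomial σ ℂ ⧸ J)) :
    F • x = MvPolynomial.aeval (genericVector J) F * x := by
  rw [Algebra.smul_def, aeval_genericVector]
  rfl

variable [Fintype σ]

theorem Derivation.apply_mvPolynomial_eq_sum_pderiv {R M : Type*} [CommRing R] [AddCommGroup M]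
    [Module R M] [Module (MvPolynomial σ R) M] [IsScalarTower R (MvPolynomial σ R) M]
    (d : Derivation R (MvPolynomial σ R) M) (F : MvPolynomial σ R) :
    d F = ∑ i, MvPolynomial.pderiv i F • d (MvPolynomial.X i) := by
  classical
  induction F using MvPolynomial.induction_on with
  | C a => simp [← MvPolynomial.algebraMap_eq]
  | add p q hp hq => simp [hp, hq, add_smul, Finset.sum_add_distrib]
  | mul_X p j hp =>
    simp only [Derivation.leibniz, hp, MvPolynomial.pderiv_X, smul_eq_mul, add_smul,
      Finset.sum_add_distrib, mul_smul, Finset.smul_sum]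
    congr 1
    rw [← Finset.smul_sum, Finset.sum_eq_single j]
    · simp
    · intro i _ hi
      simp [Pi.single_eq_of_ne hi.symm]
    · simp

/-- A vector `v` that is tangent to the affine part of `C` at its generic point is a derivation of
the affine coordinate ring into the function field. -/
theorem exists_derivation_of_tangent [J.IsPrime]
    {v : σ → FractionRing (MvPolynomial σ ℂ ⧸ J)}
    (hv : ∀ F ∈ J, ∑ i, MvPolynomial.aeval (genericVector J) (MvPolynomial.pderiv i F) * v i = 0) :
    ∃ D : Derivation ℂ (FractionRing (MvPolynomial σ ℂ ⧸ J))
        (FractionRing (MvPolynomial σ ℂ ⧸ J)), ∀ i, D (genericVector J i) = v i := by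
  let A := MvPolynomial σ ℂ ⧸ J
  let K := FractionRing A
  let d : Derivation ℂ (MvPolynomial σ ℂ) K := MvPolynomial.mkDerivation ℂ v
  have hd : ∀ F, d F =
      ∑ i, MvPolynomial.aeval (genericVector J) (MvPolynomial.pderiv i F) * v i := by
    intro F
    rw [d.apply_mvPolynomial_eq_sum_pderiv]
    refine Finset.sum_congr rfl fun i _ => ?_
    rw [MvPolynomial.mkDerivation_X, smul_eq_aeval_genericVector_mul]
  let l : A →ₗ[ℂ] K := Submodule.liftQ (J.restrictScalars ℂ) d.toLinearMap fun F hF =>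
    (hd F).trans (hv F hF)
  have hl : ∀ F, l (Ideal.Quotient.mk J F) = d F := fun F => rfl
  let d' : Derivation ℂ A K :=
    { toLinearMap := l
      map_one_eq_zero' := (hl 1).trans d.map_one_eq_zero
      leibniz' := fun a b => by
        obtain ⟨F, rfl⟩ := Ideal.Quotient.mk_surjective a
        obtain ⟨G, rfl⟩ := Ideal.Quotient.mk_surjective b
        change l (Ideal.Quotient.mk J F * Ideal.Quotient.mk J G) = _ • l _ + _ • l _
        rw [← map_mul, hl, hl, hl, d.leibniz, ← algebraMap_smul A F, ← algebraMap_smul A G]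
        rfl }
  have : Algebra.FormallyEtale A K := Algebra.FormallyEtale.of_isLocalization (nonZeroDivisors A)
  obtain ⟨D, hD⟩ := Derivation.exists_extend_of_formallyEtale (T := K) d'
  refine ⟨D, fun i => (hD _).trans ?_⟩
  exact (hl _).trans (MvPolynomial.mkDerivation_X _ _ _)

theorem Derivation.apply_aeval_eq_sum {K : Type*} [Field K] [Algebra ℂ K] (D : Derivation ℂ K K)
    (m : σ → K) (F : MvPolynomial σ ℂ) :
    D (MvPolynomial.aeval m F) =
      ∑ i, MvPolynomial.aeval m (MvPolynomial.pderiv i F) * D (m i) := by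
  let : Algebra (MvPolynomial σ ℂ) K := (MvPolynomial.aeval m : _ →ₐ[ℂ] K).toAlgebra
  have : IsScalarTower ℂ (MvPolynomial σ ℂ) K :=
    .of_algebraMap_eq fun r => (AlgHom.commutes (MvPolynomial.aeval m : _ →ₐ[ℂ] K) r).symm
  have h := (D.compAlgebraMap (MvPolynomial σ ℂ)).apply_mvPolynomial_eq_sum_pderiv F
  refine h.trans (Finset.sum_congr rfl fun i _ => ?_)
  rw [Algebra.smul_def]
  change MvPolynomial.aeval m _ * D (MvPolynomial.aeval m (MvPolynomial.X i)) = _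
  rw [MvPolynomial.aeval_X]

/-- If `y` is a transcendence basis, then `d/dy` spans the derivations. -/
theorem IsTranscendenceBasis.derivation_apply_eq {k K : Type*} [Field k] [CharZero k] [Field K]
    [Algebra k K] {y : K} (hy : IsTranscendenceBasis k fun _ : Unit => y) {D : Derivation k K K}
    (hDy : D y = 1) (E : Derivation k K K) (x : K) : E x = E y * D x :=
  congrArg (fun D : Derivation k K K => D x)
    (hy.derivation_ext (D₁ := E) (D₂ := E y • D) fun _ => by simp [hDy])

/-- Euler's identity at a zero of `F`. -/
theorem MvPolynomial.IsHomogeneous.sum_pderiv_mul_eq_zero {K : Type*} [Field K] [Algebra ℂ K]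
    {m : σ → K} {F : MvPolynomial σ ℂ} {d : ℕ} (hF : F.IsHomogeneous d)
    (h0 : MvPolynomial.aeval m F = 0) :
    ∑ i, MvPolynomial.aeval m (MvPolynomial.pderiv i F) * m i = 0 := by
  have := congrArg (MvPolynomial.aeval m) hF.sum_X_mul_pderiv
  rw [map_sum, map_nsmul, h0, smul_zero] at this
  rw [← this]
  exact Finset.sum_congr rfl fun i _ => by rw [map_mul, MvPolynomial.aeval_X, mul_comm]

/-- The tangent space at the generic point `m` of a curve is spanned by `m` and its derivative. -/
theorem exists_eq_add_of_tangent {C : Set (ℙ ℂ (σ → ℂ))} [J.IsPrime]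
    (h : MvPolynomial.X i₀ - 1 ∈ J) (hJ : IsGenericVector (genericVector J) C)
    {y : FractionRing (MvPolynomial σ ℂ ⧸ J)} (hy : IsTranscendenceBasis ℂ fun _ : Unit => y)
    {D : Derivation ℂ (FractionRing (MvPolynomial σ ℂ ⧸ J)) (FractionRing (MvPolynomial σ ℂ ⧸ J))}
    (hDy : D y = 1) {v : σ → FractionRing (MvPolynomial σ ℂ ⧸ J)}
    (hv : ∀ F ∈ vanishingForms C,
      ∑ i, MvPolynomial.aeval (genericVector J) (MvPolynomial.pderiv i F) * v i = 0) :
    ∃ a b : FractionRing (MvPolynomial σ ℂ ⧸ J),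
      v = a • genericVector J + b • (D ∘ genericVector J) := by
  classical
  set m := genericVector J with hm
  have hm₀ : m i₀ = 1 := genericVector_eq_one h
  -- subtracting a multiple of `m` makes the coordinate `i₀` of `v` vanish
  let w := v - v i₀ • m
  have hw₀ : w i₀ = 0 := by simp [w, hm₀]
  have hw : ∀ F ∈ vanishingForms C,
      ∑ i, MvPolynomial.aeval m (MvPolynomial.pderiv i F) * w i = 0 := by
    intro F hF
    obtain ⟨d, hd⟩ := hF.1
    have h1 := hd.sum_pderiv_mul_eq_zero ((hJ.aeval_eq_zero_iff F hF.1).mpr hF.2)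
    have h2 : ∀ i, MvPolynomial.aeval m (MvPolynomial.pderiv i F) * w i =
        MvPolynomial.aeval m (MvPolynomial.pderiv i F) * v i -
          v i₀ * (MvPolynomial.aeval m (MvPolynomial.pderiv i F) * m i) := fun i => by
      simp only [w, Pi.sub_apply, Pi.smul_apply, smul_eq_mul]; ring
    simp only [h2, Finset.sum_sub_distrib, ← Finset.mul_sum]
    rw [hv F hF, h1, mul_zero, sub_zero]
  obtain ⟨E, hE⟩ := exists_derivation_of_tangent (J := J) (v := w) fun F hF => by
    let δ : Derivation ℂ (MvPolynomial σ ℂ) (FractionRing (MvPolynomial σ ℂ ⧸ J)) :=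
      MvPolynomial.mkDerivation ℂ w
    have hsmul : ∀ (G : MvPolynomial σ ℂ) (x : FractionRing (MvPolynomial σ ℂ ⧸ J)),
        G • x = MvPolynomial.aeval m G * x := smul_eq_aeval_genericVector_mul
    have hδX : ∀ i, δ (MvPolynomial.X i) = w i := MvPolynomial.mkDerivation_X _ _
    have hδ : ∀ G, δ G = ∑ i, MvPolynomial.aeval m (MvPolynomial.pderiv i G) * w i := fun G => by
      simp only [δ.apply_mvPolynomial_eq_sum_pderiv G, hsmul, hδX]
    -- homogenising with respect to `X i₀` changes neither the value nor this derivation at `m`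
    have hδh : δ (homogenizeAt i₀ F.totalDegree F) = δ F := by
      conv_rhs => rw [← sum_range_homogeneousComponent (F := F) le_rfl]
      rw [homogenizeAt, map_sum, map_sum]
      refine Finset.sum_congr rfl fun d _ => ?_
      have h0 : δ (MvPolynomial.X i₀ ^ (F.totalDegree - d)) = 0 := by
        rw [δ.leibniz_pow, hδX, hw₀, smul_zero]
        exact nsmul_zero _
      rw [δ.leibniz, h0, smul_zero, add_zero, hsmul,
        map_pow, MvPolynomial.aeval_X, hm₀, one_pow, one_mul]
    rw [← hδ, ← hδh, hδ]
    refine hw _ ⟨⟨_, isHomogeneous_homogenizeAt⟩, ?_⟩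
    rw [← hJ.aeval_eq_zero_iff _ ⟨_, isHomogeneous_homogenizeAt⟩, aeval_homogenizeAt hm₀ le_rfl,
      aeval_genericVector_eq_zero_iff]
    exact hF
  refine ⟨v i₀, E y, ?_⟩
  funext i
  have h1 : w i = E y * D (m i) := by rw [← hE i, hy.derivation_apply_eq hDy]
  have h2 : w i = v i - v i₀ * m i := rfl
  simp only [Pi.add_apply, Pi.smul_apply, smul_eq_mul, Function.comp_apply]
  rw [← h1, h2, add_sub_cancel]

end Tangent

/-! ### The intersection point of three planes -/

section CrossProduct

/-- The vector product of three vectors in a four-dimensional space: the coordinates of the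
intersection point of three planes are the maximal minors of their coefficient matrix. -/
def tripleCross {R : Type*} [CommRing R] (a b c : Fin 4 → R) : Fin 4 → R :=
  fun j => (Matrix.of ![a, b, c, Pi.single j 1]).det

theorem updateRow_three {R : Type*} (a b c v w : Fin 4 → R) :
    (Matrix.of ![a, b, c, v]).updateRow 3 w = Matrix.of ![a, b, c, w] := by
  ext i j
  fin_cases i <;> rfl

section CommRing

variable {R : Type*} [CommRing R] (a b c p : Fin 4 → R)

/-- Expansion of the determinant along the last row. -/
theorem tripleCross_dotProduct :
    dotProduct (tripleCross a b c) p = (Matrix.of ![a, b, c, p]).det := by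
  have h := ((Matrix.detRowAlternating (n := Fin 4) (R := R)).toMultilinearMap.toLinearMap
    ![a, b, c, 0] 3).pi_apply_eq_sum_univ p
  have h1 : ∀ w : Fin 4 → R,
      (Matrix.detRowAlternating (n := Fin 4) (R := R)).toMultilinearMap.toLinearMap
        ![a, b, c, 0] 3 w = (Matrix.of ![a, b, c, w]).det := fun w => by
    rw [← updateRow_three a b c 0 w]
    rfl
  rw [h1] at h
  rw [h]
  refine Finset.sum_congr rfl fun i _ => ?_
  have h2 : (fun j => if i = j then 1 else 0 : Fin 4 → R) = Pi.single i 1 := by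
    funext j
    simp [Pi.single_apply, eq_comm]
  rw [h1, smul_eq_mul, mul_comm, tripleCross, h2]

theorem tripleCross_dotProduct_left : dotProduct (tripleCross a b c) a = 0 := by
  rw [tripleCross_dotProduct]
  exact Matrix.det_zero_of_row_eq (i := 0) (j := 3) (by decide) rfl

theorem tripleCross_dotProduct_middle : dotProduct (tripleCross a b c) b = 0 := by
  rw [tripleCross_dotProduct]
  exact Matrix.det_zero_of_row_eq (i := 1) (j := 3) (by decide) rfl

theorem tripleCross_dotProduct_right : dotProduct (tripleCross a b c) c = 0 := by
  rw [tripleCross_dotProduct]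
  exact Matrix.det_zero_of_row_eq (i := 2) (j := 3) (by decide) rfl

variable {a b c p}

/-- Every solution of the three linear equations is proportional to their vector product. -/
theorem mul_tripleCross_eq (ha : dotProduct a p = 0) (hb : dotProduct b p = 0)
    (hc : dotProduct c p = 0) (i j : Fin 4) :
    p i * tripleCross a b c j = p j * tripleCross a b c i := by
  let M := Matrix.of ![a, b, c, Pi.single j 1]
  have h1 : M.mulVec p = Pi.single 3 (p j) := by
    funext k
    fin_cases k
    · exact ha
    · exact hb
    · exact hc
    · exact single_one_dotProduct j p
  have h2 : M.adjugate.mulVec (M.mulVec p) = M.det • p := by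
    rw [Matrix.mulVec_mulVec, Matrix.adjugate_mul, Matrix.smul_mulVec, Matrix.one_mulVec]
  have h3 := congrFun h2 i
  rw [h1, Matrix.mulVec_single] at h3
  simp only [Pi.smul_apply, Matrix.col_apply, Matrix.adjugate_apply, smul_eq_mul, M,
    updateRow_three, MulOpposite.smul_eq_mul_unop, MulOpposite.unop_op] at h3
  change tripleCross a b c i * p j = tripleCross a b c j * p i at h3
  rw [mul_comm, ← h3, mul_comm]

theorem map_tripleCross {S : Type*} [CommRing S] (f : R →+* S) (j : Fin 4) :
    f (tripleCross a b c j) = tripleCross (f ∘ a) (f ∘ b) (f ∘ c) j := by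
  rw [tripleCross, RingHom.map_det, tripleCross]
  congr 1
  ext i k
  fin_cases i <;> simp [Pi.single_apply, apply_ite f]

end CommRing

section Field

variable {K : Type*} [Field K] {a b c p : Fin 4 → K}

theorem tripleCross_ne_zero_iff : tripleCross a b c ≠ 0 ↔ LinearIndependent K ![a, b, c] := by
  have hdet : ∀ v, (Matrix.of ![a, b, c, v]).det ≠ 0 ↔ LinearIndependent K ![a, b, c, v] := by
    intro v
    rw [← isUnit_iff_ne_zero, ← Matrix.isUnit_iff_isUnit_det,
      ← Matrix.linearIndependent_rows_iff_isUnit]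
    rfl
  have hsnoc : ∀ v, (![a, b, c, v] : Fin 4 → Fin 4 → K) = Fin.snoc ![a, b, c] v := by
    intro v
    funext i
    fin_cases i <;> rfl
  constructor
  · intro h
    obtain ⟨j, hj⟩ := Function.ne_iff.mp h
    have := (hdet (Pi.single j 1)).mp hj
    rw [hsnoc, linearIndependent_finSnoc] at this
    exact this.1
  · intro h h0
    have hlt : Submodule.span K (Set.range ![a, b, c]) < ⊤ := by
      refine Submodule.lt_top_of_finrank_lt_finrank ?_
      rw [finrank_span_eq_card h]
      simp
    obtain ⟨v, -, hv⟩ := SetLike.exists_of_lt hlt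
    refine (hdet v).mpr ?_ ?_
    · rw [hsnoc, linearIndependent_finSnoc]
      exact ⟨h, hv⟩
    · rw [← tripleCross_dotProduct, h0, zero_dotProduct]

theorem mem_span_pair_of_tripleCross_eq_zero (hab : LinearIndependent K ![a, b])
    (h : tripleCross a b c = 0) : c ∈ Submodule.span K {a, b} := by
  by_contra hc
  refine tripleCross_ne_zero_iff.mpr ?_ h
  have : (![a, b, c] : Fin 3 → Fin 4 → K) = Fin.snoc ![a, b] c := by
    funext i
    fin_cases i <;> rfl
  rw [this, linearIndependent_finSnoc, Matrix.range_cons_cons_empty]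
  exact ⟨hab, hc⟩

theorem linearIndependent_pair_of_tripleCross_ne_zero (h : tripleCross a b c ≠ 0) :
    LinearIndependent K ![a, b] := by
  have := tripleCross_ne_zero_iff.mp h
  have h3 : (![a, b, c] : Fin 3 → Fin 4 → K) = Fin.snoc ![a, b] c := by
    funext i
    fin_cases i <;> rfl
  rw [h3, linearIndependent_finSnoc] at this
  exact this.1

/-- If all common zeros of finitely many linear forms lie in `W`, then there are at least as many
independent ones as the codimension of `W`. -/
theorem le_finrank_span_add_finrank {n r : ℕ} (f : Fin r → Fin n → K) (W : Submodule K (Fin n → K))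
    (hf : ∀ v, (∀ i, dotProduct (f i) v = 0) → v ∈ W) :
    n ≤ Module.finrank K (Submodule.span K (Set.range f)) + Module.finrank K W := by
  have h1 := (Matrix.of f).mulVecLin.finrank_range_add_finrank_ker
  have h2 : (Matrix.of f).rank = Module.finrank K (Submodule.span K (Set.range f)) :=
    Matrix.rank_eq_finrank_span_row _
  have h3 : (Matrix.of f).mulVecLin.ker ≤ W := fun v hv => hf v fun i => congrFun hv i
  have h4 := Submodule.finrank_mono h3
  rw [Matrix.rank] at h2
  rw [Module.finrank_fin_fun] at h1
  omega

theorem tripleCross_ne_zero_of_forall_mem_span (h : ∀ v, dotProduct a v = 0 → dotProduct b v = 0 →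
    dotProduct c v = 0 → v ∈ Submodule.span K {p}) : tripleCross a b c ≠ 0 := by
  rw [tripleCross_ne_zero_iff, linearIndependent_iff_card_le_finrank_span, Set.finrank]
  have h1 := le_finrank_span_add_finrank ![a, b, c] (Submodule.span K {p})
    fun v hv => h v (hv 0) (hv 1) (hv 2)
  have h2 : Module.finrank K (Submodule.span K {p}) ≤ 1 :=
    (finrank_span_le_card {p}).trans (by simp)
  exact (Fintype.card_fin 3).trans_le (by omega)

end Field

end CrossProduct

/-! ### The Halphen map is given by forms -/

section PolarRow

variable {R : Type*} [CommRing R] (b : Sym2 (Fin 4) → R)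

/-- The coefficients of the linear form `polarForm b u`. -/
def polarRow (u : Fin 4 → R) : Fin 4 → R := fun i => polarForm b u (Pi.single i 1)

theorem polarRow_dotProduct (u v : Fin 4 → R) : dotProduct (polarRow b u) v = polarForm b u v := by
  let l : (Fin 4 → R) →ₗ[R] R :=
    { toFun := polarForm b u
      map_add' := polarForm_add_right b u
      map_smul' := fun c v => polarForm_smul_right b c u v }
  refine Eq.trans ?_ (l.pi_apply_eq_sum_univ v).symm
  refine Finset.sum_congr rfl fun i _ => ?_
  have : (fun j => if i = j then 1 else 0 : Fin 4 → R) = Pi.single i 1 := by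
    funext j
    simp [Pi.single_apply, eq_comm]
  rw [this, smul_eq_mul, mul_comm]
  rfl

theorem map_polarRow {S : Type*} [CommRing S] (f : R →+* S) (u : Fin 4 → R) :
    f ∘ polarRow b u = polarRow (f ∘ b) (f ∘ u) := by
  funext i
  change f (polarForm _ _ _) = polarForm _ _ _
  rw [map_polarForm]
  congr 1
  funext j
  simp [Pi.single_apply, apply_ite f]

/-- The polar of `m` with respect to the quadric `q` is the plane conjugate to `m`. -/
theorem mem_polarPlane_quadraticFormOf_iff {q : ℙ ℂ (Sym2 (Fin 4) → ℂ)} {m p : ℙ ℂ (Fin 4 → ℂ)} :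
    p ∈ polarPlane (quadraticFormOf q) m ↔ dotProduct (polarRow q.rep m.rep) p.rep = 0 := by
  have h1 : ∀ s : Sym2 (Fin 4), ∑ i, m.rep i * MvPolynomial.eval p.rep (MvPolynomial.pderiv i
      (Sym2.lift ⟨fun i j => MvPolynomial.X i * MvPolynomial.X j, fun _ _ => mul_comm _ _⟩ s)) =
      polarMonomial s m.rep p.rep := by
    intro s
    induction s with
    | _ i j =>
      simp only [Sym2.lift_mk, Derivation.leibniz, MvPolynomial.pderiv_X, Pi.single_apply,
        smul_eq_mul, mul_ite, mul_one, mul_zero, map_add, apply_ite (MvPolynomial.eval p.rep),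
        MvPolynomial.eval_X, map_zero, mul_add, Finset.sum_add_distrib, Finset.sum_ite_eq,
        Finset.mem_univ, if_true, polarMonomial_mk]
      ring
  have h2 : ∑ i, m.rep i * gradAt (quadraticFormOf q) p i = polarForm q.rep m.rep p.rep := by
    simp only [gradAt, quadraticFormOf, map_sum, Derivation.leibniz, MvPolynomial.pderiv_C,
      smul_eq_mul, Finset.mul_sum]
    rw [Finset.sum_comm]
    refine Finset.sum_congr rfl fun s _ => ?_
    rw [← h1 s, Finset.mul_sum]
    refine Finset.sum_congr rfl fun i _ => ?_
    rw [mul_zero, add_zero, map_mul, MvPolynomial.eval_C]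
    exact mul_left_comm _ _ _
  rw [polarRow_dotProduct, ← h2]
  rfl

end PolarRow

section HalphenForms

/-- The forms that give the Halphen map at the points `x` where the planes tangent at `x` to the
surfaces `F = 0` and `G = 0` intersect in the tangent line: the vector product of the two gradients
and of the coefficients of the polar plane. -/
noncomputable def halphenForms (F G : MvPolynomial (Fin 4) ℂ) (b : Sym2 (Fin 4) → ℂ) :
    Fin 4 → MvPolynomial (Fin 4) ℂ :=
  tripleCross (fun i => MvPolynomial.pderiv i F) (fun i => MvPolynomial.pderiv i G)
    (polarRow (MvPolynomial.C ∘ b) MvPolynomial.X)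

variable {F G : MvPolynomial (Fin 4) ℂ}

/-- If the entries of each row are homogeneous of one degree, then so is the determinant. -/
theorem MvPolynomial.IsHomogeneous.det {σ R ι : Type*} [CommRing R] [Fintype ι] [DecidableEq ι]
    {M : Matrix ι ι (MvPolynomial σ R)} {r : ι → ℕ} (hM : ∀ i j, (M i j).IsHomogeneous (r i)) :
    M.det.IsHomogeneous (∑ i, r i) := by
  rw [Matrix.det_apply']
  refine MvPolynomial.IsHomogeneous.sum _ _ _ fun s _ => ?_
  have h1 : (∏ i, M (s i) i).IsHomogeneous (∑ i, r i) := by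
    rw [← Equiv.sum_comp s r]
    exact MvPolynomial.IsHomogeneous.prod _ _ _ fun i _ => hM _ _
  have h2 := (MvPolynomial.isHomogeneous_C σ ((Equiv.Perm.sign s : ℤ) : R)).mul h1
  rw [zero_add] at h2
  simpa using h2

theorem isHomogeneous_single_one {σ : Type*} (i k : Fin 4) :
    ((Pi.single i 1 : Fin 4 → MvPolynomial σ ℂ) k).IsHomogeneous 0 := by
  rw [Pi.single_apply]
  split_ifs
  · exact MvPolynomial.isHomogeneous_one _ _
  · exact MvPolynomial.isHomogeneous_zero _ _ _

theorem exists_isHomogeneous_tripleCross {a b c : Fin 4 → MvPolynomial (Fin 4) ℂ} {k l n : ℕ}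
    (ha : ∀ i, (a i).IsHomogeneous k) (hb : ∀ i, (b i).IsHomogeneous l)
    (hc : ∀ i, (c i).IsHomogeneous n) : ∃ d, ∀ j, (tripleCross a b c j).IsHomogeneous d := by
  refine ⟨_, fun j => MvPolynomial.IsHomogeneous.det (r := ![k, l, n, 0]) fun i i' => ?_⟩
  fin_cases i
  · exact ha i'
  · exact hb i'
  · exact hc i'
  · exact isHomogeneous_single_one j i'

theorem isHomogeneous_polarRow (b : Sym2 (Fin 4) → ℂ) (i : Fin 4) :
    (polarRow (MvPolynomial.C ∘ b) MvPolynomial.X i :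
      MvPolynomial (Fin 4) ℂ).IsHomogeneous 1 := by
  refine MvPolynomial.IsHomogeneous.sum _ _ _ fun s _ => ?_
  have h1 : (polarMonomial s MvPolynomial.X
      (Pi.single i 1 : Fin 4 → MvPolynomial (Fin 4) ℂ)).IsHomogeneous 1 := by
    induction s with
    | _ k l =>
      exact ((MvPolynomial.isHomogeneous_X ℂ k).mul (isHomogeneous_single_one i l)).add
        ((MvPolynomial.isHomogeneous_X ℂ l).mul (isHomogeneous_single_one i k))
  have h2 := (MvPolynomial.isHomogeneous_C (Fin 4) (b s)).mul h1
  rwa [zero_add] at h2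

theorem exists_isHomogeneous_halphenForms (hF : IsForm F) (hG : IsForm G)
    (b : Sym2 (Fin 4) → ℂ) : ∃ d, ∀ j, (halphenForms F G b j).IsHomogeneous d := by
  obtain ⟨k, hk⟩ := hF
  obtain ⟨l, hl⟩ := hG
  exact exists_isHomogeneous_tripleCross (fun i => hk.pderiv) (fun i => hl.pderiv)
    (isHomogeneous_polarRow b)

theorem map_halphenForms {K : Type*} [Field K] [Algebra ℂ K] (m : Fin 4 → K)
    (b : Sym2 (Fin 4) → ℂ) (j : Fin 4) :
    MvPolynomial.aeval m (halphenForms F G b j) =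
      tripleCross (fun i => MvPolynomial.aeval m (MvPolynomial.pderiv i F))
        (fun i => MvPolynomial.aeval m (MvPolynomial.pderiv i G))
        (polarRow (algebraMap ℂ K ∘ b) m) j := by
  have h := map_tripleCross (a := fun i => MvPolynomial.pderiv i F)
    (b := fun i => MvPolynomial.pderiv i G)
    (c := polarRow (MvPolynomial.C ∘ b) MvPolynomial.X)
    (MvPolynomial.aeval m : MvPolynomial (Fin 4) ℂ →ₐ[ℂ] K).toRingHom j
  refine h.trans ?_
  rw [map_polarRow]
  congr 2
  · funext s
    exact MvPolynomial.aeval_C m (b s)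
  · funext i
    exact MvPolynomial.aeval_X m i

theorem evalVec_halphenForms (b : Sym2 (Fin 4) → ℂ) (x : ℙ ℂ (Fin 4 → ℂ)) :
    evalVec (halphenForms F G b) x.rep =
      tripleCross (gradAt F x) (gradAt G x) (polarRow b x.rep) := by
  funext j
  have := map_halphenForms (F := F) (G := G) x.rep b j
  simp only [MvPolynomial.aeval_eq_eval] at this
  exact this

end HalphenForms

section Intersection

variable {C : Set (ℙ ℂ (Fin 4 → ℂ))}

theorem dotProduct_rep_mk_eq_zero_iff {σ : Type*} [Fintype σ] (a : σ → ℂ) {v : σ → ℂ}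
    (hv : v ≠ 0) :
    dotProduct a (Projectivization.mk ℂ v hv).rep = 0 ↔ dotProduct a v = 0 := by
  obtain ⟨c, hc⟩ := Projectivization.exists_smul_eq_mk_rep ℂ v hv
  rw [← hc, Units.smul_def, dotProduct_smul, smul_eq_mul, mul_eq_zero, or_iff_right c.ne_zero]

/-- Three independent planes intersect in the point given by their vector product. -/
theorem setOf_planes_eq_singleton {a b c : Fin 4 → ℂ} (h : tripleCross a b c ≠ 0) :
    {p : ℙ ℂ (Fin 4 → ℂ) | dotProduct a p.rep = 0 ∧ dotProduct b p.rep = 0 ∧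
      dotProduct c p.rep = 0} = {Projectivization.mk ℂ _ h} := by
  ext p
  rw [Set.mem_singleton_iff]
  constructor
  · rintro ⟨ha, hb, hc⟩
    rw [← p.mk_rep]
    refine Projectivization.mk_eq_mk_of_mul_eq _ _ fun i j => ?_
    exact mul_tripleCross_eq ha hb hc i j
  · rintro rfl
    refine ⟨?_, ?_, ?_⟩ <;> rw [dotProduct_rep_mk_eq_zero_iff, dotProduct_comm]
    · exact tripleCross_dotProduct_left a b c
    · exact tripleCross_dotProduct_middle a b c
    · exact tripleCross_dotProduct_right a b c

theorem tripleCross_ne_zero_of_planes_eq_singleton {a b c : Fin 4 → ℂ} {p : ℙ ℂ (Fin 4 → ℂ)}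
    (h : {p : ℙ ℂ (Fin 4 → ℂ) | dotProduct a p.rep = 0 ∧ dotProduct b p.rep = 0 ∧
      dotProduct c p.rep = 0} = {p}) : tripleCross a b c ≠ 0 := by
  refine tripleCross_ne_zero_of_forall_mem_span (p := p.rep) fun v ha hb hc => ?_
  by_cases hv : v = 0
  · rw [hv]; exact Submodule.zero_mem _
  have : Projectivization.mk ℂ v hv ∈ ({p} : Set _) := by
    rw [← h]
    exact ⟨(dotProduct_rep_mk_eq_zero_iff a hv).mpr ha, (dotProduct_rep_mk_eq_zero_iff b hv).mpr hb,
      (dotProduct_rep_mk_eq_zero_iff c hv).mpr hc⟩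
  rw [Set.mem_singleton_iff, ← p.mk_rep, Projectivization.mk_eq_mk_iff'] at this
  exact Submodule.mem_span_singleton.mpr this

/-- The intersection of the tangent line with the polar plane, for two equations whose differentials
span those of all equations. -/
theorem tangentLine_inter_polarPlane_eq {F G : MvPolynomial (Fin 4) ℂ} {x : ℙ ℂ (Fin 4 → ℂ)}
    (hF : F ∈ vanishingForms C) (hG : G ∈ vanishingForms C)
    (hspan : ∀ H ∈ vanishingForms C, gradAt H x ∈ Submodule.span ℂ {gradAt F x, gradAt G x})
    (q : ℙ ℂ (Sym2 (Fin 4) → ℂ)) :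
    tangentLine C x ∩ polarPlane (quadraticFormOf q) x =
      {p : ℙ ℂ (Fin 4 → ℂ) | dotProduct (gradAt F x) p.rep = 0 ∧
        dotProduct (gradAt G x) p.rep = 0 ∧ dotProduct (polarRow q.rep x.rep) p.rep = 0} := by
  ext p
  rw [Set.mem_inter_iff, mem_polarPlane_quadraticFormOf_iff, Set.mem_ofPred_eq, ← and_assoc]
  refine and_congr_left' ⟨fun h => ⟨h F hF, h G hG⟩, fun h H hH => ?_⟩
  obtain ⟨s, t, hst⟩ := Submodule.mem_span_pair.mp (hspan H hH)
  change dotProduct (gradAt H x) p.rep = 0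
  rw [← hst, add_dotProduct, smul_dotProduct, smul_dotProduct, h.1, h.2, smul_zero, smul_zero,
    add_zero]

theorem Set.exists_fun_fin_span_eq {K V : Type*} [Field K] [AddCommGroup V] [Module K V]
    [FiniteDimensional K V] {S : Set V} {n : ℕ}
    (h : Module.finrank K (Submodule.span K S) = n) :
    ∃ f : Fin n → V, (∀ i, f i ∈ S) ∧ Submodule.span K (Set.range f) = Submodule.span K S := by
  subst h
  obtain ⟨f, hf, hfs, -⟩ := Submodule.exists_fun_fin_finrank_span_eq K S
  exact ⟨f, hf, hfs⟩

/-- At every point of its domain the Halphen map is given by the forms `halphenForms F G q` for two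
suitable equations `F` and `G`. -/
theorem exists_halphenForms_of_mem_halphenMap {q : ℙ ℂ (Sym2 (Fin 4) → ℂ)}
    {x y : ℙ ℂ (Fin 4 → ℂ)} (hy : y ∈ halphenMap C (quadraticFormOf q) x) :
    x ∈ C ∧ ∃ F ∈ vanishingForms C, ∃ G ∈ vanishingForms C,
      ∃ h : evalVec (halphenForms F G q.rep) x.rep ≠ 0, y = Projectivization.mk ℂ _ h := by
  rw [mem_halphenMap] at hy
  obtain ⟨⟨hx, hrank⟩, hy⟩ := hy
  refine ⟨hx, ?_⟩
  obtain ⟨f, hf, hfs⟩ := Set.exists_fun_fin_span_eq hrank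
  obtain ⟨F, hF, hfF⟩ := hf 0
  obtain ⟨G, hG, hfG⟩ := hf 1
  have hrange : Set.range f = {gradAt F x, gradAt G x} := by
    rw [← hfF, ← hfG]
    ext v
    simp [Fin.exists_fin_two, eq_comm]
  rw [hrange] at hfs
  have hspan : ∀ H ∈ vanishingForms C,
      gradAt H x ∈ Submodule.span ℂ {gradAt F x, gradAt G x} := by
    intro H hH
    rw [hfs]
    exact Submodule.subset_span ⟨H, hH, rfl⟩
  rw [tangentLine_inter_polarPlane_eq hF hG hspan] at hy
  have h := tripleCross_ne_zero_of_planes_eq_singleton hy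
  rw [setOf_planes_eq_singleton h] at hy
  refine ⟨F, hF, G, hG, (evalVec_halphenForms _ _).trans_ne h, ?_⟩
  rw [← Set.singleton_injective hy]
  simp only [evalVec_halphenForms]

/-- The forms `halphenForms F G q` give the Halphen map wherever they do not vanish, provided that
the differentials of `F` and `G` span generically those of all equations. -/
theorem mk_evalVec_halphenForms_mem_halphenMap {F G : MvPolynomial (Fin 4) ℂ}
    (hF : F ∈ vanishingForms C) (hG : G ∈ vanishingForms C) {x : ℙ ℂ (Fin 4 → ℂ)} (hx : x ∈ C)
    (hFG : ∀ H ∈ vanishingForms C, tripleCross (gradAt F x) (gradAt G x) (gradAt H x) = 0)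
    {q : ℙ ℂ (Sym2 (Fin 4) → ℂ)} (h : evalVec (halphenForms F G q.rep) x.rep ≠ 0) :
    Projectivization.mk ℂ _ h ∈ halphenMap C (quadraticFormOf q) x := by
  have h' := h
  rw [evalVec_halphenForms] at h'
  have hli := linearIndependent_pair_of_tripleCross_ne_zero h'
  have hspan : ∀ H ∈ vanishingForms C,
      gradAt H x ∈ Submodule.span ℂ {gradAt F x, gradAt G x} :=
    fun H hH => mem_span_pair_of_tripleCross_eq_zero hli (hFG H hH)
  rw [mem_halphenMap]
  refine ⟨⟨hx, ?_⟩, ?_⟩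
  · have : Submodule.span ℂ {v : Fin 4 → ℂ | ∃ F ∈ vanishingForms C, v = gradAt F x} =
        Submodule.span ℂ (Set.range ![gradAt F x, gradAt G x]) := by
      rw [Matrix.range_cons_cons_empty]
      refine le_antisymm (Submodule.span_le.mpr ?_) (Submodule.span_mono ?_)
      · rintro _ ⟨H, hH, rfl⟩
        exact hspan H hH
      · rintro _ (rfl | rfl)
        · exact ⟨F, hF, rfl⟩
        · exact ⟨G, hG, rfl⟩
    rw [this, finrank_span_eq_card hli, Fintype.card_fin]
  · rw [tangentLine_inter_polarPlane_eq hF hG hspan, setOf_planes_eq_singleton h']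
    simp only [evalVec_halphenForms]

end Intersection

/-! ### The generic point of the Halphen transform -/

section Generic

variable {K : Type*} [Field K] [Algebra ℂ K] {C : Set (ℙ ℂ (Fin 4 → ℂ))} {m m' : Fin 4 → K}
  {i₀ : Fin 4} {F G H : MvPolynomial (Fin 4) ℂ}

/-- The gradient of `F` at a vector with entries in an extension of `ℂ`. -/
noncomputable def genericGrad (m : Fin 4 → K) (F : MvPolynomial (Fin 4) ℂ) : Fin 4 → K :=
  fun i => MvPolynomial.aeval m (MvPolynomial.pderiv i F)

/-- `m` is a generic point of `C`, normalised by `m i₀ = 1`, and the tangent line to `C` at `m` is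
the line through `m` and `m'`. -/
structure IsGenericTangent (C : Set (ℙ ℂ (Fin 4 → ℂ))) (i₀ : Fin 4) (m m' : Fin 4 → K) : Prop where
  isGenericVector : IsGenericVector m C
  apply_eq_one : m i₀ = 1
  deriv_apply_eq_zero : m' i₀ = 0
  deriv_ne_zero : m' ≠ 0
  dotProduct_deriv : ∀ F ∈ vanishingForms C, dotProduct (genericGrad m F) m' = 0
  mem_span : ∀ v, (∀ F ∈ vanishingForms C, dotProduct (genericGrad m F) v = 0) →
    v ∈ Submodule.span K {m, m'}

namespace IsGenericTangent

theorem dotProduct_self (h : IsGenericTangent C i₀ m m') (hF : F ∈ vanishingForms C) :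
    dotProduct (genericGrad m F) m = 0 := by
  obtain ⟨d, hd⟩ := hF.1
  exact hd.sum_pderiv_mul_eq_zero ((h.isGenericVector.aeval_eq_zero_iff F hF.1).mpr hF.2)

theorem ne_zero (h : IsGenericTangent C i₀ m m') : m ≠ 0 := fun h0 => by
  have := h.apply_eq_one
  simp [h0] at this

/-- Three planes that contain the tangent line are dependent. -/
theorem tripleCross_eq_zero_of_dotProduct (h : IsGenericTangent C i₀ m m') {a b c : Fin 4 → K}
    (ha : dotProduct a m = 0) (hb : dotProduct b m = 0) (hc : dotProduct c m = 0)
    (ha' : dotProduct a m' = 0) (hb' : dotProduct b m' = 0) (hc' : dotProduct c m' = 0) :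
    tripleCross a b c = 0 := by
  have h1 : ∀ j, tripleCross a b c j = m j * tripleCross a b c i₀ := fun j => by
    rw [← mul_tripleCross_eq ha hb hc i₀ j, h.apply_eq_one, one_mul]
  have h2 : tripleCross a b c i₀ = 0 := by
    obtain ⟨j, hj⟩ := Function.ne_iff.mp h.deriv_ne_zero
    have := mul_tripleCross_eq ha' hb' hc' i₀ j
    rw [h.deriv_apply_eq_zero, zero_mul, eq_comm, mul_eq_zero] at this
    exact this.resolve_left hj
  funext j
  rw [h1, h2, mul_zero, Pi.zero_apply]

/-- The differentials of the equations span a space of dimension at most two at the generic point,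
and therefore at every point. -/
theorem tripleCross_gradAt_eq_zero (h : IsGenericTangent C i₀ m m') (hF : F ∈ vanishingForms C)
    (hG : G ∈ vanishingForms C) (hH : H ∈ vanishingForms C) {x : ℙ ℂ (Fin 4 → ℂ)} (hx : x ∈ C) :
    tripleCross (gradAt F x) (gradAt G x) (gradAt H x) = 0 := by
  obtain ⟨k, hk⟩ := hF.1
  obtain ⟨l, hl⟩ := hG.1
  obtain ⟨n, hn⟩ := hH.1
  obtain ⟨d, hd⟩ := exists_isHomogeneous_tripleCross (fun i => hk.pderiv (i := i))
    (fun i => hl.pderiv (i := i)) (fun i => hn.pderiv (i := i))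
  funext j
  have h0 := h.isGenericVector.eval_eq_zero ⟨d, hd j⟩ ?_ hx
  · rw [map_tripleCross] at h0
    exact h0
  · refine (map_tripleCross (MvPolynomial.aeval m : _ →ₐ[ℂ] K).toRingHom j).trans ?_
    exact congrFun (h.tripleCross_eq_zero_of_dotProduct (h.dotProduct_self hF)
      (h.dotProduct_self hG) (h.dotProduct_self hH) (h.dotProduct_deriv F hF)
      (h.dotProduct_deriv G hG) (h.dotProduct_deriv H hH)) j

/-- The differentials of the equations span a space of dimension at least two at the generic point,
since the tangent space has dimension at most two. -/
theorem exists_linearIndependent_genericGrad (h : IsGenericTangent C i₀ m m') :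
    ∃ F ∈ vanishingForms C, ∃ G ∈ vanishingForms C,
      LinearIndependent K ![genericGrad m F, genericGrad m G] := by
  obtain ⟨f, hf, hfs, hfi⟩ := Submodule.exists_fun_fin_finrank_span_eq K
    {v : Fin 4 → K | ∃ F ∈ vanishingForms C, v = genericGrad m F}
  have h1 := le_finrank_span_add_finrank f (Submodule.span K {m, m'}) fun v hv =>
    h.mem_span v fun F hF => by
      have hmem : genericGrad m F ∈ Submodule.span K (Set.range f) := by
        rw [hfs]
        exact Submodule.subset_span ⟨F, hF, rfl⟩
      generalize genericGrad m F = w at hmem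
      induction hmem using Submodule.span_induction with
      | mem w hw =>
        obtain ⟨i, rfl⟩ := hw
        exact hv i
      | zero => exact zero_dotProduct v
      | add w w' _ _ hw hw' => rw [add_dotProduct, hw, hw', add_zero]
      | smul c w _ hw => rw [smul_dotProduct, hw, smul_zero]
  have h2 : Module.finrank K (Submodule.span K {m, m'}) ≤ 2 := by
    classical
    refine (finrank_span_le_card {m, m'}).trans ?_
    rw [Set.toFinset_insert, Set.toFinset_singleton]
    exact Finset.card_le_two
  rw [hfs] at h1
  have h3 : 2 ≤ Module.finrank K (Submodule.span K
    {v : Fin 4 → K | ∃ F ∈ vanishingForms C, v = genericGrad m F}) := by omega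
  obtain ⟨F, hF, hfF⟩ := hf (Fin.castLE h3 0)
  obtain ⟨G, hG, hfG⟩ := hf (Fin.castLE h3 1)
  refine ⟨F, hF, G, hG, ?_⟩
  have h4 := hfi.comp (Fin.castLE h3) (Fin.castLE_injective h3)
  have h5 : f ∘ Fin.castLE h3 = ![genericGrad m F, genericGrad m G] := by
    funext i
    fin_cases i
    · exact hfF
    · exact hfG
  rwa [h5] at h4

variable {b : Sym2 (Fin 4) → ℂ}

/-- At the generic point, the forms `halphenForms F G b` give a multiple of `halphenVector`. -/
theorem exists_aeval_halphenForms_eq (h : IsGenericTangent C i₀ m m') (hF : F ∈ vanishingForms C)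
    (hG : G ∈ vanishingForms C) (hb : halphenVector (algebraMap ℂ K ∘ b) m m' ≠ 0) :
    ∃ c : K, ∀ j, MvPolynomial.aeval m (halphenForms F G b j) =
      c * halphenVector (algebraMap ℂ K ∘ b) m m' j := by
  set p := halphenVector (algebraMap ℂ K ∘ b) m m' with hp
  have hdot : ∀ a : Fin 4 → K, dotProduct a m = 0 → dotProduct a m' = 0 →
      dotProduct a p = 0 := fun a ha ha' => by
    rw [hp, halphenVector, dotProduct_sub, dotProduct_smul, dotProduct_smul, ha, ha', smul_zero,
      smul_zero, sub_zero]
  have hc : dotProduct (polarRow (algebraMap ℂ K ∘ b) m) p = 0 := by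
    rw [hp, halphenVector, dotProduct_sub, dotProduct_smul, dotProduct_smul, polarRow_dotProduct,
      polarRow_dotProduct, smul_eq_mul, smul_eq_mul, mul_comm, sub_self]
  obtain ⟨i, hi⟩ := Function.ne_iff.mp hb
  refine ⟨MvPolynomial.aeval m (halphenForms F G b i) / p i, fun j => ?_⟩
  have := mul_tripleCross_eq (hdot _ (h.dotProduct_self hF) (h.dotProduct_deriv F hF))
    (hdot _ (h.dotProduct_self hG) (h.dotProduct_deriv G hG)) hc i j
  rw [div_mul_eq_mul_div, eq_div_iff hi, map_halphenForms, map_halphenForms, mul_comm,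
    mul_comm _ (p j)]
  exact this

/-- If the differentials of `F` and `G` are independent at the generic point, then the forms
`halphenForms F G b` do not vanish there. -/
theorem exists_aeval_halphenForms_ne_zero (h : IsGenericTangent C i₀ m m')
    (hFG : LinearIndependent K ![genericGrad m F, genericGrad m G])
    (hF : F ∈ vanishingForms C) (hG : G ∈ vanishingForms C)
    (hb : halphenVector (algebraMap ℂ K ∘ b) m m' ≠ 0) :
    ∃ j, MvPolynomial.aeval m (halphenForms F G b j) ≠ 0 := by
  by_contra! hcon
  have h0 : tripleCross (genericGrad m F) (genericGrad m G)
      (polarRow (algebraMap ℂ K ∘ b) m) = 0 := by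
    funext j
    rw [Pi.zero_apply, ← hcon j, map_halphenForms]
    rfl
  obtain ⟨s, t, hst⟩ := Submodule.mem_span_pair.mp (mem_span_pair_of_tripleCross_eq_zero hFG h0)
  refine hb ?_
  rw [halphenVector, ← polarRow_dotProduct, ← polarRow_dotProduct, ← hst]
  simp only [add_dotProduct, smul_dotProduct, h.dotProduct_self hF, h.dotProduct_self hG,
    h.dotProduct_deriv F hF, h.dotProduct_deriv G hG, smul_zero, add_zero, zero_smul, sub_zero]

/-- The point `halphenVector q m m'` is a generic point of the Halphen transform. -/
theorem isGenericVector_halphenTransform (h : IsGenericTangent C i₀ m m')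
    {q : ℙ ℂ (Sym2 (Fin 4) → ℂ)}
    (hq : halphenVector (algebraMap ℂ K ∘ q.rep) m m' ≠ 0) :
    IsGenericVector (halphenVector (algebraMap ℂ K ∘ q.rep) m m')
      (halphenTransform C (quadraticFormOf q)) := by
  refine ⟨isClosed_closure, fun R hR => ⟨fun hR0 => ?_, fun hR0 => ?_⟩⟩
  · intro y hy
    refine (mem_closure_iff_forms.mp hy) R ⟨hR, ?_⟩
    rintro y ⟨x, hxy⟩
    obtain ⟨hx, F, hF, G, hG, hne, rfl⟩ := exists_halphenForms_of_mem_halphenMap hxy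
    obtain ⟨d, hd⟩ := exists_isHomogeneous_halphenForms hF.1 hG.1 q.rep
    obtain ⟨c, hc⟩ := h.exists_aeval_halphenForms_eq hF hG hq
    obtain ⟨e, he⟩ := hR
    rw [eval_rep_mk_eq_zero_iff ⟨e, he⟩, eval_evalVec]
    refine h.isGenericVector.eval_eq_zero ⟨_, he.aeval _ hd⟩ ?_ hx
    rw [aeval_aeval_vec, funext hc]
    refine (he.aeval_smul c _).trans ?_
    rw [hR0, mul_zero]
  · obtain ⟨F, hF, G, hG, hFG⟩ := h.exists_linearIndependent_genericGrad
    obtain ⟨j, hj⟩ := h.exists_aeval_halphenForms_ne_zero hFG hF hG hq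
    obtain ⟨d, hd⟩ := exists_isHomogeneous_halphenForms hF.1 hG.1 q.rep
    obtain ⟨c, hc⟩ := h.exists_aeval_halphenForms_eq hF hG hq
    obtain ⟨e, he⟩ := hR
    -- a form vanishing on the image pulls back to a form vanishing where `halphenForms` does not
    have h1 : MvPolynomial.aeval m
        (MvPolynomial.aeval (halphenForms F G q.rep) R * halphenForms F G q.rep j) = 0 := by
      rw [h.isGenericVector.aeval_eq_zero_iff _ ⟨_, (he.aeval _ hd).mul (hd j)⟩]
      intro x hx
      rw [map_mul, mul_eq_zero, or_iff_not_imp_right]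
      intro hxj
      have hne : evalVec (halphenForms F G q.rep) x.rep ≠ 0 := Function.ne_iff.mpr ⟨j, hxj⟩
      have hmem := mk_evalVec_halphenForms_mem_halphenMap hF hG hx
        (fun H hH => h.tripleCross_gradAt_eq_zero hF hG hH hx) hne
      rw [← eval_evalVec, ← eval_rep_mk_eq_zero_iff ⟨e, he⟩ hne]
      exact hR0 _ (subset_closure ⟨x, hmem⟩)
    rw [map_mul, mul_eq_zero, or_iff_left hj, aeval_aeval_vec, funext hc] at h1
    have h2 := (he.aeval_smul c (halphenVector (algebraMap ℂ K ∘ q.rep) m m')).symm.trans h1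
    refine (mul_eq_zero.mp h2).resolve_left (pow_ne_zero _ fun hc0 => hj ?_)
    rw [hc, hc0, zero_mul]

/-- If the generic point of the curve can be expressed by forms in the generic point of the Halphen
transform, then the Halphen map is birational. -/
theorem isBirational_halphenMap (h : IsGenericTangent C i₀ m m') {q : ℙ ℂ (Sym2 (Fin 4) → ℂ)}
    (hq : halphenVector (algebraMap ℂ K ∘ q.rep) m m' ≠ 0) {Ψ : Fin 4 → MvPolynomial (Fin 4) ℂ}
    {e : ℕ} {c' : K} (hΨ : ∀ i, (Ψ i).IsHomogeneous e) (hc' : c' ≠ 0)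
    (hΨm : ∀ i, MvPolynomial.aeval (halphenVector (algebraMap ℂ K ∘ q.rep) m m') (Ψ i) =
      c' * m i) :
    IsBirational (halphenMap C (quadraticFormOf q)) C (halphenTransform C (quadraticFormOf q)) := by
  obtain ⟨F, hF, G, hG, hFG⟩ := h.exists_linearIndependent_genericGrad
  obtain ⟨j, hj⟩ := h.exists_aeval_halphenForms_ne_zero hFG hF hG hq
  obtain ⟨d, hd⟩ := exists_isHomogeneous_halphenForms hF.1 hG.1 q.rep
  obtain ⟨c, hc⟩ := h.exists_aeval_halphenForms_eq hF hG hq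
  exact h.isGenericVector.isBirational (h.isGenericVector_halphenTransform hq) h.ne_zero hq hd hc
    hΨ hΨm (fun hc0 => hj (by rw [hc, hc0, zero_mul])) hc' _ fun x hx hne =>
      mk_evalVec_halphenForms_mem_halphenMap hF hG hx
        (fun H hH => h.tripleCross_gradAt_eq_zero hF hG hH hx) hne

end IsGenericTangent

end Generic

/-- The function field of an irreducible curve, with the generic point and its tangent line. -/
theorem IsIrreducibleCurve.exists_isGenericTangent {C : Set (ℙ ℂ (Fin 4 → ℂ))}
    (hC : IsIrreducibleCurve C) :
    ∃ (K : Type) (_ : Field K) (_ : Algebra ℂ K) (y : K) (D : Derivation ℂ K K) (m : Fin 4 → K)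
      (i₀ : Fin 4), IsTranscendenceBasis ℂ (fun _ : Unit => y) ∧ D y = 1 ∧
        IsGenericTangent C i₀ m (D ∘ m) := by
  obtain ⟨i₀, J, hJ, h1, hJC⟩ := hC.isIrreducible.exists_prime_ideal
  have hm : IsGenericVector (genericVector J) C :=
    ⟨hC.isClosed, fun F hF => by rw [aeval_genericVector_eq_zero_iff, hJC F hF]⟩
  obtain ⟨F₁, hF₁⟩ := hC.exists_isTranscendenceBasis h1 hm
  obtain ⟨D, hD⟩ := hF₁.exists_derivation fun _ : Unit =>
    (1 : FractionRing (MvPolynomial (Fin 4) ℂ ⧸ J))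
  have hD1 := hD ()
  refine ⟨FractionRing (MvPolynomial (Fin 4) ℂ ⧸ J), inferInstance, inferInstance, _, D,
    genericVector J, i₀, hF₁, hD1, hm, genericVector_eq_one h1, ?_, ?_, ?_, ?_⟩
  · rw [Function.comp_apply, genericVector_eq_one h1, D.map_one_eq_zero]
  · -- if `D` killed the coordinates, it would kill the transcendence basis
    intro h0
    rw [D.apply_aeval_eq_sum, Finset.sum_eq_zero] at hD1
    · exact zero_ne_one hD1
    · intro i _
      rw [show D (genericVector J i) = 0 from congrFun h0 i, mul_zero]
  · intro F hF
    refine (D.apply_aeval_eq_sum _ F).symm.trans ?_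
    rw [(hm.aeval_eq_zero_iff F hF.1).mpr hF.2, map_zero]
  · intro v hv
    obtain ⟨a, b, hab⟩ := exists_eq_add_of_tangent h1 hm hF₁ hD1 hv
    exact Submodule.mem_span_pair.mpr ⟨a, b, hab.symm⟩

/-! ### Nondegenerate quadrics -/

section Hessian

/-- The matrix of the polar form. -/
def polarMatrix {R : Type*} [CommRing R] (b : Sym2 (Fin 4) → R) : Matrix (Fin 4) (Fin 4) R :=
  Matrix.of fun i => polarRow b (Pi.single i 1)

theorem polarMatrix_mulVec {R : Type*} [CommRing R] (b : Sym2 (Fin 4) → R) (u : Fin 4 → R)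
    (i : Fin 4) : (polarMatrix b).mulVec u i = polarForm b u (Pi.single i 1) := by
  rw [polarForm_comm]
  exact polarRow_dotProduct b (Pi.single i 1) u

/-- The matrix of the polar form of `∑ i, X i ^ 2`. -/
theorem polarMatrix_diag :
    polarMatrix (fun s : Sym2 (Fin 4) => if s.IsDiag then (1 : ℂ) else 0) =
      Matrix.diagonal fun _ => 2 := by
  have hterm : ∀ (i j : Fin 4) (s : Sym2 (Fin 4)), s ≠ s(i, i) →
      (if s.IsDiag then (1 : ℂ) else 0) * polarMonomial s (Pi.single i 1) (Pi.single j 1) = 0 := by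
    intro i j s hs
    induction s with
    | _ k l =>
      by_cases hkl : k = l
      · subst hkl
        have hik : k ≠ i := fun h => hs (by rw [h])
        simp [hik]
      · simp [hkl]
  ext i j
  rw [polarMatrix, Matrix.of_apply, polarRow, polarForm,
    Finset.sum_eq_single s(i, i) (fun s _ hs => hterm i j s hs) (by simp)]
  by_cases hij : i = j
  · subst hij
    simp
    norm_num
  · simp [hij]

variable {q : ℙ ℂ (Sym2 (Fin 4) → ℂ)}

theorem eval_quadraticFormOf (u : Fin 4 → ℂ) :
    MvPolynomial.eval u (quadraticFormOf q) =
      ∑ s, q.rep s * Sym2.lift ⟨fun i j => u i * u j, fun _ _ => mul_comm _ _⟩ s := by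
  rw [quadraticFormOf, map_sum]
  refine Finset.sum_congr rfl fun s _ => ?_
  rw [map_mul, MvPolynomial.eval_C]
  congr 1
  induction s with
  | _ i j => simp

theorem polarForm_eq_eval_add_sub (u v : Fin 4 → ℂ) :
    polarForm q.rep u v = MvPolynomial.eval (u + v) (quadraticFormOf q) -
      MvPolynomial.eval u (quadraticFormOf q) - MvPolynomial.eval v (quadraticFormOf q) := by
  simp only [eval_quadraticFormOf, polarForm, ← Finset.sum_sub_distrib]
  refine Finset.sum_congr rfl fun s _ => ?_
  induction s with
  | _ i j => simp only [polarMonomial_mk, Sym2.lift_mk, Pi.add_apply]; ring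

theorem totalDegree_quadraticFormOf_le : (quadraticFormOf q).totalDegree ≤ 2 := by
  refine MvPolynomial.totalDegree_finsetSum_le fun s _ => ?_
  refine (MvPolynomial.totalDegree_mul _ _).trans ?_
  rw [MvPolynomial.totalDegree_C, zero_add]
  induction s with
  | _ i j =>
    refine (MvPolynomial.totalDegree_mul _ _).trans ?_
    rw [MvPolynomial.totalDegree_X, MvPolynomial.totalDegree_X]

theorem exists_eval_add_eq_of_totalDegree_le_one {σ : Type*} [Fintype σ] {F : MvPolynomial σ ℂ}
    (hF : F.totalDegree ≤ 1) :
    ∃ f : σ → ℂ, ∀ u v, MvPolynomial.eval (u + v) F = dotProduct f u + MvPolynomial.eval v F := by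
  have h1 := MvPolynomial.homogeneousComponent_isHomogeneous 1 F
  have hf : ∀ i, ∃ a, MvPolynomial.pderiv i (MvPolynomial.homogeneousComponent 1 F) =
      MvPolynomial.C a := fun i =>
    ⟨_, MvPolynomial.totalDegree_eq_zero_iff_eq_C.mp (Nat.le_zero.mp h1.pderiv.totalDegree_le)⟩
  choose f hf using hf
  have h2 : MvPolynomial.homogeneousComponent 1 F =
      ∑ i, MvPolynomial.X i * MvPolynomial.C (f i) := by
    have := h1.sum_X_mul_pderiv
    rw [one_smul] at this
    rw [← this]
    exact Finset.sum_congr rfl fun i _ => by rw [hf]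
  refine ⟨f, fun u v => ?_⟩
  rw [← sum_range_homogeneousComponent hF, Finset.sum_range_succ, Finset.sum_range_one, h2,
    MvPolynomial.homogeneousComponent_zero]
  simp only [map_add, map_sum, map_mul, MvPolynomial.eval_C, MvPolynomial.eval_X, Pi.add_apply,
    dotProduct, add_mul, Finset.sum_add_distrib, mul_comm (f _)]
  ring

/-- A nondegenerate quadratic form in four variables is irreducible: a product of two polynomials of
degree one is invariant under translation by a common zero of their linear parts, which then lies in
the kernel of the polar form. -/
theorem irreducible_quadraticFormOf (h : (polarMatrix q.rep).det ≠ 0) :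
    Irreducible (quadraticFormOf q) := by
  have h0 : MvPolynomial.eval 0 (quadraticFormOf q) = 0 := by
    rw [eval_quadraticFormOf]
    refine Finset.sum_eq_zero fun s _ => ?_
    induction s with
    | _ i j => simp
  have hQ : quadraticFormOf q ≠ 0 := by
    intro hQ
    refine h (Matrix.exists_mulVec_eq_zero_iff.mp ⟨Pi.single 0 1, by simp, ?_⟩)
    funext i
    rw [polarMatrix_mulVec, polarForm_eq_eval_add_sub, hQ]
    simp
  constructor
  · intro hu
    have := hu.map (MvPolynomial.eval (0 : Fin 4 → ℂ))
    rw [h0] at this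
    exact not_isUnit_zero this
  · intro F G hFG
    have hF0 : F ≠ 0 := fun h => hQ (by rw [hFG, h, zero_mul])
    have hG0 : G ≠ 0 := fun h => hQ (by rw [hFG, h, mul_zero])
    have hunit : ∀ H : MvPolynomial (Fin 4) ℂ, H ≠ 0 → H.totalDegree = 0 → IsUnit H := by
      intro H hH hd
      rw [MvPolynomial.totalDegree_eq_zero_iff_eq_C] at hd
      rw [hd] at hH ⊢
      refine IsUnit.map MvPolynomial.C (isUnit_iff_ne_zero.mpr fun h => hH ?_)
      rw [h, map_zero]
    by_contra! hcon
    have hdF : F.totalDegree ≠ 0 := fun h => hcon.1 (hunit F hF0 h)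
    have hdG : G.totalDegree ≠ 0 := fun h => hcon.2 (hunit G hG0 h)
    have hdeg := totalDegree_quadraticFormOf_le (q := q)
    rw [hFG, MvPolynomial.totalDegree_mul_of_isDomain hF0 hG0] at hdeg
    obtain ⟨f, hf⟩ := exists_eval_add_eq_of_totalDegree_le_one (F := F) (by omega)
    obtain ⟨g, hg⟩ := exists_eval_add_eq_of_totalDegree_le_one (F := G) (by omega)
    obtain ⟨u, hu0, hfu, hgu⟩ : ∃ u : Fin 4 → ℂ, u ≠ 0 ∧ dotProduct f u = 0 ∧
        dotProduct g u = 0 := by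
      by_contra! hu
      have h1 := le_finrank_span_add_finrank ![f, g] ⊥ fun v hv => by
        rw [Submodule.mem_bot]
        by_contra hv0
        exact hu v hv0 (hv 0) (hv 1)
      have h2 := finrank_range_le_card (R := ℂ) ![f, g]
      rw [finrank_bot] at h1
      rw [Set.finrank, Fintype.card_fin] at h2
      omega
    have hinv : ∀ v, MvPolynomial.eval (u + v) (quadraticFormOf q) =
        MvPolynomial.eval v (quadraticFormOf q) := fun v => by
      rw [hFG, map_mul, map_mul, hf, hg, hfu, hgu, zero_add, zero_add]
    have hu : MvPolynomial.eval u (quadraticFormOf q) = 0 := by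
      rw [← add_zero u, hinv, h0]
    refine h (Matrix.exists_mulVec_eq_zero_iff.mp ⟨u, hu0, ?_⟩)
    funext i
    rw [polarMatrix_mulVec, polarForm_eq_eval_add_sub, hinv, hu]
    simp

end Hessian

/-! ### The open set of quadrics -/

/-- The discriminant of the quadrics, as a form in their coefficients. -/
noncomputable def discriminantForm : MvPolynomial (Sym2 (Fin 4)) ℂ :=
  (polarMatrix (MvPolynomial.X : Sym2 (Fin 4) → MvPolynomial (Sym2 (Fin 4)) ℂ)).det

theorem eval_discriminantForm (b : Sym2 (Fin 4) → ℂ) :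
    MvPolynomial.eval b discriminantForm = (polarMatrix b).det := by
  rw [discriminantForm, RingHom.map_det]
  congr 1
  ext i j
  have h := congrFun (map_polarRow (MvPolynomial.X : Sym2 (Fin 4) → MvPolynomial (Sym2 (Fin 4)) ℂ)
    (MvPolynomial.eval b) (Pi.single i 1)) j
  refine h.trans ?_
  have h1 : ⇑(MvPolynomial.eval b) ∘ (MvPolynomial.X : Sym2 (Fin 4) → _) = b :=
    funext fun s => MvPolynomial.eval_X s
  have h2 : ⇑(MvPolynomial.eval b) ∘
      (Pi.single i 1 : Fin 4 → MvPolynomial (Sym2 (Fin 4)) ℂ) = Pi.single i 1 := by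
    funext k
    simp [Pi.single_apply, apply_ite (MvPolynomial.eval b)]
  rw [h1, h2]
  rfl

theorem isHomogeneous_discriminantForm : discriminantForm.IsHomogeneous 4 := by
  refine MvPolynomial.IsHomogeneous.det (r := fun _ => 1) fun i j => ?_
  refine MvPolynomial.IsHomogeneous.sum (Finset.univ : Finset (Sym2 (Fin 4))) _ 1 fun s _ => ?_
  refine (MvPolynomial.isHomogeneous_X ℂ s).mul (n := 0) ?_
  induction s with
  | _ k l =>
    exact ((isHomogeneous_single_one i k).mul (isHomogeneous_single_one j l)).add
      ((isHomogeneous_single_one i l).mul (isHomogeneous_single_one j k))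

theorem discriminantForm_ne_zero : discriminantForm ≠ 0 := by
  intro h
  have := eval_discriminantForm fun s : Sym2 (Fin 4) => if s.IsDiag then (1 : ℂ) else 0
  rw [h, map_zero, polarMatrix_diag, Matrix.det_diagonal] at this
  norm_num at this

/-- A nonzero polynomial over `K` does not vanish at the points over `k` where a suitable nonzero
polynomial over `k` does not vanish: apply a linear functional to the coefficients. -/
theorem MvPolynomial.exists_ne_zero_eval_algebraMap_ne_zero {k K τ : Type*} [Field k] [Field K]
    [Algebra k K] {P : MvPolynomial τ K} (hP : P ≠ 0) :
    ∃ P' : MvPolynomial τ k, P' ≠ 0 ∧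
      ∀ q : τ → k, eval q P' ≠ 0 → eval (algebraMap k K ∘ q) P ≠ 0 := by
  classical
  obtain ⟨d₀, hd₀⟩ := MvPolynomial.ne_zero_iff.mp hP
  obtain ⟨l, hl⟩ : ∃ l : Module.Dual k K, l (coeff d₀ P) ≠ 0 := by
    by_contra! hcon
    exact hd₀ ((Module.forall_dual_apply_eq_zero_iff k _).mp hcon)
  refine ⟨∑ d ∈ P.support, monomial d (l (coeff d P)), fun h0 => hl ?_, fun q hq hPq => hq ?_⟩
  · have := congrArg (coeff d₀) h0
    rw [coeff_sum, Finset.sum_eq_single d₀] at this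
    · simpa using this
    · intro d _ hd
      rw [coeff_monomial, if_neg hd]
    · intro hd
      rw [coeff_monomial, if_pos rfl, MvPolynomial.notMem_support_iff.mp hd, map_zero]
  · rw [map_sum, ← map_zero l, ← hPq, MvPolynomial.eval_eq, map_sum]
    refine Finset.sum_congr rfl fun d _ => ?_
    have : coeff d P * ∏ i ∈ d.support, (algebraMap k K ∘ q) i ^ d i =
        (∏ i ∈ d.support, q i ^ d i) • coeff d P := by
      rw [Algebra.smul_def, map_prod, mul_comm]
      simp
    rw [this, map_smul, eval_monomial, smul_eq_mul, mul_comm]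
    rfl

/-- If a homogeneous component of `P` does not vanish at `v`, then `P` does not vanish at some
multiple of `v`. -/
theorem MvPolynomial.exists_eval_smul_ne_zero {k τ : Type*} [Field k] [Infinite k]
    {P : MvPolynomial τ k} {n : ℕ} {v : τ → k} (h : eval v (homogeneousComponent n P) ≠ 0) :
    ∃ t : k, t ≠ 0 ∧ eval (t • v) P ≠ 0 := by
  by_contra! hcon
  let p : Polynomial k := ∑ d ∈ Finset.range (P.totalDegree + 1),
    Polynomial.C (eval v (homogeneousComponent d P)) * Polynomial.X ^ d
  have hp : ∀ t, p.eval t = eval (t • v) P := by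
    intro t
    conv_rhs => rw [← sum_range_homogeneousComponent (F := P) le_rfl]
    rw [map_sum, Polynomial.eval_finsetSum]
    refine Finset.sum_congr rfl fun d _ => ?_
    rw [(homogeneousComponent_isHomogeneous d P).eval_smul]
    rw [Polynomial.eval_mul, Polynomial.eval_C, Polynomial.eval_pow, Polynomial.eval_X, mul_comm]
  have hXp : Polynomial.X * p = 0 := by
    refine Polynomial.funext fun t => ?_
    rw [Polynomial.eval_mul, Polynomial.eval_X, Polynomial.eval_zero, hp, mul_eq_zero,
      or_iff_not_imp_left]
    exact hcon t
  have hp0 : p = 0 := (mul_eq_zero.mp hXp).resolve_left Polynomial.X_ne_zero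
  have hn : n < P.totalDegree + 1 := by
    by_contra hn
    exact h (by rw [homogeneousComponent_eq_zero n P (by omega), map_zero])
  have := congrArg (fun p => p.coeff n) hp0
  simp only [p, Polynomial.finsetSum_coeff, Polynomial.coeff_C_mul, Polynomial.coeff_X_pow,
    mul_ite, mul_one, mul_zero, Finset.sum_ite_eq, Finset.mem_range, hn, if_true,
    Polynomial.coeff_zero] at this
  exact h this

theorem halphenVector_smul {τ R : Type*} [Fintype τ] [DecidableEq τ] [CommRing R] (t : R)
    (b : Sym2 τ → R) (m m' : τ → R) :
    halphenVector (t • b) m m' = t • halphenVector b m m' := by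
  have : ∀ u v, polarForm (t • b) u v = t * polarForm b u v := fun u v => by
    simp only [polarForm, Finset.mul_sum, Pi.smul_apply, smul_eq_mul, mul_assoc]
  rw [halphenVector, halphenVector, this, this, smul_sub, mul_smul, mul_smul]

theorem mainTheorem2 (C : Set (ℙ ℂ (Fin 4 → ℂ))) (hC : IsIrreducibleCurve C) :
    ∃ G : Set (ℙ ℂ (Sym2 (Fin 4) → ℂ)), IsOpen G ∧ G.Nonempty ∧
      ∀ q ∈ G, Irreducible (quadraticFormOf q) ∧
        IsBirational (halphenMap C (quadraticFormOf q)) C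
          (halphenTransform C (quadraticFormOf q)) := by
  obtain ⟨K, _, _, y, D, m, i₀, hy, hDy, hT⟩ := hC.exists_isGenericTangent
  obtain ⟨P, hP, hPq⟩ := exists_inverse_forms hy D hDy hT.apply_eq_one
    (Function.ne_iff.mp hT.deriv_ne_zero)
  obtain ⟨P', hP', hP'q⟩ := MvPolynomial.exists_ne_zero_eval_algebraMap_ne_zero (k := ℂ) hP
  obtain ⟨n, hn⟩ : ∃ n, MvPolynomial.homogeneousComponent n P' ≠ 0 := by
    by_contra! hcon
    refine hP' ?_
    rw [← P'.sum_homogeneousComponent]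
    exact Finset.sum_eq_zero fun n _ => hcon n
  have hform := (MvPolynomial.homogeneousComponent_isHomogeneous n P').mul
    isHomogeneous_discriminantForm
  refine ⟨{q | MvPolynomial.eval q.rep
    (MvPolynomial.homogeneousComponent n P' * discriminantForm) ≠ 0},
    isOpen_setOf_eval_ne_zero ⟨_, hform⟩, ?_, fun q hq => ?_⟩
  · obtain ⟨v, hv⟩ : ∃ v, MvPolynomial.eval v
        (MvPolynomial.homogeneousComponent n P' * discriminantForm) ≠ 0 := by
      by_contra! hcon
      exact mul_ne_zero hn discriminantForm_ne_zero
        (MvPolynomial.funext fun v => (hcon v).trans (map_zero _).symm)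
    have hv0 : v ≠ 0 := by
      rintro rfl
      have := isHomogeneous_discriminantForm.eval_smul 0 0
      rw [zero_smul, zero_pow four_ne_zero, zero_mul] at this
      rw [map_mul, this, mul_zero] at hv
      exact hv rfl
    exact ⟨Projectivization.mk ℂ v hv0, fun h => hv ((eval_rep_mk_eq_zero_iff ⟨_, hform⟩ hv0).mp h)⟩
  · rw [Set.mem_ofPred_eq, map_mul, mul_ne_zero_iff, eval_discriminantForm] at hq
    refine ⟨irreducible_quadraticFormOf hq.2, ?_⟩
    obtain ⟨t, ht, hPt⟩ := MvPolynomial.exists_eval_smul_ne_zero hq.1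
    obtain ⟨hne, e, Ψ, c, hΨ, hc, hΨm⟩ := hPq _ (hP'q _ hPt)
    have hsmul : algebraMap ℂ K ∘ (t • q.rep) = algebraMap ℂ K t • (algebraMap ℂ K ∘ q.rep) := by
      funext s
      simp
    rw [hsmul, halphenVector_smul] at hne hΨm
    have ht' : algebraMap ℂ K t ^ e ≠ 0 := pow_ne_zero _ (by simpa using ht)
    refine hT.isBirational_halphenMap (right_ne_zero_of_smul hne) hΨ (div_ne_zero hc ht')
      fun i => ?_
    rw [div_mul_eq_mul_div, eq_div_iff ht', ← hΨm i, (hΨ i).aeval_smul, mul_comm]
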